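/- **Setting.** Let $l(x,d)$, $x\in\mathbb R^m$, be a loss that is differentiable in $x$, let $d\sim\mathcal D$, and let $\phi(x)=\mathbb E_{d\sim\mathcal D}[l(x,d)]$. Assume that $\phi$ is bounded below and differentiable with $L$-Lipschitz gradient; that for all $x$, $\mathrm{Var}[l(x,d)]\le\sigma_f^2$ and $|l(x,d)-\phi(x)|$ is sub-exponential with parameters $(\nu,b)$, i.e. $X=|l(x,d)-\phi(x)|$ satisfies $\mathbb E\,e^{t(X-\mathbb EX)}\le e^{t^2\nu^2/2}$ for $|t|\le 1/b$; and that for all $x$, $\mathbb E[\nabla_x l(x,d)]=\nabla\phi(x)$ and $\mathbb E\|\nabla_x l(x,d)-\nabla\phi(x)\|^2\le M_c+M_v\|\nabla\phi(x)\|^2$. **Algorithm (SASS).** Fix $\theta,\gamma\in(0,1)$, $r>0$, $\alpha_{\max}\in(0,\infty]$, $x_0$ and $\alpha_0\in(0,\alpha_{\max}]$. In iteration $k=0,1,\dots$, fresh independent minibatches of i.i.d. samples give averages $g_k\approx\nabla\phi(x_k)$, $f_k^0\approx\phi(x_k)$ and $f_k^+\approx\phi(x_k-\alpha_kg_k)$.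 If $f_k^0-f_k^+\ge\theta\alpha_k\|g_k\|^2-r$ (a successful iteration), then $x_{k+1}=x_k-\alpha_kg_k$ and $\alpha_{k+1}=\min\{\gamma^{-1}\alpha_k,\alpha_{\max}\}$; otherwise $x_{k+1}=x_k$ and $\alpha_{k+1}=\gamma\alpha_k$. Let $\kappa,\tau>0$. With $s=\varepsilon^2$ in the non-convex case and $s=\varepsilon$ in the strongly convex case, put $r=\rho s$, use minibatches of size $\max\{1,\lceil a_0\sigma_f^2/s^2\rceil\}$ for each of $f_k^0$ and $f_k^+$, and of size $\max\{1,\lceil a_1(M_c/s+M_v/\min\{\tau,\kappa\alpha_k\}^2)\rceil\}$ for $g_k$. Let $\mathsf{TOC}(n)$ be the total number of sample values $l(x,d)$ and sample gradients $\nabla_xl(x,d)$ computed in the first $n$ iterations. Let $T_\varepsilon=\min\{k:\|\nabla\phi(x_k)\|\le\varepsilon\}$ in the non-convex case and $T_\varepsilon=\min\{k:\phi(x_k)-\inf\phi\le\varepsilon\}$ in the strongly convex case. **Constants.** Fix $L,\theta,\kappa,\tau,\bar\alpha,\alpha_0,p,\omega$, a lower bound $\gamma_0\in(0,\tfrac12]$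 for $\gamma$, an upper bound $\Delta$ for $\phi(x_0)-\inf\phi$, and an upper bound $\varepsilon_{\max}$ for $\varepsilon$ (with $\varepsilon_{\max}<1$ in the strongly convex case, where the strong convexity modulus $\mu>0$ is also fixed), such that $0<\bar\alpha\le\frac{1-\theta}{L/2+\kappa}$, $\kappa\bar\alpha\le\tau$, $\bar\alpha\le\alpha_0$, $\tfrac12<p<1$, $\omega>0$. Put $q=1-p$ and $\Lambda=\log_{1/\gamma}\frac{\alpha_0}{\bar\alpha}$. **Theorem.** For every sufficiently small $\rho>0$ and all sufficiently large $a_0,a_1$ (how large may depend on $\rho$), there is a constant $C_1>0$ (respectively $C_2>0$ in the strongly convex case) such that the following holds for every $K$ and every $c\in(0,1)$. All bounds hold for all $\gamma\in[\gamma_0,1)$ and $\varepsilon\in(0,\varepsilon_{\max}]$. The constants in the ${\cal O}(\cdot)$ bounds on $\mathsf{TOC}$ may depend on the fixed constants, $\rho,a_0,a_1,K,c$, but not on $m,\mathcal D,l,x_0,\alpha_{\max},\gamma,\varepsilon,n,\beta,\sigma_f,M_c,M_v,\nu,b$; $C_3>0$ and the constant in ${\cal O}(n^{-\omega})$ may depend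 in addition on $\sigma_f,\nu,b$ only. (0) If the stopping criterion does not hold at $x$ and $0<\alpha\le\bar\alpha$, then an iteration started from $(x,\alpha)$ is successful with probability at least $p$. (1) *Non-convex case.* If $n$ is an integer with $\frac{C_1}{\varepsilon^2}+\Lambda\le n\le K\left(\frac1{\varepsilon^2}+\Lambda\right)$, then with probability at least $1-2\exp(-C_3n)-{\cal O}(n^{-\omega})$, $T_\varepsilon$ is finite and $$\mathsf{TOC}(T_\varepsilon)\le{\cal O}\left(\left(\frac1{\varepsilon^2}+\Lambda\right)\max\left\{1,\ \frac{\sigma_f^2}{\varepsilon^4}+\frac{M_c}{\varepsilon^2}+\frac{M_v}{\varepsilon^{4(1+\omega)\log_{2q}\gamma}}\right\}\right).$$ *Strongly convex case.* If $C_2\log\frac1\varepsilon+\Lambda\le n\le K\left(\log\frac1\varepsilon+\Lambda\right)$, then with probability at least $1-2\exp(-C_3n)-{\cal O}(n^{-\omega})$, $T_\varepsilon$ is finite and $$\mathsf{TOC}(T_\varepsilon)\le{\cal O}\left(\left(\log\frac1\varepsilon+\Lambda\right)\max\left\{1,\ \frac{\sigma_f^2}{\varepsilon^2}+\frac{M_c}{\varepsilon}+M_v\left(\log\frac1\varepsilon\right)^{2(1+\omega)\log_{2q}\gamma}\right\}\right).$$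 (2) Let $\beta\in(0,\frac12)$ and $\gamma\in\left[\max\left\{\frac12,\left(\frac1{2q}\right)^{\frac{\log(2\beta)}{(1+\omega)\log n}}\right\},\ \left(\frac{\bar\alpha}{\alpha_0}\right)^{\frac1{cn}}\right]$ with $n\ge2$. If $\frac{C_1}{\varepsilon^2}+\Lambda\le n\le\frac K{\varepsilon^2}+\Lambda$ (non-convex case), respectively $C_2\log\frac1\varepsilon+\Lambda\le n\le K\log\frac1\varepsilon+\Lambda$ (strongly convex case), then with probability at least $1-2\exp(-C_3n)-{\cal O}(n^{-\omega})$, $T_\varepsilon$ is finite and, respectively, $$\mathsf{TOC}(T_\varepsilon)\le{\cal O}\left(\frac1{\varepsilon^2}\max\left\{1,\ \frac{\sigma_f^2}{\varepsilon^4}+\frac{M_c}{\varepsilon^2}+\frac{M_v}{\beta^2}\right\}\right),\qquad \mathsf{TOC}(T_\varepsilon)\le{\cal O}\left(\log\frac1\varepsilon\,\max\left\{1,\ \frac{\sigma_f^2}{\varepsilon^2}+\frac{M_c}{\varepsilon}+\frac{M_v}{\beta^2}\right\}\right).$$ -/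

import Mathlib

open MeasureTheory ProbabilityTheory

universe u v

/-- `X` is sub-exponential with parameters `(ν, b)`: the centred moment generating function exists
on `[-1/b, 1/b]` and is at most `exp (t² ν² / 2)` there. -/
def IsSubexponential {D : Type u} [MeasurableSpace D] (X : D → ℝ) (ν b : ℝ) (𝒟 : Measure D) :
    Prop :=
  0 < b ∧ ∀ t : ℝ, |t| ≤ 1 / b →
    Integrable (fun d => Real.exp (t * (X d - ∫ d', X d' ∂𝒟))) 𝒟 ∧
    ∫ d, Real.exp (t * (X d - ∫ d', X d' ∂𝒟)) ∂𝒟 ≤ Real.exp (t ^ 2 * ν ^ 2 / 2)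

/-- The expected risk `φ x = 𝔼_{d ∼ 𝒟} [l (x, d)]`. -/
noncomputable def expectedRisk {D : Type u} [MeasurableSpace D] {m : ℕ} (𝒟 : Measure D)
    (l : EuclideanSpace ℝ (Fin m) → D → ℝ) (x : EuclideanSpace ℝ (Fin m)) : ℝ :=
  ∫ d, l x d ∂𝒟

/-- The gradient `∇ₓ l (x, d)` of the sample loss. -/
noncomputable def lossGradient {D : Type u} {m : ℕ}
    (l : EuclideanSpace ℝ (Fin m) → D → ℝ) (x : EuclideanSpace ℝ (Fin m)) (d : D) :
    EuclideanSpace ℝ (Fin m) :=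
  gradient (fun y => l y d) x

/-- The standing assumptions on the expected risk minimization problem. -/
structure ERMAssumptions {D : Type u} [MeasurableSpace D] {m : ℕ} (𝒟 : Measure D)
    (l : EuclideanSpace ℝ (Fin m) → D → ℝ) (L : NNReal) (σf ν b Mc Mv : ℝ) : Prop where
  isProb : IsProbabilityMeasure 𝒟
  measurable_loss : Measurable (Function.uncurry l)
  differentiable_loss : ∀ d, Differentiable ℝ (fun x => l x d)
  /-- `φ` is `L`-smooth. -/
  differentiable_risk : Differentiable ℝ (expectedRisk 𝒟 l)
  lipschitz_gradient : LipschitzWith L (gradient (expectedRisk 𝒟 l))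
  bddBelow : BddBelow (Set.range (expectedRisk 𝒟 l))
  /-- Function values: sub-exponential deviations (uniformly in `x`) and bounded variance. -/
  subexponential : ∀ x, IsSubexponential (fun d => |l x d - expectedRisk 𝒟 l x|) ν b 𝒟
  variance_le : ∀ x, variance (l x) 𝒟 ≤ σf ^ 2
  /-- Gradients: unbiased, with the `M_c`, `M_v` variance bound. -/
  integrable_gradient : ∀ x, Integrable (lossGradient l x) 𝒟
  unbiased : ∀ x, ∫ d, lossGradient l x d ∂𝒟 = gradient (expectedRisk 𝒟 l) x
  integrable_sq : ∀ x,
    Integrable (fun d => ‖lossGradient l x d - gradient (expectedRisk 𝒟 l) x‖ ^ 2) 𝒟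
  gradient_variance : ∀ x,
    ∫ d, ‖lossGradient l x d - gradient (expectedRisk 𝒟 l) x‖ ^ 2 ∂𝒟 ≤
      Mc + Mv * ‖gradient (expectedRisk 𝒟 l) x‖ ^ 2

/-- The three oracle calls made in one iteration: the function value at the current iterate, the
function value at the trial point, and the gradient at the current iterate. -/
inductive OracleCall
  | value
  | trialValue
  | grad

/-- `ξ (k, j, i)` is the `i`-th sample available to oracle call `j` of iteration `k`; all of them are
independent with law `𝒟`. -/
structure IsIIDSampling {D : Type u} [MeasurableSpace D] {Ω : Type v} [MeasurableSpace Ω]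
    (P : Measure Ω) (𝒟 : Measure D) (ξ : ℕ × OracleCall × ℕ → Ω → D) : Prop where
  measurable : ∀ i, Measurable (ξ i)
  law : ∀ i, P.map (ξ i) = 𝒟
  indep : iIndepFun ξ P

/-- The minibatch average of `h` over the first `N` samples of the stream `s`. -/
noncomputable def minibatchAvg {D : Type u} {F : Type*} [AddCommGroup F] [Module ℝ F]
    (h : D → F) (s : ℕ → D) (N : ℕ) : F :=
  (N : ℝ)⁻¹ • ∑ i ∈ Finset.range N, h (s i)

/-- The data of a run of SASS (stochastic adaptive step search) with minibatch oracles: the sample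
loss, the algorithmic constants `θ, γ, α_max` (`⊤` when there is no cap), `r`, the starting point
and starting step size parameter, the minibatch size of each of the two zeroth-order calls, and the
minibatch size of the first-order call as a function of the current step size parameter. -/
structure SASS (m : ℕ) (D : Type u) where
  loss : EuclideanSpace ℝ (Fin m) → D → ℝ
  θ : ℝ
  γ : ℝ
  αmax : WithTop ℝ
  r : ℝ
  x₀ : EuclideanSpace ℝ (Fin m)
  α₀ : ℝ
  valueBatch : ℕ
  gradBatch : ℝ → ℕ

namespace SASS

variable {m : ℕ} {D : Type u} {Ω : Type v}

/-- The gradient estimate `g`. -/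
noncomputable def gradEst (A : SASS m D) (s : OracleCall → ℕ → D)
    (x : EuclideanSpace ℝ (Fin m)) (α : ℝ) : EuclideanSpace ℝ (Fin m) :=
  minibatchAvg (lossGradient A.loss x) (s .grad) (A.gradBatch α)

/-- The step `s(α) = -α g`. -/
noncomputable def trialStep (A : SASS m D) (s : OracleCall → ℕ → D)
    (x : EuclideanSpace ℝ (Fin m)) (α : ℝ) : EuclideanSpace ℝ (Fin m) :=
  -(α • A.gradEst s x α)

/-- Sufficient reduction: `f⁰ - f⁺ ≥ -θ gᵀ s(α) - r`. -/
def Successful (A : SASS m D) (s : OracleCall → ℕ → D)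
    (x : EuclideanSpace ℝ (Fin m)) (α : ℝ) : Prop :=
  minibatchAvg (A.loss x) (s .value) A.valueBatch
      - minibatchAvg (A.loss (x + A.trialStep s x α)) (s .trialValue) A.valueBatch
    ≥ -A.θ * inner ℝ (A.gradEst s x α) (A.trialStep s x α) - A.r

open Classical in
/-- One iteration, from the pair `(x, α)` to the next one. -/
noncomputable def next (A : SASS m D) (s : OracleCall → ℕ → D)
    (z : EuclideanSpace ℝ (Fin m) × ℝ) : EuclideanSpace ℝ (Fin m) × ℝ :=
  if A.Successful s z.1 z.2 then
    (z.1 + A.trialStep s z.1 z.2,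
      (min ((A.γ⁻¹ * z.2 : ℝ) : WithTop ℝ) A.αmax).untopD (A.γ⁻¹ * z.2))
  else (z.1, A.γ * z.2)

/-- The samples used in iteration `k`. -/
def samples (ξ : ℕ × OracleCall × ℕ → Ω → D) (k : ℕ) (ω : Ω) : OracleCall → ℕ → D :=
  fun j i => ξ (k, j, i) ω

/-- The state `(X_k, 𝒜_k)` of the algorithm at the beginning of iteration `k`. -/
noncomputable def state (A : SASS m D) (ξ : ℕ × OracleCall × ℕ → Ω → D) :
    ℕ → Ω → EuclideanSpace ℝ (Fin m) × ℝ
  | 0, _ => (A.x₀, A.α₀)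
  | k + 1, ω => A.next (samples ξ k ω) (A.state ξ k ω)

/-- The iterate `X_k`. -/
noncomputable def iterate (A : SASS m D) (ξ : ℕ × OracleCall × ℕ → Ω → D) (k : ℕ) (ω : Ω) :
    EuclideanSpace ℝ (Fin m) :=
  (A.state ξ k ω).1

/-- The step size parameter `𝒜_k`. -/
noncomputable def stepSize (A : SASS m D) (ξ : ℕ × OracleCall × ℕ → Ω → D) (k : ℕ) (ω : Ω) : ℝ :=
  (A.state ξ k ω).2

/-- The total sample complexity of the first `n` iterations: the number of evaluations of `l (x, d)`
(two minibatches per iteration) plus the number of evaluations of `∇ₓ l (x, d)`. -/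
noncomputable def TOC (A : SASS m D) (ξ : ℕ × OracleCall × ℕ → Ω → D) (n : ℕ) (ω : Ω) : ℕ :=
  ∑ k ∈ Finset.range n, (2 * A.valueBatch + A.gradBatch (A.stepSize ξ k ω))

/-- The event that the stopping time `T = min {k | X_k ∈ G}` is finite and `TOC(T) ≤ B`. -/
def tocAtMost (A : SASS m D) (ξ : ℕ × OracleCall × ℕ → Ω → D)
    (G : Set (EuclideanSpace ℝ (Fin m))) (B : ℝ) : Set Ω :=
  {ω | ∃ T : ℕ, IsLeast {k | A.iterate ξ k ω ∈ G} T ∧ (A.TOC ξ T ω : ℝ) ≤ B}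

/-- SASS for expected risk minimization, tuned to the accuracy level `s` (`s = ε²` in the non-convex
case, `s = ε` in the strongly convex case): `r = ρ s`, zeroth-order minibatches of size
`a₀ σ_f² / s²`, first-order minibatches of size `a₁ (M_c / s + M_v / min {τ, κ α}²)`, rounded up to
positive integers. -/
noncomputable def forERM (l : EuclideanSpace ℝ (Fin m) → D → ℝ) (θ γ : ℝ) (αmax : WithTop ℝ)
    (x₀ : EuclideanSpace ℝ (Fin m)) (α₀ κ τ σf Mc Mv ρ a₀ a₁ s : ℝ) : SASS m D where
  loss := l
  θ := θ
  γ := γ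
  αmax := αmax
  r := ρ * s
  x₀ := x₀
  α₀ := α₀
  valueBatch := max 1 ⌈a₀ * (σf ^ 2 / s ^ 2)⌉₊
  gradBatch := fun α => max 1 ⌈a₁ * (Mc / s + Mv / (min τ (κ * α)) ^ 2)⌉₊

end SASS

/-! ### Real inequalities -/

/-! The run is followed through V(x, α) = w Φ(x) + |log_{1/γ}(α/αs) + 1|, where Φ is (φ − inf φ)/ε²
in the non-convex case and log((φ − inf φ)/ε) in the strongly convex case; `IsPotential` isolates
what the two share. Outside the target, an iteration with accurate oracle calls lowers V by 1 up to
small noise: a failure can only occur at α > αs and a success at α ≤ γ²αs moves the other way, so in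
both cases log α moves towards its centre; any other success uses a sizeable step and lowers wΦ by
at least 2. An inaccurate iteration costs 2 more (`lyapunov_next_le`). Since the samples of each
iteration are fresh, E exp(λV) restricted to survival contracts by a fixed factor
(`lintegral_exp_lyapunov_next_le`), and the probability of not having stopped decays exponentially
(`measure_alive_le`).

The delicate point is that Λ enters the lower bound for n with coefficient exactly 1. Two facts
leave room. A small accuracy constant c replaces κ by κ/2 in the step size threshold, so small steps
are reliable up to some αs, either α₀ itself or strictly above αbar, and V(x₀, α₀) contains only (1
− ζ)Λ (`exists_threshold`). And the mean drift is −1 up to terms linear in δ, ρ, η, all chosen small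
against ζ, so that the contraction factor is at most exp(−λ(1 − ζ/2)) for some λ > 0
(`exists_contraction_le`).

Uniformity comes from separating orders in λ. To first order the noise is seen only through its
second moment, which the batch size makes small whatever σf, ν, b are; these parameters affect only
the second order (`lintegral_exp_le_of_sq`), hence only λ and C₃, not ρ, a₀, a₁ or C₁.

The step size is bounded below by a second potential, max(1, (αbar/α)^e). The failure probability δ
at α ≤ αbar is taken so small that its mean grows at most linearly in k; Markov and a union bound
give α_k ≥ αbar n^{−a} for all k < n up to probability O(n^{−ω}) (`measure_exists_stepSize_lt_le`).
When both events hold, T ≤ n and every batch size is controlled; the conditions on n and γ turn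
n^{2a} into a power of 1/ε² or log(1/ε), or into 1/β². -/

theorem exp_mul_le_of_le_half {κ : ℝ} (h0 : 0 ≤ κ) (h1 : κ ≤ 1 / 2) (y : ℝ) :
    Real.exp (κ * y) ≤ 1 + κ * y + 8 * κ ^ 2 * Real.exp |y| := by
  have hq : y ^ 2 / 2 ≤ Real.exp |y| := by
    have := Real.quadratic_le_exp_of_nonneg (abs_nonneg y)
    rw [sq_abs] at this
    linarith [abs_nonneg y]
  have hκ2 : 0 ≤ κ ^ 2 := sq_nonneg κ
  have hmul := mul_le_mul_of_nonneg_left hq hκ2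
  have hpos : 0 ≤ κ ^ 2 * Real.exp |y| := by positivity
  by_cases hs : |κ * y| ≤ 1
  · have := (abs_le.1 (Real.abs_exp_sub_one_sub_id_le hs)).2
    nlinarith
  push Not at hs
  rcases le_or_gt 0 y with hy | hy
  · rw [abs_of_nonneg (mul_nonneg h0 hy)] at hs
    rw [abs_of_nonneg hy] at *
    have h2 : Real.exp (κ * y) ≤ Real.exp (y / 2) := Real.exp_le_exp.2 (by nlinarith)
    have h3 : y ^ 2 ≤ 8 * Real.exp (y / 2) := by
      have := Real.quadratic_le_exp_of_nonneg (show 0 ≤ y / 2 by linarith)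
      nlinarith
    have h4 : Real.exp y = Real.exp (y / 2) * Real.exp (y / 2) := by
      rw [← Real.exp_add]; ring_nf
    have hE := Real.exp_pos (y / 2)
    have h5 : 1 ≤ κ ^ 2 * y ^ 2 := by nlinarith
    have h6 : κ ^ 2 * y ^ 2 ≤ κ ^ 2 * (8 * Real.exp (y / 2)) :=
      mul_le_mul_of_nonneg_left h3 hκ2
    have h7 : Real.exp (y / 2) ≤ 8 * κ ^ 2 * Real.exp y := by
      rw [h4]; nlinarith
    nlinarith [mul_nonneg h0 hy]
  · have hκy : κ * y ≤ 0 := mul_nonpos_of_nonneg_of_nonpos h0 hy.le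
    rw [abs_of_nonpos hκy] at hs
    have h2 : Real.exp (κ * y) ≤ 1 := Real.exp_le_one_iff.2 hκy
    have h5 : -(κ * y) ≤ κ ^ 2 * y ^ 2 := by nlinarith
    linarith

/-! ### Smooth and strongly convex functions -/

section Smooth

variable {E : Type*} [NormedAddCommGroup E] [InnerProductSpace ℝ E] [CompleteSpace E]

theorem hasDerivAt_comp_line {f : E → ℝ} (hf : Differentiable ℝ f) (x v : E) (t : ℝ) :
    HasDerivAt (fun t : ℝ => f (x + t • v)) (inner ℝ (gradient f (x + t • v)) v) t := by
  have h1 : HasDerivAt (fun t : ℝ => x + t • v) v t := by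
    simpa using ((hasDerivAt_id t).smul_const v).const_add x
  have h2 := (hf (x + t • v)).hasFDerivAt.comp_hasDerivAt t h1
  rwa [← inner_gradient_left] at h2

/-- Along the segment, the function minus its linear part and minus the quadratic (L/2)‖v‖²t² has
nonpositive derivative. -/
theorem le_quadratic_of_lipschitzWith_gradient {f : E → ℝ} {L : NNReal}
    (hf : Differentiable ℝ f) (hL : LipschitzWith L (gradient f)) (x v : E) :
    f (x + v) ≤ f x + inner ℝ (gradient f x) v + L / 2 * ‖v‖ ^ 2 := by
  have hd : ∀ t : ℝ, HasDerivAt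
      (fun t : ℝ => f (x + t • v) - t * inner ℝ (gradient f x) v - L / 2 * ‖v‖ ^ 2 * t ^ 2)
      (inner ℝ (gradient f (x + t • v)) v - inner ℝ (gradient f x) v
        - L / 2 * ‖v‖ ^ 2 * (2 * t)) t := by
    intro t
    refine ((hasDerivAt_comp_line hf x v t).sub ?_).sub ?_
    · simpa using (hasDerivAt_id t).mul_const (inner ℝ (gradient f x) v)
    · simpa using (hasDerivAt_pow 2 t).const_mul (L / 2 * ‖v‖ ^ 2)
  have hanti := antitoneOn_of_deriv_nonpos (convex_Icc (0 : ℝ) 1)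
    (fun t _ => (hd t).continuousAt.continuousWithinAt)
    (fun t _ => (hd t).differentiableAt.differentiableWithinAt) (by
      intro t ht
      rw [interior_Icc] at ht
      rw [(hd t).deriv, ← inner_sub_left]
      have h1 := real_inner_le_norm (gradient f (x + t • v) - gradient f x) v
      have h2 := hL.dist_le_mul (x + t • v) x
      rw [dist_eq_norm, dist_eq_norm, add_sub_cancel_left, norm_smul, Real.norm_of_nonneg ht.1.le]
        at h2
      nlinarith [norm_nonneg v, mul_le_mul_of_nonneg_right h2 (norm_nonneg v)])
  have := hanti (Set.left_mem_Icc.2 zero_le_one) (Set.right_mem_Icc.2 zero_le_one) zero_le_one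
  simp only [one_smul, zero_smul, add_zero] at this
  linarith

/-- Strong convexity between x and x + v, divided by t, bounds the difference quotient; let t tend
to 0 from the right. -/
theorem StrongConvexOn.le_of_gradient {f : E → ℝ} {μ : ℝ}
    (hf : Differentiable ℝ f) (hc : StrongConvexOn Set.univ μ f) (x v : E) :
    f x + inner ℝ (gradient f x) v + μ / 2 * ‖v‖ ^ 2 ≤ f (x + v) := by
  have hd := hasDerivAt_comp_line hf x v 0
  simp only [zero_smul, add_zero] at hd
  have ht := hd.tendsto_slope_zero_right
  have ht2 : Filter.Tendsto (fun t : ℝ => f (x + v) - f x - (1 - t) * (μ / 2 * ‖v‖ ^ 2))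
      (nhdsWithin 0 (Set.Ioi 0)) (nhds (f (x + v) - f x - (1 - 0) * (μ / 2 * ‖v‖ ^ 2))) := by
    refine Filter.Tendsto.mono_left (Continuous.tendsto (by fun_prop) 0) nhdsWithin_le_nhds
  have := le_of_tendsto_of_tendsto ht ht2 (by
    filter_upwards [Ioo_mem_nhdsGT (show (0 : ℝ) < 1 by norm_num)] with t ht
    have h := hc.2 (Set.mem_univ x) (Set.mem_univ (x + v)) (show 0 ≤ 1 - t by linarith [ht.2])
      ht.1.le (by ring)
    have e : (1 - t) • x + t • (x + v) = x + t • v := by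
      rw [smul_add, sub_smul, one_smul]; abel
    rw [e] at h
    simp only [smul_eq_mul, zero_add, zero_smul, add_zero, sub_add_cancel_left, norm_neg] at h ⊢
    rw [inv_mul_le_iff₀ ht.1]
    linarith)
  linarith

/-- The Polyak–Łojasiewicz inequality: minimise the quadratic lower bound at x over the distance ‖y
− x‖. -/
theorem StrongConvexOn.sub_iInf_le {f : E → ℝ} {μ : ℝ} (hμ : 0 < μ)
    (hf : Differentiable ℝ f) (hc : StrongConvexOn Set.univ μ f) (x : E) :
    2 * μ * (f x - ⨅ y, f y) ≤ ‖gradient f x‖ ^ 2 := by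
  have h : f x - ‖gradient f x‖ ^ 2 / (2 * μ) ≤ ⨅ y, f y := by
    refine le_ciInf fun y => ?_
    have h1 := hc.le_of_gradient hf x (y - x)
    rw [add_sub_cancel] at h1
    have h2 := neg_le_of_abs_le (abs_real_inner_le_norm (gradient f x) (y - x))
    have h3 : ‖gradient f x‖ * ‖y - x‖ - μ / 2 * ‖y - x‖ ^ 2 ≤ ‖gradient f x‖ ^ 2 / (2 * μ) := by
      rw [le_div_iff₀ (by positivity)]
      nlinarith [sq_nonneg (‖gradient f x‖ - μ * ‖y - x‖)]
    linarith
  have : f x - ⨅ y, f y ≤ ‖gradient f x‖ ^ 2 / (2 * μ) := by linarith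
  rw [le_div_iff₀ (by positivity)] at this
  linarith

end Smooth

/-! ### Measurability of the sample gradient -/

/-- Coordinates are pointwise limits of difference quotients with increments 1/(n+1). Joint
measurability is what is needed, since the gradient is evaluated at random iterates. -/
theorem measurable_lossGradient {D : Type u} [MeasurableSpace D] {m : ℕ}
    {l : EuclideanSpace ℝ (Fin m) → D → ℝ} (hl : Measurable (Function.uncurry l))
    (hd : ∀ d, Differentiable ℝ (fun x => l x d)) :
    Measurable (fun p : EuclideanSpace ℝ (Fin m) × D => lossGradient l p.1 p.2) := by
  have hcoord : ∀ i : Fin m, Measurable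
      (fun p : EuclideanSpace ℝ (Fin m) × D => lossGradient l p.1 p.2 i) := by
    intro i
    let e : EuclideanSpace ℝ (Fin m) := EuclideanSpace.single i 1
    have hu : ∀ n : ℕ, Measurable (fun p : EuclideanSpace ℝ (Fin m) × D =>
        (((n : ℝ) + 1)⁻¹)⁻¹ • (l (p.1 + ((n : ℝ) + 1)⁻¹ • e) p.2 - l p.1 p.2)) := by
      intro n
      have h1 : Measurable (fun p : EuclideanSpace ℝ (Fin m) × D =>
          l (p.1 + ((n : ℝ) + 1)⁻¹ • e) p.2) :=
        hl.comp ((measurable_fst.add_const _).prodMk measurable_snd)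
      have h2 : Measurable (fun p : EuclideanSpace ℝ (Fin m) × D => l p.1 p.2) := hl
      exact (h1.sub h2).const_mul (((n : ℝ) + 1)⁻¹)⁻¹
    refine measurable_of_tendsto_metrizable hu (tendsto_pi_nhds.2 fun p => ?_)
    have h := (hasDerivAt_comp_line (hd p.2) p.1 e 0).tendsto_slope_zero
    have hn : Filter.Tendsto (fun n : ℕ => ((n : ℝ) + 1)⁻¹) Filter.atTop (nhdsWithin 0 {0}ᶜ) := by
      refine tendsto_nhdsWithin_iff.2 ⟨?_, Filter.Eventually.of_forall fun n => ?_⟩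
      · simpa using tendsto_one_div_add_atTop_nhds_zero_nat (𝕜 := ℝ)
      · simp only [Set.mem_compl_iff, Set.mem_singleton_iff]; positivity
    have h2 := h.comp hn
    simp only [zero_smul, add_zero, zero_add] at h2
    have e1 : inner ℝ (gradient (fun x => l x p.2) p.1) e = lossGradient l p.1 p.2 i := by
      rw [EuclideanSpace.inner_single_right]; simp [lossGradient]
    rw [e1] at h2
    exact h2
  have := (WithLp.measurable_toLp 2 (Fin m → ℝ)).comp (measurable_pi_iff.2 hcoord)
  exact this

/-! ### Minibatch averages -/

theorem minibatchAvg_sub_const {D : Type u} {F : Type*} [AddCommGroup F] [Module ℝ F] (h : D → F) (c : F)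
    (t : ℕ → D) {N : ℕ} (hN : 0 < N) :
    minibatchAvg (fun d => h d - c) t N = minibatchAvg h t N - c := by
  have : (N : ℝ) ≠ 0 := by positivity
  simp only [minibatchAvg, Finset.sum_sub_distrib, smul_sub, Finset.sum_const, Finset.card_range]
  congr 1
  rw [← Nat.cast_smul_eq_nsmul ℝ, smul_smul, inv_mul_cancel₀ this, one_smul]

section Minibatch

variable {D : Type u} [MeasurableSpace D] {Ω : Type v} [MeasurableSpace Ω]
  {P : Measure Ω} [IsProbabilityMeasure P] {𝒟 : Measure D} {s : ℕ → Ω → D}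

theorem measurable_minibatchAvg (hs : ∀ i, Measurable (s i)) {W : D → ℝ} (hW : Measurable W)
    (N : ℕ) : Measurable (fun ω => minibatchAvg W (fun i => s i ω) N) := by
  unfold minibatchAvg
  simp only [smul_eq_mul]
  exact (Finset.measurable_sum _ fun i _ => hW.comp (hs i)).const_mul _

theorem lintegral_sq_minibatchAvg_le (hs : ∀ i, Measurable (s i)) (hlaw : ∀ i, P.map (s i) = 𝒟)
    (hind : iIndepFun s P) {W : D → ℝ} (hW : Measurable W) (hL2 : MemLp W 2 𝒟)
    {N : ℕ} (hN : 0 < N) :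
    ∫⁻ ω, ENNReal.ofReal ((minibatchAvg W (fun i => s i ω) N - ∫ d, W d ∂𝒟) ^ 2) ∂P =
      ENNReal.ofReal (variance W 𝒟 / N) := by
  have hN' : (N : ℝ) ≠ 0 := by positivity
  have hmp : ∀ i, MeasurePreserving (s i) P 𝒟 := fun i => ⟨hs i, hlaw i⟩
  have hLi : ∀ i, MemLp (fun ω => W (s i ω)) 2 P := fun i => hL2.comp_measurePreserving (hmp i)
  have havg : (fun ω => minibatchAvg W (fun i => s i ω) N) =
      fun ω => (N : ℝ)⁻¹ * (∑ i ∈ Finset.range N, fun ω => W (s i ω)) ω := by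
    funext ω; simp [minibatchAvg]
  have hmem : MemLp (fun ω => minibatchAvg W (fun i => s i ω) N) 2 P := by
    rw [havg]
    exact (memLp_finsetSum' _ fun i _ => hLi i).const_mul _
  have hmean : ∫ ω, minibatchAvg W (fun i => s i ω) N ∂P = ∫ d, W d ∂𝒟 := by
    simp only [minibatchAvg, smul_eq_mul]
    rw [integral_const_mul, integral_finsetSum _ fun i _ => (hLi i).integrable one_le_two]
    have : ∀ i, ∫ ω, W (s i ω) ∂P = ∫ d, W d ∂𝒟 := fun i => by
      rw [← hlaw i, integral_map (hs i).aemeasurable hW.aestronglyMeasurable]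
    simp only [this, Finset.sum_const, Finset.card_range, nsmul_eq_mul]
    field_simp
  have hvar : variance (fun ω => minibatchAvg W (fun i => s i ω) N) P = variance W 𝒟 / N := by
    rw [havg, variance_const_mul, IndepFun.variance_sum (fun i _ => hLi i) (fun i _ j _ hij =>
      ((hind.indepFun hij).comp hW hW))]
    have : ∀ i, variance (fun ω => W (s i ω)) P = variance W 𝒟 := fun i =>
      (hmp i).variance_fun_comp hW.aemeasurable
    simp only [this, Finset.sum_const, Finset.card_range, nsmul_eq_mul]
    field_simp
  rw [← hvar, ofReal_variance hmem, evariance_eq_lintegral_ofReal, hmean]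

/-- Apply the scalar identity in each coordinate; the coordinate variances add up to the mean square
norm, so no dimension factor appears. -/
theorem lintegral_norm_sq_minibatchAvg_le {m : ℕ} (hs : ∀ i, Measurable (s i))
    (hlaw : ∀ i, P.map (s i) = 𝒟) (hind : iIndepFun s P)
    {W : D → EuclideanSpace ℝ (Fin m)} {c : EuclideanSpace ℝ (Fin m)}
    (hW : Measurable W) (hint : Integrable W 𝒟) (hmean : ∫ d, W d ∂𝒟 = c)
    (hsq : Integrable (fun d => ‖W d - c‖ ^ 2) 𝒟) {N : ℕ} (hN : 0 < N) :
    ∫⁻ ω, ENNReal.ofReal (‖minibatchAvg W (fun i => s i ω) N - c‖ ^ 2) ∂P =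
      ENNReal.ofReal ((∫ d, ‖W d - c‖ ^ 2 ∂𝒟) / N) := by
  have hprob : IsProbabilityMeasure 𝒟 := by
    rw [← hlaw 0]; exact Measure.isProbabilityMeasure_map (hs 0).aemeasurable
  have hWj : ∀ j : Fin m, Measurable (fun d => W d j) := fun j =>
    (EuclideanSpace.proj j : EuclideanSpace ℝ (Fin m) →L[ℝ] ℝ).continuous.measurable.comp hW
  have hmj : ∀ j : Fin m, ∫ d, W d j ∂𝒟 = c j := fun j => by
    rw [← hmean]
    exact (EuclideanSpace.proj j : EuclideanSpace ℝ (Fin m) →L[ℝ] ℝ).integral_comp_comm hint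
  have hsqj : ∀ j : Fin m, Integrable (fun d => (W d j - c j) ^ 2) 𝒟 := fun j => by
    refine hsq.mono' ((hWj j).sub_const _ |>.pow_const 2).aestronglyMeasurable
      (ae_of_all _ fun d => ?_)
    rw [EuclideanSpace.norm_sq_eq, Real.norm_of_nonneg (sq_nonneg _)]
    have := Finset.single_le_sum (f := fun i => ‖(W d - c) i‖ ^ 2) (fun i _ => sq_nonneg _)
      (Finset.mem_univ j)
    simpa using this
  have hLj : ∀ j : Fin m, MemLp (fun d => W d j) 2 𝒟 := fun j => by
    have h1 : MemLp (fun d => W d j - c j) 2 𝒟 :=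
      (memLp_two_iff_integrable_sq ((hWj j).sub_const _).aestronglyMeasurable).2 (hsqj j)
    have h2 := h1.add (memLp_const (c j))
    exact h2.ae_eq (ae_of_all _ fun d => by simp)
  have hvj : ∀ j : Fin m, variance (fun d => W d j) 𝒟 = ∫ d, (W d j - c j) ^ 2 ∂𝒟 := fun j => by
    rw [variance_eq_integral (hWj j).aemeasurable, hmj]
  have happ : ∀ ω (j : Fin m), (minibatchAvg W (fun i => s i ω) N) j =
      minibatchAvg (fun d => W d j) (fun i => s i ω) N := fun ω j => by
    simp [minibatchAvg]
  have hexp : ∀ ω, ENNReal.ofReal (‖minibatchAvg W (fun i => s i ω) N - c‖ ^ 2) =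
      ∑ j : Fin m, ENNReal.ofReal
        ((minibatchAvg (fun d => W d j) (fun i => s i ω) N - ∫ d, W d j ∂𝒟) ^ 2) := fun ω => by
    rw [EuclideanSpace.norm_sq_eq, ENNReal.ofReal_sum_of_nonneg fun _ _ => sq_nonneg _]
    simp [happ, hmj]
  simp_rw [hexp]
  rw [lintegral_finsetSum _ fun j _ => (((measurable_minibatchAvg hs (hWj j) N).sub_const
    _).pow_const 2).ennreal_ofReal]
  simp_rw [lintegral_sq_minibatchAvg_le hs hlaw hind (hWj _) (hLj _) hN, hvj]
  rw [← ENNReal.ofReal_sum_of_nonneg fun j _ =>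
    div_nonneg (integral_nonneg fun _ => sq_nonneg _) (Nat.cast_nonneg _), ← Finset.sum_div,
    ← integral_finsetSum _ fun j _ => hsqj j]
  congr 3
  funext d
  rw [EuclideanSpace.norm_sq_eq]
  simp

/-- In `exp_mul_le_of_le_half`, taken at |v|b and ±Y/b, the linear term integrates to zero; the
second-order term is absorbed by 1 + x ≤ e^x. -/
theorem integral_exp_mul_le_of_integral_eq_zero [IsProbabilityMeasure 𝒟] {Y : D → ℝ} {b K : ℝ}
    (hb : 0 < b) (hY : Measurable Y)
    (hYi : Integrable Y 𝒟) (hY0 : ∫ d, Y d ∂𝒟 = 0)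
    (hint : Integrable (fun d => Real.exp (|Y d| / b)) 𝒟)
    (hK : ∫ d, Real.exp (|Y d| / b) ∂𝒟 ≤ K) {v : ℝ} (hv : |v| ≤ 1 / (2 * b)) :
    Integrable (fun d => Real.exp (v * Y d)) 𝒟 ∧
      ∫ d, Real.exp (v * Y d) ∂𝒟 ≤ Real.exp (8 * b ^ 2 * K * v ^ 2) := by
  have hpt : ∀ d, Real.exp (v * Y d) ≤ 1 + v * Y d + 8 * (v * b) ^ 2 * Real.exp (|Y d| / b) := by
    intro d
    have hvb : |v| * b ≤ 1 / 2 := by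
      rw [le_div_iff₀ (by positivity)] at hv; linarith
    rcases le_total 0 v with h0 | h0
    · rw [abs_of_nonneg h0] at hvb
      have := exp_mul_le_of_le_half (mul_nonneg h0 hb.le) hvb (Y d / b)
      rwa [abs_div, abs_of_pos hb, mul_assoc, mul_div_cancel₀ _ hb.ne'] at this
    · rw [abs_of_nonpos h0] at hvb
      have := exp_mul_le_of_le_half (mul_nonneg (neg_nonneg.2 h0) hb.le) hvb (-(Y d / b))
      rw [abs_neg, abs_div, abs_of_pos hb,
        show -v * b * -(Y d / b) = v * (b * (Y d / b)) by ring, mul_div_cancel₀ _ hb.ne'] at this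
      calc _ ≤ _ := this
        _ = _ := by ring
  have hbound : Integrable
      (fun d => 1 + v * Y d + 8 * (v * b) ^ 2 * Real.exp (|Y d| / b)) 𝒟 :=
    ((integrable_const _).add (hYi.const_mul v)).add (hint.const_mul _)
  have hi : Integrable (fun d => Real.exp (v * Y d)) 𝒟 :=
    hbound.mono' (hY.const_mul v).exp.aestronglyMeasurable (ae_of_all _ fun d => by
      rw [Real.norm_of_nonneg (Real.exp_pos _).le]; exact hpt d)
  refine ⟨hi, (integral_mono hi hbound hpt).trans ?_⟩
  have hlin : Integrable (fun d => 1 + v * Y d) 𝒟 := (integrable_const _).add (hYi.const_mul v)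
  rw [integral_add hlin (hint.const_mul _), integral_add (integrable_const _) (hYi.const_mul v), integral_const_mul, integral_const_mul, hY0]
  have : 8 * (v * b) ^ 2 * ∫ d, Real.exp (|Y d| / b) ∂𝒟 ≤ 8 * (v * b) ^ 2 * K :=
    mul_le_mul_of_nonneg_left hK (by positivity)
  have h2 := Real.add_one_le_exp (8 * b ^ 2 * K * v ^ 2)
  simp only [integral_const, probReal_univ, smul_eq_mul, mul_zero, add_zero, mul_one]
  nlinarith

/-- By independence the moment generating function is a product of N factors at u/N, and N (u/N)² =
u²/N. Bounding e^{u|X|} by e^{uX} + e^{−uX} costs the factor 2. -/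
theorem lintegral_exp_abs_minibatchAvg_le (hs : ∀ i, Measurable (s i))
    (hlaw : ∀ i, P.map (s i) = 𝒟) (hind : iIndepFun s P) {Y : D → ℝ} {b K : ℝ}
    (hb : 0 < b) (hY : Measurable Y) (hYi : Integrable Y 𝒟) (hY0 : ∫ d, Y d ∂𝒟 = 0)
    (hint : Integrable (fun d => Real.exp (|Y d| / b)) 𝒟)
    (hK : ∫ d, Real.exp (|Y d| / b) ∂𝒟 ≤ K) {N : ℕ} (hN : 0 < N) {u : ℝ} (hu : 0 ≤ u)
    (huN : u / N ≤ 1 / (2 * b)) :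
    ∫⁻ ω, ENNReal.ofReal (Real.exp (u * |minibatchAvg Y (fun i => s i ω) N|)) ∂P ≤
      ENNReal.ofReal (2 * Real.exp (8 * b ^ 2 * K * (u ^ 2 / N))) := by
  have hprob : IsProbabilityMeasure 𝒟 := by
    rw [← hlaw 0]; exact Measure.isProbabilityMeasure_map (hs 0).aemeasurable
  have hN' : (N : ℝ) ≠ 0 := by positivity
  have hmp : ∀ i, MeasurePreserving (s i) P 𝒟 := fun i => ⟨hs i, hlaw i⟩
  have hindY : iIndepFun (fun i ω => Y (s i ω)) P := hind.comp (fun _ => Y) fun _ => hY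
  have key : ∀ w : ℝ, |w| = u →
      ∫⁻ ω, ENNReal.ofReal (Real.exp (w * minibatchAvg Y (fun i => s i ω) N)) ∂P ≤
        ENNReal.ofReal (Real.exp (8 * b ^ 2 * K * (u ^ 2 / N))) := by
    intro w hw
    have hv : |w / N| ≤ 1 / (2 * b) := by
      rw [abs_div, hw, Nat.abs_cast]; exact huN
    obtain ⟨hi, hle⟩ := integral_exp_mul_le_of_integral_eq_zero hb hY hYi hY0 hint hK hv
    have hii : ∀ i, Integrable (fun ω => Real.exp (w / N * Y (s i ω))) P := fun i =>
      (hmp i).integrable_comp_of_integrable hi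
    have hmgf : ∀ i, mgf (fun ω => Y (s i ω)) P (w / N) ≤
        Real.exp (8 * b ^ 2 * K * (w / N) ^ 2) := fun i => by
      refine le_trans (le_of_eq ?_) hle
      rw [mgf, ← hlaw i, integral_map (hs i).aemeasurable
        (hY.const_mul _).exp.aestronglyMeasurable]
    have hsum := hindY.integrable_exp_mul_sum (t := w / N) (fun i => hY.comp (hs i))
      (s := Finset.range N) fun i _ => hii i
    have heq : ∀ ω, w * minibatchAvg Y (fun i => s i ω) N =
        w / N * (∑ i ∈ Finset.range N, fun ω => Y (s i ω)) ω := fun ω => by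
      simp only [minibatchAvg, smul_eq_mul, Finset.sum_apply]; ring
    simp_rw [heq]
    rw [← ofReal_integral_eq_lintegral_ofReal hsum (ae_of_all _ fun _ => (Real.exp_pos _).le)]
    refine ENNReal.ofReal_le_ofReal ?_
    have := hindY.mgf_sum (t := w / N) (fun i => hY.comp (hs i)) (Finset.range N)
    rw [mgf] at this
    rw [this]
    refine (Finset.prod_le_prod (fun i _ => mgf_nonneg) fun i _ => hmgf i).trans (le_of_eq ?_)
    rw [Finset.prod_const, Finset.card_range, ← Real.exp_nat_mul]
    congr 1
    rw [← hw, sq_abs]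
    field_simp
  have hm := measurable_minibatchAvg hs hY N
  calc _ ≤ ∫⁻ ω, (ENNReal.ofReal (Real.exp (u * minibatchAvg Y (fun i => s i ω) N)) +
        ENNReal.ofReal (Real.exp (-u * minibatchAvg Y (fun i => s i ω) N))) ∂P := by
        refine lintegral_mono fun ω => ?_
        rw [← ENNReal.ofReal_add (Real.exp_pos _).le (Real.exp_pos _).le]
        refine ENNReal.ofReal_le_ofReal ?_
        rcases abs_cases (minibatchAvg Y (fun i => s i ω) N) with ⟨h, _⟩ | ⟨h, _⟩ <;> rw [h]
        · linarith [Real.exp_pos (-u * minibatchAvg Y (fun i => s i ω) N)]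
        · rw [mul_neg, ← neg_mul]
          linarith [Real.exp_pos (u * minibatchAvg Y (fun i => s i ω) N)]
    _ ≤ _ := by
        rw [lintegral_add_left (hm.const_mul u).exp.ennreal_ofReal, two_mul,
          ENNReal.ofReal_add (Real.exp_pos _).le (Real.exp_pos _).le]
        exact add_le_add (key u (abs_of_nonneg hu)) (key (-u) (by rw [abs_neg, abs_of_nonneg hu]))

end Minibatch

/-! ### Moments of the sample loss -/

namespace ERMAssumptions

variable {D : Type u} [MeasurableSpace D] {m : ℕ} {𝒟 : Measure D}
  {l : EuclideanSpace ℝ (Fin m) → D → ℝ} {L : NNReal} {σf ν b Mc Mv : ℝ}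

theorem measurable_apply (h : ERMAssumptions 𝒟 l L σf ν b Mc Mv) (x : EuclideanSpace ℝ (Fin m)) :
    Measurable (l x) :=
  h.measurable_loss.comp measurable_prodMk_left

/-- The sub-exponential bound at its extreme exponent t = 1/b, with the centring undone. -/
theorem integrable_exp_abs (h : ERMAssumptions 𝒟 l L σf ν b Mc Mv)
    (x : EuclideanSpace ℝ (Fin m)) :
    Integrable (fun d => Real.exp (|l x d - expectedRisk 𝒟 l x| / b)) 𝒟 ∧
    ∫ d, Real.exp (|l x d - expectedRisk 𝒟 l x| / b) ∂𝒟 ≤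
      Real.exp ((∫ d, |l x d - expectedRisk 𝒟 l x| ∂𝒟) / b + ν ^ 2 / (2 * b ^ 2)) := by
  obtain ⟨hb, hsub⟩ := h.subexponential x
  obtain ⟨hi, hle⟩ := hsub (1 / b) (le_of_eq (abs_of_pos (by positivity)))
  have heq : ∀ d, Real.exp (|l x d - expectedRisk 𝒟 l x| / b) =
      Real.exp ((∫ d, |l x d - expectedRisk 𝒟 l x| ∂𝒟) / b) *
      Real.exp (1 / b * (|l x d - expectedRisk 𝒟 l x| -
        ∫ d, |l x d - expectedRisk 𝒟 l x| ∂𝒟)) := fun d => by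
    rw [← Real.exp_add]; congr 1; ring
  simp_rw [heq]
  refine ⟨hi.const_mul _, ?_⟩
  rw [integral_const_mul, Real.exp_add]
  refine mul_le_mul_of_nonneg_left (hle.trans (Real.exp_le_exp.2 (le_of_eq ?_)))
    (Real.exp_pos _).le
  have := hb.ne'
  field_simp

theorem memLp_two (h : ERMAssumptions 𝒟 l L σf ν b Mc Mv) (x : EuclideanSpace ℝ (Fin m)) :
    MemLp (fun d => l x d - expectedRisk 𝒟 l x) 2 𝒟 := by
  have hm : Measurable (fun d => l x d - expectedRisk 𝒟 l x) := (h.measurable_apply x).sub_const _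
  have hb := (h.subexponential x).1
  refine (memLp_two_iff_integrable_sq hm.aestronglyMeasurable).2 ?_
  refine ((h.integrable_exp_abs x).1.const_mul (2 * b ^ 2)).mono'
    (hm.pow_const 2).aestronglyMeasurable (ae_of_all _ fun d => ?_)
  rw [Real.norm_of_nonneg (sq_nonneg _), ← sq_abs]
  have h0 : 0 ≤ |l x d - expectedRisk 𝒟 l x| / b := by positivity
  have := Real.quadratic_le_exp_of_nonneg h0
  have h2 : (|l x d - expectedRisk 𝒟 l x| / b) ^ 2 ≤
      2 * Real.exp (|l x d - expectedRisk 𝒟 l x| / b) := by linarith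
  rw [div_pow, div_le_iff₀ (by positivity)] at h2
  linarith

theorem memLp_loss (h : ERMAssumptions 𝒟 l L σf ν b Mc Mv) (x : EuclideanSpace ℝ (Fin m)) :
    MemLp (l x) 2 𝒟 := by
  have := h.isProb
  exact ((h.memLp_two x).add (memLp_const (expectedRisk 𝒟 l x))).ae_eq
    (ae_of_all _ fun d => by simp)

theorem integral_sub_risk (h : ERMAssumptions 𝒟 l L σf ν b Mc Mv)
    (x : EuclideanSpace ℝ (Fin m)) : ∫ d, (l x d - expectedRisk 𝒟 l x) ∂𝒟 = 0 := by
  have := h.isProb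
  rw [integral_sub ((h.memLp_loss x).integrable one_le_two) (integrable_const _)]
  simp [expectedRisk]

/-- The variance of |l − φ| is nonnegative, so the squared mean is at most the second moment. -/
theorem integral_abs_le (h : ERMAssumptions 𝒟 l L σf ν b Mc Mv) (hσ : 0 ≤ σf)
    (x : EuclideanSpace ℝ (Fin m)) : ∫ d, |l x d - expectedRisk 𝒟 l x| ∂𝒟 ≤ σf := by
  have := h.isProb
  have h1 := variance_eq_sub (h.memLp_two x).abs
  have h2 := variance_nonneg (fun d => |l x d - expectedRisk 𝒟 l x|) 𝒟
  have h3 : ∫ d, (l x d - expectedRisk 𝒟 l x) ^ 2 ∂𝒟 ≤ σf ^ 2 := by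
    refine le_trans (le_of_eq ?_) (h.variance_le x)
    rw [variance_eq_integral (h.measurable_apply x).aemeasurable]; rfl
  have h4 : ∫ d, ((fun d => |l x d - expectedRisk 𝒟 l x|) ^ 2) d ∂𝒟 =
      ∫ d, (l x d - expectedRisk 𝒟 l x) ^ 2 ∂𝒟 := by
    congr 1; funext d; simp
  have h5 : (∫ d, |l x d - expectedRisk 𝒟 l x| ∂𝒟) ^ 2 ≤ σf ^ 2 := by
    simp only [Pi.abs_def] at h1; rw [h4] at h1; linarith
  exact abs_le_of_sq_le_sq' h5 hσ |>.2

variable {Ω : Type v} [MeasurableSpace Ω] {P : Measure Ω} [IsProbabilityMeasure P]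
  {s : ℕ → Ω → D}

/-- Mean-square error of the zeroth-order oracle, in units of the accuracy `t`. -/
theorem lintegral_sq_value_le (h : ERMAssumptions 𝒟 l L σf ν b Mc Mv)
    (hs : ∀ i, Measurable (s i)) (hlaw : ∀ i, P.map (s i) = 𝒟) (hind : iIndepFun s P)
    {a₀ t : ℝ} (ha : 0 < a₀) (ht : 0 < t) (x : EuclideanSpace ℝ (Fin m)) :
    ∫⁻ ω, ENNReal.ofReal ((|minibatchAvg (l x) (fun i => s i ω) (max 1 ⌈a₀ * (σf ^ 2 / t ^ 2)⌉₊)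
      - expectedRisk 𝒟 l x| / t) ^ 2) ∂P ≤ ENNReal.ofReal (1 / a₀) := by
  set N := max 1 ⌈a₀ * (σf ^ 2 / t ^ 2)⌉₊ with hNdef
  have hN : 0 < N := lt_max_of_lt_left one_pos
  have hNr : a₀ * (σf ^ 2 / t ^ 2) ≤ N := (Nat.le_ceil _).trans (by exact_mod_cast le_max_right _ _)
  have h1 := lintegral_sq_minibatchAvg_le hs hlaw hind (h.measurable_apply x) (h.memLp_loss x) hN
  have heq : ∀ ω, ENNReal.ofReal ((|minibatchAvg (l x) (fun i => s i ω) N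
      - expectedRisk 𝒟 l x| / t) ^ 2) = ENNReal.ofReal ((t ^ 2)⁻¹) *
      ENNReal.ofReal ((minibatchAvg (l x) (fun i => s i ω) N - ∫ d, l x d ∂𝒟) ^ 2) := fun ω => by
    rw [← ENNReal.ofReal_mul (by positivity), div_pow, sq_abs, div_eq_inv_mul]; rfl
  simp_rw [heq]
  rw [lintegral_const_mul _ (((measurable_minibatchAvg hs (h.measurable_apply x) N).sub_const
    _).pow_const 2).ennreal_ofReal, h1, ← ENNReal.ofReal_mul (by positivity)]
  refine ENNReal.ofReal_le_ofReal ?_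
  have hNpos : (0 : ℝ) < N := by exact_mod_cast hN
  have hv := h.variance_le x
  rw [← mul_div_assoc, div_le_div_iff₀ hNpos ha, one_mul]
  calc (t ^ 2)⁻¹ * variance (l x) 𝒟 * a₀ ≤ (t ^ 2)⁻¹ * σf ^ 2 * a₀ := by gcongr
    _ = a₀ * (σf ^ 2 / t ^ 2) := by rw [div_eq_mul_inv]; ring
    _ ≤ N := hNr

end ERMAssumptions

/-- Exponential moment of the error of the zeroth-order oracle, uniformly in the accuracy. -/
theorem exists_lintegral_exp_value_le {σf ν b a₀ tmax : ℝ} (hσ : 0 ≤ σf) (ha : 0 < a₀)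
    (hb : 0 < b) (htmax : 0 < tmax) :
    ∃ t₁ > (0 : ℝ), ∃ M > (0 : ℝ), ∀ {D : Type u} [MeasurableSpace D] {m : ℕ} {𝒟 : Measure D}
      {l : EuclideanSpace ℝ (Fin m) → D → ℝ} {L : NNReal} {Mc Mv : ℝ},
      ERMAssumptions 𝒟 l L σf ν b Mc Mv →
      ∀ {Ω : Type v} [MeasurableSpace Ω] {P : Measure Ω} [IsProbabilityMeasure P]
        {s : ℕ → Ω → D}, (∀ i, Measurable (s i)) → (∀ i, P.map (s i) = 𝒟) → iIndepFun s P →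
      ∀ t ∈ Set.Ioc 0 tmax, ∀ x : EuclideanSpace ℝ (Fin m),
      ∫⁻ ω, ENNReal.ofReal (Real.exp (t₁ *
        (|minibatchAvg (l x) (fun i => s i ω) (max 1 ⌈a₀ * (σf ^ 2 / t ^ 2)⌉₊)
          - expectedRisk 𝒟 l x| / t))) ∂P ≤ ENNReal.ofReal M := by
  -- For σf = 0 the batch has a single sample and averaging gives nothing, but zero variance makes
  -- the estimate exact almost surely.
  rcases hσ.eq_or_lt with rfl | hσ
  · refine ⟨1, one_pos, 1, one_pos, ?_⟩
    intro D _ m 𝒟 l L Mc Mv h Ω _ P _ s hs hlaw hind t ht x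
    have hN : 0 < max 1 ⌈a₀ * ((0 : ℝ) ^ 2 / t ^ 2)⌉₊ := lt_max_of_lt_left one_pos
    have h1 := lintegral_sq_minibatchAvg_le hs hlaw hind (h.measurable_apply x) (h.memLp_loss x) hN
    have hv : variance (l x) 𝒟 = 0 :=
      le_antisymm (by simpa using h.variance_le x) (variance_nonneg _ _)
    rw [hv, zero_div, ENNReal.ofReal_zero, lintegral_eq_zero_iff (((measurable_minibatchAvg hs
      (h.measurable_apply x) _).sub_const _).pow_const 2).ennreal_ofReal] at h1
    have h2 : ∀ᵐ ω ∂P, ENNReal.ofReal (Real.exp (1 * (|minibatchAvg (l x) (fun i => s i ω)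
        (max 1 ⌈a₀ * ((0 : ℝ) ^ 2 / t ^ 2)⌉₊) - expectedRisk 𝒟 l x| / t))) = ENNReal.ofReal 1 := by
      filter_upwards [h1] with ω hω
      have h0 : minibatchAvg (l x) (fun i => s i ω)
        (max 1 ⌈a₀ * ((0 : ℝ) ^ 2 / t ^ 2)⌉₊) - expectedRisk 𝒟 l x = 0 := by
        have := ENNReal.ofReal_eq_zero.1 hω
        exact pow_eq_zero_iff two_ne_zero |>.1 (le_antisymm this (sq_nonneg _))
      rw [h0]; simp
    rw [lintegral_congr_ae h2]
    simp
  · set K := Real.exp (σf / b + ν ^ 2 / (2 * b ^ 2)) with hK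
    -- The exponent u = t₁/t must satisfy u/N ≤ 1/(2b). As N ≥ a₀σf²/t², the ratio is at most
    -- t₁t/(a₀σf²), and t ≤ tmax gives this choice, uniformly in t.
    set t₁ := a₀ * σf ^ 2 / (2 * b * tmax) with ht₁
    have ht₁pos : 0 < t₁ := by positivity
    refine ⟨t₁, ht₁pos, 2 * Real.exp (8 * b ^ 2 * K * (t₁ ^ 2 / (a₀ * σf ^ 2))), by positivity, ?_⟩
    intro D _ m 𝒟 l L Mc Mv h Ω _ P _ s hs hlaw hind t ht x
    obtain ⟨ht0, htm⟩ := ht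
    set N := max 1 ⌈a₀ * (σf ^ 2 / t ^ 2)⌉₊ with hNdef
    have hN : 0 < N := lt_max_of_lt_left one_pos
    have hNpos : (0 : ℝ) < N := by exact_mod_cast hN
    have hNr : a₀ * (σf ^ 2 / t ^ 2) ≤ N :=
      (Nat.le_ceil _).trans (by exact_mod_cast le_max_right _ _)
    have hNr2 : a₀ * σf ^ 2 ≤ N * t ^ 2 := by
      rwa [← mul_div_assoc, div_le_iff₀ (by positivity)] at hNr
    have hprob := h.isProb
    obtain ⟨hi, hle⟩ := h.integrable_exp_abs x
    have hle' : ∫ d, Real.exp (|l x d - expectedRisk 𝒟 l x| / b) ∂𝒟 ≤ K := by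
      refine hle.trans (Real.exp_le_exp.2 ?_)
      have := h.integral_abs_le hσ.le x
      gcongr
    have key := lintegral_exp_abs_minibatchAvg_le hs hlaw hind hb
      ((h.measurable_apply x).sub_const (expectedRisk 𝒟 l x))
      ((h.memLp_two x).integrable one_le_two) (h.integral_sub_risk x) hi hle' hN
      (u := t₁ / t) (by positivity) (by
        rw [div_div, div_le_div_iff₀ (by positivity) (by positivity), one_mul, ht₁,
          div_mul_eq_mul_div, div_le_iff₀ (by positivity)]
        calc a₀ * σf ^ 2 * (2 * b) ≤ N * t ^ 2 * (2 * b) := by gcongr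
          _ = t * N * (2 * b * t) := by ring
          _ ≤ t * N * (2 * b * tmax) := by gcongr)
    simp_rw [minibatchAvg_sub_const (l x) (expectedRisk 𝒟 l x) _ hN] at key
    have heq : ∀ ω, t₁ * (|minibatchAvg (l x) (fun i => s i ω) N - expectedRisk 𝒟 l x| / t) =
        t₁ / t * |minibatchAvg (l x) (fun i => s i ω) N - expectedRisk 𝒟 l x| := fun ω => by ring
    simp_rw [heq]
    refine key.trans (ENNReal.ofReal_le_ofReal ?_)
    have hq : (t₁ / t) ^ 2 / N ≤ t₁ ^ 2 / (a₀ * σf ^ 2) := by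
      rw [div_pow, div_div]
      apply div_le_div_of_nonneg_left (by positivity) (by positivity)
      linarith
    gcongr

/-- The first-order coefficient is η alone; the moment M at the fixed exponent t₁ enters only with
t². The mean of Z is replaced by second-moment information through Z ≤ η/2 + Z²/(2η). -/
theorem lintegral_exp_le_of_sq {Ω : Type v} [MeasurableSpace Ω] {P : Measure Ω}
    [IsProbabilityMeasure P] {Z : Ω → ℝ} (hZ : Measurable Z) (hZ0 : ∀ ω, 0 ≤ Z ω)
    {η t₁ M t : ℝ} (hη : 0 < η) (ht₁ : 0 < t₁) (hM : 0 ≤ M) (ht : 0 ≤ t) (htt : t ≤ t₁ / 2)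
    (h2 : ∫⁻ ω, ENNReal.ofReal (Z ω ^ 2) ∂P ≤ ENNReal.ofReal (η ^ 2))
    (hexp : ∫⁻ ω, ENNReal.ofReal (Real.exp (t₁ * Z ω)) ∂P ≤ ENNReal.ofReal M) :
    ∫⁻ ω, ENNReal.ofReal (Real.exp (t * Z ω)) ∂P ≤
      ENNReal.ofReal (1 + t * η + 8 * (t / t₁) ^ 2 * M) := by
  have hpt : ∀ ω, Real.exp (t * Z ω) ≤ (1 + t * (η / 2)) + t / (2 * η) * Z ω ^ 2 +
      8 * (t / t₁) ^ 2 * Real.exp (t₁ * Z ω) := by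
    intro ω
    have h := exp_mul_le_of_le_half (κ := t / t₁) (by positivity)
      (by rw [div_le_iff₀ ht₁]; linarith) (t₁ * Z ω)
    rw [abs_of_nonneg (mul_nonneg ht₁.le (hZ0 ω)), ← mul_assoc, div_mul_cancel₀ _ ht₁.ne'] at h
    have h3 : Z ω ≤ η / 2 + Z ω ^ 2 / (2 * η) := by
      rw [← sub_nonneg]
      have : η / 2 + Z ω ^ 2 / (2 * η) - Z ω = (Z ω - η) ^ 2 / (2 * η) := by field_simp; ring
      rw [this]; positivity
    have h4 := mul_le_mul_of_nonneg_left h3 ht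
    calc _ ≤ _ := h
      _ ≤ 1 + t * (η / 2 + Z ω ^ 2 / (2 * η)) + 8 * (t / t₁) ^ 2 * Real.exp (t₁ * Z ω) := by
        linarith
      _ = _ := by ring
  calc _ ≤ ∫⁻ ω, (ENNReal.ofReal (1 + t * (η / 2)) +
        ENNReal.ofReal (t / (2 * η)) * ENNReal.ofReal (Z ω ^ 2) +
        ENNReal.ofReal (8 * (t / t₁) ^ 2) * ENNReal.ofReal (Real.exp (t₁ * Z ω))) ∂P := by
        refine lintegral_mono fun ω => ?_
        rw [← ENNReal.ofReal_mul (by positivity), ← ENNReal.ofReal_mul (by positivity),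
          ← ENNReal.ofReal_add (by positivity) (by positivity),
          ← ENNReal.ofReal_add (by positivity) (by positivity)]
        exact ENNReal.ofReal_le_ofReal (hpt ω)
    _ ≤ ENNReal.ofReal (1 + t * (η / 2)) + ENNReal.ofReal (t / (2 * η)) * ENNReal.ofReal (η ^ 2) +
        ENNReal.ofReal (8 * (t / t₁) ^ 2) * ENNReal.ofReal M := by
        rw [lintegral_add_right _ ((hZ.const_mul _).exp.ennreal_ofReal.const_mul _),
          lintegral_add_left measurable_const,
          lintegral_const_mul _ (hZ.pow_const 2).ennreal_ofReal,
          lintegral_const_mul _ (hZ.const_mul _).exp.ennreal_ofReal]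
        simp only [lintegral_const, measure_univ, mul_one]
        gcongr
    _ = _ := by
        rw [← ENNReal.ofReal_mul (by positivity), ← ENNReal.ofReal_mul (by positivity),
          ← ENNReal.ofReal_add (by positivity) (by positivity),
          ← ENNReal.ofReal_add (by positivity) (by positivity)]
        congr 1
        field_simp
        ring

/-! ### The first-order oracle -/

namespace ERMAssumptions

variable {D : Type u} [MeasurableSpace D] {m : ℕ} {𝒟 : Measure D}
  {l : EuclideanSpace ℝ (Fin m) → D → ℝ} {L : NNReal} {σf ν b Mc Mv : ℝ}
  {Ω : Type v} [MeasurableSpace Ω] {P : Measure Ω} [IsProbabilityMeasure P] {s : ℕ → Ω → D}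

/-- Markov for the squared error: the batch size makes its mean at most (t + q²‖∇φ‖²)/a₁, while the
squared threshold is at least c²(t + q²‖∇φ‖²). -/
theorem measure_gradient_inaccurate_le (h : ERMAssumptions 𝒟 l L σf ν b Mc Mv)
    (hMc : 0 ≤ Mc) (hMv : 0 ≤ Mv)
    (hs : ∀ i, Measurable (s i)) (hlaw : ∀ i, P.map (s i) = 𝒟) (hind : iIndepFun s P)
    {a₁ t q c : ℝ} (ha : 0 < a₁) (ht : 0 < t) (hq : 0 < q) (hc : 0 < c)
    (x : EuclideanSpace ℝ (Fin m)) :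
    P {ω | ¬ ‖minibatchAvg (lossGradient l x) (fun i => s i ω)
        (max 1 ⌈a₁ * (Mc / t + Mv / q ^ 2)⌉₊) - gradient (expectedRisk 𝒟 l) x‖ ≤
        c * (√t + q * ‖gradient (expectedRisk 𝒟 l) x‖)} ≤ ENNReal.ofReal (1 / (a₁ * c ^ 2)) := by
  set N := max 1 ⌈a₁ * (Mc / t + Mv / q ^ 2)⌉₊ with hNdef
  set B := gradient (expectedRisk 𝒟 l) x with hB
  have hN : 0 < N := lt_max_of_lt_left one_pos
  have hNpos : (0 : ℝ) < N := by exact_mod_cast hN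
  have hNr : a₁ * (Mc / t + Mv / q ^ 2) ≤ N :=
    (Nat.le_ceil _).trans (by exact_mod_cast le_max_right _ _)
  have hgm : Measurable (lossGradient l x) :=
    (measurable_lossGradient h.measurable_loss h.differentiable_loss).comp measurable_prodMk_left
  have h1 := lintegral_norm_sq_minibatchAvg_le hs hlaw hind hgm (h.integrable_gradient x)
    (h.unbiased x) (h.integrable_sq x) hN
  set S := c ^ 2 * (t + q ^ 2 * ‖B‖ ^ 2) with hS
  have hSpos : 0 < S := by positivity
  have hsub : {ω | ¬ ‖minibatchAvg (lossGradient l x) (fun i => s i ω) N - B‖ ≤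
      c * (√t + q * ‖B‖)} ⊆ {ω | ENNReal.ofReal S ≤
      ENNReal.ofReal (‖minibatchAvg (lossGradient l x) (fun i => s i ω) N - B‖ ^ 2)} := by
    intro ω hω
    simp only [Set.mem_ofPred_eq, not_le] at hω ⊢
    refine ENNReal.ofReal_le_ofReal ?_
    have h2 : (c * (√t + q * ‖B‖)) ^ 2 ≤
        ‖minibatchAvg (lossGradient l x) (fun i => s i ω) N - B‖ ^ 2 := by gcongr
    refine le_trans ?_ h2
    rw [hS, mul_pow]
    have : √t ^ 2 = t := Real.sq_sqrt ht.le
    have h3 : 0 ≤ 2 * √t * (q * ‖B‖) := by positivity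
    gcongr
    nlinarith
  have hmeas : Measurable (fun ω => ENNReal.ofReal
      (‖minibatchAvg (lossGradient l x) (fun i => s i ω) N - B‖ ^ 2)) := by
    refine Measurable.ennreal_ofReal (Measurable.pow_const (Measurable.norm (Measurable.sub_const
      ?_ _)) 2)
    unfold minibatchAvg
    exact (Finset.measurable_sum _ fun i _ => hgm.comp (hs i)).const_smul ((N : ℝ)⁻¹)
  refine (measure_mono hsub).trans ((meas_ge_le_lintegral_div hmeas.aemeasurable
    (by simpa using hSpos) ENNReal.ofReal_ne_top).trans ?_)
  rw [h1, ← ENNReal.ofReal_div_of_pos hSpos]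
  refine ENNReal.ofReal_le_ofReal ?_
  rw [div_div, div_le_div_iff₀ (by positivity) (by positivity), one_mul]
  have hV := h.gradient_variance x
  have hk : a₁ * (Mc + Mv * ‖B‖ ^ 2) ≤ N * (t + q ^ 2 * ‖B‖ ^ 2) := by
    have e1 : a₁ * Mc ≤ N * t := by
      have : a₁ * (Mc / t) ≤ N := le_trans (by gcongr; simp; positivity) hNr
      rwa [← mul_div_assoc, div_le_iff₀ ht] at this
    have e2 : a₁ * Mv ≤ N * q ^ 2 := by
      have : a₁ * (Mv / q ^ 2) ≤ N := le_trans (by gcongr; simp; positivity) hNr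
      rwa [← mul_div_assoc, div_le_iff₀ (by positivity)] at this
    nlinarith [sq_nonneg ‖B‖, mul_le_mul_of_nonneg_right e2 (sq_nonneg ‖B‖)]
  calc _ ≤ (Mc + Mv * ‖B‖ ^ 2) * (a₁ * c ^ 2) := by gcongr
    _ = a₁ * (Mc + Mv * ‖B‖ ^ 2) * c ^ 2 := by ring
    _ ≤ N * (t + q ^ 2 * ‖B‖ ^ 2) * c ^ 2 := by gcongr
    _ = _ := by rw [hS]; ring

end ERMAssumptions

/-! ### One step with an accurate gradient estimate -/

/-- The lower bound b₁√t on ‖B‖, available outside the target, turns the additive error into a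
relative one. -/
theorem half_norm_le_of_gradient_accurate {E : Type*} [NormedAddCommGroup E] {c τ t q b₁ : ℝ} (hc : 0 < c) (hb₁ : 0 < b₁)
    (hcb : c * (1 / b₁ + τ) ≤ 1 / 2) (hq : q ≤ τ) {B g : E} (hB : b₁ * √t ≤ ‖B‖)
    (hg : ‖g - B‖ ≤ c * (√t + q * ‖B‖)) : ‖B‖ / 2 ≤ ‖g‖ := by
  have h1 : √t ≤ 1 / b₁ * ‖B‖ := by
    rw [one_div, ← div_eq_inv_mul, le_div_iff₀ hb₁]; linarith
  have h2 : c * (√t + q * ‖B‖) ≤ c * (1 / b₁ * ‖B‖ + τ * ‖B‖) := by gcongr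
  have h3 : c * (1 / b₁ + τ) * ‖B‖ ≤ 1 / 2 * ‖B‖ := by gcongr
  have h4 : ‖B‖ ≤ ‖g‖ + ‖g - B‖ := by
    have := norm_sub_le g (g - B)
    rwa [sub_sub_cancel] at this
  nlinarith

section Step

variable {E : Type*} [NormedAddCommGroup E] [InnerProductSpace ℝ E] [CompleteSpace E]

/-- The bound by τ keeps the error factor at most 1/2, so ‖∇φ‖ can be traded for ‖g‖; the bound by
κα makes the multiplicative error second order in α, like the curvature term. With c small these
errors use only κ/2, which is the slack that lets the threshold on α exceed αbar. -/
theorem decrease_of_gradient_accurate {f : E → ℝ} {L : NNReal} (hf : Differentiable ℝ f)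
    (hL : LipschitzWith L (gradient f)) {κ τ θ α c ρ t : ℝ} (hκ : 0 < κ) (hα : 0 < α)
    (hαle : (L / 2 + κ / 2) * α ≤ 1 - θ) (hc : 0 < c) (hcτ : c * τ ≤ 1 / 2) (hcρ : c ≤ ρ / 2)
    (hcκ : c * (1 + 2 * κ) ≤ κ / 2) (ht : 0 < t) {x g : E} (hτ : 0 < τ)
    (hg : ‖g - gradient f x‖ ≤ c * (√t + min τ (κ * α) * ‖gradient f x‖)) :
    f (x + -(α • g)) ≤ f x - θ * α * ‖g‖ ^ 2 + ρ * t / 2 := by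
  set q := min τ (κ * α) with hq
  set B := gradient f x with hB
  have hq0 : 0 < q := lt_min hτ (by positivity)
  have hqτ : q ≤ τ := min_le_left _ _
  have hqα : q ≤ κ * α := min_le_right _ _
  have hBn : ‖B‖ ≤ ‖g‖ + ‖g - B‖ := by
    have := norm_sub_le g (g - B)
    rwa [sub_sub_cancel] at this
  have hδ : ‖g - B‖ ≤ 2 * c * √t + 2 * c * (κ * α) * ‖g‖ := by
    have h1 : c * q ≤ 1 / 2 := le_trans (by gcongr) hcτ
    have h2 : c * q * ‖B‖ ≤ c * q * (‖g‖ + ‖g - B‖) := by gcongr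
    have h3 : c * q * ‖g - B‖ ≤ 1 / 2 * ‖g - B‖ := by gcongr
    have h4 : c * q * ‖g‖ ≤ c * (κ * α) * ‖g‖ := by gcongr
    nlinarith
  have hdesc := le_quadratic_of_lipschitzWith_gradient hf hL x (-(α • g))
  have hin : inner ℝ B (-(α • g)) = -α * ‖g‖ ^ 2 + α * inner ℝ (g - B) g := by
    rw [inner_neg_right, real_inner_smul_right, inner_sub_left, real_inner_self_eq_norm_sq]; ring
  have hcs : inner ℝ (g - B) g ≤ ‖g - B‖ * ‖g‖ := real_inner_le_norm _ _
  rw [hin, norm_neg, norm_smul, Real.norm_of_nonneg hα.le, mul_pow] at hdesc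
  have h5 : α * inner ℝ (g - B) g ≤ α * ((2 * c * √t + 2 * c * (κ * α) * ‖g‖) * ‖g‖) := by
    refine mul_le_mul_of_nonneg_left (hcs.trans ?_) hα.le
    gcongr
  have h6 : 2 * c * √t * (α * ‖g‖) ≤ c * t + c * (α * ‖g‖) ^ 2 := by
    have := sq_nonneg (√t - α * ‖g‖)
    have e : √t ^ 2 = t := Real.sq_sqrt ht.le
    have : 2 * √t * (α * ‖g‖) ≤ t + (α * ‖g‖) ^ 2 := by nlinarith
    nlinarith
  have h7 : c * (1 + 2 * κ) * (α ^ 2 * ‖g‖ ^ 2) ≤ κ / 2 * (α ^ 2 * ‖g‖ ^ 2) := by gcongr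
  have h8 : (L / 2 + κ / 2) * α * (α * ‖g‖ ^ 2) ≤ (1 - θ) * (α * ‖g‖ ^ 2) := by gcongr
  have h9 : c * t ≤ ρ / 2 * t := by gcongr
  nlinarith

end Step

/-! ### The step size on a logarithmic scale -/

section StepSize

variable {γ αs α α' : ℝ}

theorem logb_inv_mul_div (hγ : γ ∈ Set.Ioo (0 : ℝ) 1) (hαs : 0 < αs) (hα : 0 < α) :
    Real.logb (1 / γ) (γ⁻¹ * α / αs) = Real.logb (1 / γ) (α / αs) + 1 := by
  have h1 : 1 < 1 / γ := by rw [one_div]; exact (one_lt_inv₀ hγ.1).2 hγ.2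
  have := hγ.1
  rw [mul_div_assoc, Real.logb_mul (by positivity) (by positivity), ← one_div,
    Real.logb_self_eq_one h1, add_comm]

theorem logb_mul_div (hγ : γ ∈ Set.Ioo (0 : ℝ) 1) (hαs : 0 < αs) (hα : 0 < α) :
    Real.logb (1 / γ) (γ * α / αs) = Real.logb (1 / γ) (α / αs) - 1 := by
  have := logb_inv_mul_div hγ hαs (mul_pos hγ.1 hα)
  rw [inv_mul_cancel_left₀ hγ.1.ne'] at this
  linarith

/-- The shift by 1 centres the scale at γαs. A success at α ≤ γ²αs, or a failure at α > αs, then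
shortens the distance by a full unit without overshooting; otherwise it grows by at most 1. The
second alternative of `hor` is the effect of the cap, which lies above αs. -/
theorem abs_logb_success_le (hγ : γ ∈ Set.Ioo (0 : ℝ) 1) (hαs : 0 < αs) (hα : 0 < α)
    (hle : α' ≤ γ⁻¹ * α) (hor : α' = γ⁻¹ * α ∨ αs ≤ α') :
    |Real.logb (1 / γ) (α' / αs) + 1| ≤ |Real.logb (1 / γ) (α / αs) + 1| + 1 ∧
    (α ≤ γ ^ 2 * αs →
      |Real.logb (1 / γ) (α' / αs) + 1| ≤ |Real.logb (1 / γ) (α / αs) + 1| - 1) := by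
  have h1 : 1 < 1 / γ := by rw [one_div]; exact (one_lt_inv₀ hγ.1).2 hγ.2
  have hstep := logb_inv_mul_div hγ hαs hα
  have hγ0 := hγ.1
  refine ⟨?_, fun hsmall => ?_⟩
  · rcases hor with h | h
    · rw [h, hstep]
      exact abs_add_le _ _ |>.trans (by simp)
    · have hpos : 0 < α' := hαs.trans_le h
      have h2 : 0 ≤ Real.logb (1 / γ) (α' / αs) :=
        Real.logb_nonneg h1 ((one_le_div hαs).2 h)
      have h3 : Real.logb (1 / γ) (α' / αs) ≤ Real.logb (1 / γ) (α / αs) + 1 := by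
        rw [← hstep]
        exact Real.logb_le_logb_of_le h1 (by positivity) (by gcongr)
      rw [abs_of_nonneg (by linarith)]
      have := le_abs_self (Real.logb (1 / γ) (α / αs) + 1)
      linarith
  · have heq : α' = γ⁻¹ * α := by
      rcases hor with h | h
      · exact h
      · exfalso
        have : γ⁻¹ * α ≤ γ * αs := by
          rw [inv_mul_le_iff₀ hγ0]; linarith
        nlinarith [hγ.2]
    have hu : Real.logb (1 / γ) (α / αs) ≤ -2 := by
      have e : Real.logb (1 / γ) (γ ^ 2) = -2 := by
        rw [one_div, Real.logb_inv_base, Real.logb_pow, Real.logb_self_eq_one_iff.2]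
        · simp
        · exact ⟨hγ0.ne', hγ.2.ne, by linarith⟩
      rw [← e]
      refine Real.logb_le_logb_of_le h1 (by positivity) ?_
      rw [div_le_iff₀ hαs]; exact hsmall
    rw [heq, hstep, abs_of_nonpos (by linarith), abs_of_nonpos (by linarith)]
    linarith

theorem abs_logb_fail_le (hγ : γ ∈ Set.Ioo (0 : ℝ) 1) (hαs : 0 < αs) (hα : 0 < α) :
    |Real.logb (1 / γ) (γ * α / αs) + 1| ≤ |Real.logb (1 / γ) (α / αs) + 1| + 1 ∧
    (αs < α →
      |Real.logb (1 / γ) (γ * α / αs) + 1| ≤ |Real.logb (1 / γ) (α / αs) + 1| - 1) := by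
  have h1 : 1 < 1 / γ := by rw [one_div]; exact (one_lt_inv₀ hγ.1).2 hγ.2
  rw [logb_mul_div hγ hαs hα]
  refine ⟨?_, fun hbig => ?_⟩
  · rw [sub_add_eq_add_sub]
    exact abs_sub _ _ |>.trans (by simp)
  · have : 0 ≤ Real.logb (1 / γ) (α / αs) := Real.logb_nonneg h1 ((one_le_div hαs).2 hbig.le)
    rw [abs_of_nonneg (by linarith), abs_of_nonneg (by linarith)]
    linarith

end StepSize

/-- The constants for which an accurate estimate of the function and the gradient ensures that
steps with `α ≤ αs` are successful and make progress. -/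
structure IsAccuracyLevel (L : NNReal) (θ κ τ αs b₁ ρ c : ℝ) : Prop where
  θ_pos : 0 < θ
  κ_pos : 0 < κ
  τ_pos : 0 < τ
  αs_pos : 0 < αs
  αs_le : (L / 2 + κ / 2) * αs ≤ 1 - θ
  b₁_pos : 0 < b₁
  c_pos : 0 < c
  c_τ : c * τ ≤ 1 / 2
  c_ρ : c ≤ ρ / 2
  c_κ : c * (1 + 2 * κ) ≤ κ / 2
  c_b₁ : c * (1 / b₁ + τ) ≤ 1 / 2

/-- `Φ` measures the progress of the minimization of `φ` outside the target set `G`, at accuracy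
level `t`. -/
structure IsPotential {m : ℕ} (φ : EuclideanSpace ℝ (Fin m) → ℝ)
    (G : Set (EuclideanSpace ℝ (Fin m))) (Φ : EuclideanSpace ℝ (Fin m) → ℝ) (b₁ c₅ t : ℝ) :
    Prop where
  measurableSet : MeasurableSet G
  measurable : Measurable Φ
  nonneg : ∀ x ∉ G, 0 ≤ Φ x
  le_norm_gradient : ∀ x ∉ G, b₁ * √t ≤ ‖gradient φ x‖
  step : ∀ x ∉ G, ∀ x' ∉ G, ∀ y ≥ (0 : ℝ), ∀ e ≥ (0 : ℝ),
    φ x' ≤ φ x - y * ‖gradient φ x‖ ^ 2 + e → Φ x' ≤ Φ x - c₅ * y + e / t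

/-! ### One-step drift of the Lyapunov function -/

namespace SASS

variable {m : ℕ} {D : Type u} (A : SASS m D) (φ : EuclideanSpace ℝ (Fin m) → ℝ)

/-- The error of the function estimate at the current point. -/
noncomputable def valueErr (s : OracleCall → ℕ → D) (x : EuclideanSpace ℝ (Fin m)) : ℝ :=
  |minibatchAvg (A.loss x) (s .value) A.valueBatch - φ x|

/-- The error of the function estimate at the trial point. -/
noncomputable def trialErr (s : OracleCall → ℕ → D) (x : EuclideanSpace ℝ (Fin m)) (α : ℝ) : ℝ :=
  |minibatchAvg (A.loss (x + A.trialStep s x α)) (s .trialValue) A.valueBatch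
    - φ (x + A.trialStep s x α)|

/-- All three oracle calls of an iteration are accurate. -/
structure Accurate (κ τ ρ c t : ℝ) (s : OracleCall → ℕ → D) (x : EuclideanSpace ℝ (Fin m))
    (α : ℝ) : Prop where
  grad : ‖A.gradEst s x α - gradient φ x‖ ≤ c * (√t + min τ (κ * α) * ‖gradient φ x‖)
  value : A.valueErr φ s x ≤ ρ * t / 4
  trial : A.trialErr φ s x α ≤ ρ * t / 4

/-- The Lyapunov function of the stopping time analysis. -/
noncomputable def lyapunov (Φ : EuclideanSpace ℝ (Fin m) → ℝ) (w αs : ℝ)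
    (z : EuclideanSpace ℝ (Fin m) × ℝ) : ℝ :=
  w * Φ z.1 + |Real.logb (1 / A.γ) (z.2 / αs) + 1|

variable {A φ} {s : OracleCall → ℕ → D} {z : EuclideanSpace ℝ (Fin m) × ℝ}

theorem next_of_successful (h : A.Successful s z.1 z.2) {αs : ℝ}
    (hαs : (αs : WithTop ℝ) ≤ A.αmax) :
    (A.next s z).1 = z.1 + A.trialStep s z.1 z.2 ∧ (A.next s z).2 ≤ A.γ⁻¹ * z.2 ∧
      ((A.next s z).2 = A.γ⁻¹ * z.2 ∨ αs ≤ (A.next s z).2) := by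
  simp only [next, if_pos h, true_and]
  cases hm : A.αmax with
  | top =>
    rw [min_top_right, WithTop.untopD_coe]
    exact ⟨le_rfl, Or.inl rfl⟩
  | coe a =>
    rw [hm] at hαs
    rw [← WithTop.coe_min, WithTop.untopD_coe]
    refine ⟨min_le_left _ _, ?_⟩
    rcases min_choice (A.γ⁻¹ * z.2) a with h | h <;> rw [h]
    · exact Or.inl rfl
    · exact Or.inr (WithTop.coe_le_coe.1 hαs)

theorem next_of_not_successful (h : ¬ A.Successful s z.1 z.2) :
    A.next s z = (z.1, A.γ * z.2) := by
  simp only [next, if_neg h]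

theorem next_snd_pos (hγ : 0 < A.γ) {αs : ℝ} (hαs : 0 < αs) (hmax : (αs : WithTop ℝ) ≤ A.αmax)
    (hz : 0 < z.2) : 0 < (A.next s z).2 := by
  by_cases h : A.Successful s z.1 z.2
  · obtain ⟨-, -, h2⟩ := next_of_successful h hmax
    rcases h2 with h2 | h2
    · rw [h2]; positivity
    · exact hαs.trans_le h2
  · rw [next_of_not_successful h]; exact mul_pos hγ hz

theorem neg_mul_inner_trialStep (x : EuclideanSpace ℝ (Fin m)) (α : ℝ) :
    -A.θ * inner ℝ (A.gradEst s x α) (A.trialStep s x α) =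
      A.θ * α * ‖A.gradEst s x α‖ ^ 2 := by
  rw [trialStep, inner_neg_right, real_inner_smul_right, real_inner_self_eq_norm_sq]; ring

/-- Of the tolerance r = ρt, the gradient error uses one half and the two function values a quarter
each. -/
theorem Accurate.successful {L : NNReal} {κ τ αs b₁ ρ c t α : ℝ} {x : EuclideanSpace ℝ (Fin m)}
    (hf : Differentiable ℝ φ) (hL : LipschitzWith L (gradient φ))
    (hc : IsAccuracyLevel L A.θ κ τ αs b₁ ρ c) (ht : 0 < t) (hr : A.r = ρ * t) (hα : 0 < α)
    (hαs : α ≤ αs) (h : A.Accurate φ κ τ ρ c t s x α) : A.Successful s x α := by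
  have hdec := decrease_of_gradient_accurate hf hL hc.κ_pos hα
    (le_trans (mul_le_mul_of_nonneg_left hαs (by have := hc.κ_pos; positivity)) hc.αs_le)
    hc.c_pos hc.c_τ hc.c_ρ hc.c_κ ht hc.τ_pos h.grad
  have hv := (abs_le.1 h.value).1
  have htr := (abs_le.1 h.trial).2
  rw [Successful, neg_mul_inner_trialStep, hr]
  simp only [trialStep] at *
  linarith

/-- The right side reads: drift −1, a penalty 2 for an inaccurate iteration (the log distance may
grow by 1), and the noise that the acceptance test lets through. -/
theorem lyapunov_next_le {L : NNReal} {κ τ αs b₁ ρ c t c₅ w : ℝ}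
    {G : Set (EuclideanSpace ℝ (Fin m))} {Φ : EuclideanSpace ℝ (Fin m) → ℝ}
    (hf : Differentiable ℝ φ) (hL : LipschitzWith L (gradient φ))
    (hc : IsAccuracyLevel L A.θ κ τ αs b₁ ρ c) (hΦ : IsPotential φ G Φ b₁ c₅ t)
    (ht : 0 < t) (hr : A.r = ρ * t) (hγ : A.γ ∈ Set.Ioo (0 : ℝ) 1)
    (hmax : (αs : WithTop ℝ) ≤ A.αmax) (hw0 : 0 ≤ w)
    (hw : 2 ≤ w * (c₅ * (A.θ * A.γ ^ 2 * αs / 4)))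
    (hz : 0 < z.2) (hzG : z.1 ∉ G) (hnG : (A.next s z).1 ∉ G) :
    A.lyapunov Φ w αs (A.next s z) ≤ A.lyapunov Φ w αs z +
      {s | A.Accurate φ κ τ ρ c t s z.1 z.2}ᶜ.indicator (fun _ => (2 : ℝ)) s - 1 +
      w * (ρ + (A.valueErr φ s z.1 + A.trialErr φ s z.1 z.2) / t) := by
  have hρ : 0 < ρ := by linarith [hc.c_pos, hc.c_ρ]
  have he0 : 0 ≤ A.valueErr φ s z.1 := abs_nonneg _
  have he1 : 0 ≤ A.trialErr φ s z.1 z.2 := abs_nonneg _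
  have herr : 0 ≤ ρ + (A.valueErr φ s z.1 + A.trialErr φ s z.1 z.2) / t := by positivity
  have hwerr := mul_nonneg hw0 herr
  unfold lyapunov
  by_cases hs : A.Successful s z.1 z.2
  · obtain ⟨h1, h2, h3⟩ := next_of_successful hs hmax
    obtain ⟨hup, hdown⟩ := abs_logb_success_le hγ hc.αs_pos hz h2 h3
    have hv := (abs_le.1 (le_refl (A.valueErr φ s z.1))).2
    have htr := (abs_le.1 (le_refl (A.trialErr φ s z.1 z.2))).1
    -- The acceptance test itself certifies this decrease, accurate or not, up to r and the two
    -- value errors.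
    have hdec : φ (A.next s z).1 ≤ φ z.1 - A.θ * z.2 * ‖A.gradEst s z.1 z.2‖ ^ 2 +
        (ρ * t + (A.valueErr φ s z.1 + A.trialErr φ s z.1 z.2)) := by
      rw [Successful, neg_mul_inner_trialStep, hr] at hs
      rw [h1]
      linarith
    have hE : (ρ * t + (A.valueErr φ s z.1 + A.trialErr φ s z.1 z.2)) / t =
        ρ + (A.valueErr φ s z.1 + A.trialErr φ s z.1 z.2) / t := by
      field_simp
    have hθ := hc.θ_pos
    have hnn : 0 ≤ A.θ * z.2 * ‖A.gradEst s z.1 z.2‖ ^ 2 := by positivity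
    have hΦ0 := hΦ.step z.1 hzG _ hnG 0 le_rfl _ (by positivity : 0 ≤ ρ * t +
      (A.valueErr φ s z.1 + A.trialErr φ s z.1 z.2)) (by linarith)
    rw [hE, mul_zero, sub_zero] at hΦ0
    have hwΦ := mul_le_mul_of_nonneg_left hΦ0 hw0
    by_cases hacc : A.Accurate φ κ τ ρ c t s z.1 z.2
    · rw [Set.indicator_of_notMem (by simpa using hacc)]
      -- Small α: the log distance falls by 1. Otherwise ‖g‖ ≥ ‖∇φ‖/2 and α > γ²αs, so by the choice
      -- of w the term wΦ falls by at least 2 before noise, covering a growth of 1 in the log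
      -- distance.
      by_cases hsmall : z.2 ≤ A.γ ^ 2 * αs
      · have := hdown hsmall
        linarith
      · push Not at hsmall
        have hn := half_norm_le_of_gradient_accurate hc.c_pos hc.b₁_pos hc.c_b₁ (min_le_left _ _)
          (hΦ.le_norm_gradient _ hzG) hacc.grad
        have hn2 : (‖gradient φ z.1‖ / 2) ^ 2 ≤ ‖A.gradEst s z.1 z.2‖ ^ 2 := by gcongr
        have hy : A.θ * A.γ ^ 2 * αs / 4 * ‖gradient φ z.1‖ ^ 2 ≤
            A.θ * z.2 * ‖A.gradEst s z.1 z.2‖ ^ 2 := by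
          calc _ = A.θ * (A.γ ^ 2 * αs) * (‖gradient φ z.1‖ / 2) ^ 2 := by ring
            _ ≤ _ := by gcongr
        have hαs := hc.αs_pos
        have hΦ1 := hΦ.step z.1 hzG _ hnG (A.θ * A.γ ^ 2 * αs / 4) (by positivity) _
          (by positivity : 0 ≤ ρ * t +
          (A.valueErr φ s z.1 + A.trialErr φ s z.1 z.2)) (by linarith)
        rw [hE] at hΦ1
        have := mul_le_mul_of_nonneg_left hΦ1 hw0
        linarith
    · rw [Set.indicator_of_mem (by simpa using hacc)]
      linarith
  · rw [next_of_not_successful hs]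
    obtain ⟨hup, hdown⟩ := abs_logb_fail_le hγ hc.αs_pos hz
    by_cases hacc : A.Accurate φ κ τ ρ c t s z.1 z.2
    · rw [Set.indicator_of_notMem (by simpa using hacc)]
      have hbig : αs < z.2 := by
        by_contra hle
        exact hs (hacc.successful hf hL hc ht hr hz (not_lt.1 hle))
      have := hdown hbig
      simp only
      linarith
    · rw [Set.indicator_of_mem (by simpa using hacc)]
      simp only
      linarith

theorem state_snd_pos {Ω : Type v} {ξ : ℕ × OracleCall × ℕ → Ω → D} (hγ : 0 < A.γ) {αs : ℝ} (hαs : 0 < αs) (hmax : (αs : WithTop ℝ) ≤ A.αmax)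
    (h0 : 0 < A.α₀) (k : ℕ) (ω : Ω) : 0 < (A.state ξ k ω).2 := by
  induction k with
  | zero => exact h0
  | succ k ih => exact next_snd_pos hγ hαs hmax ih

theorem measurable_lyapunov {Φ : EuclideanSpace ℝ (Fin m) → ℝ} (hΦ : Measurable Φ) (w αs : ℝ) :
    Measurable (A.lyapunov Φ w αs) := by
  unfold lyapunov Real.logb
  have h1 : Measurable (fun z : EuclideanSpace ℝ (Fin m) × ℝ =>
      Real.log (z.2 / αs) / Real.log (1 / A.γ) + 1) :=
    (((measurable_snd.div_const αs).log).div_const _).add_const 1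
  exact ((hΦ.comp measurable_fst).const_mul w).add (continuous_abs.measurable.comp h1)

end SASS

/-! ### Independence of past and present -/

theorem indepFun_of_measurable_iSup {ι : Type*} {D : Type u} [MeasurableSpace D] {Ω : Type v}
    [mΩ : MeasurableSpace Ω] {P : Measure Ω} {ξ : ι → Ω → D} (hξ : ∀ i, Measurable (ξ i))
    (hind : iIndepFun ξ P) {S T : Set ι} (hST : Disjoint S T)
    {β β' : Type*} [mβ : MeasurableSpace β] [mβ' : MeasurableSpace β'] {X : Ω → β} {Y : Ω → β'}
    (hX : Measurable[⨆ i ∈ S, MeasurableSpace.comap (ξ i) inferInstance] X)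
    (hY : Measurable[⨆ i ∈ T, MeasurableSpace.comap (ξ i) inferInstance] Y) :
    IndepFun X Y P := by
  rw [IndepFun_iff_Indep]
  have h := indep_iSup_of_disjoint (fun i => (hξ i).comap_le) hind.iIndep hST
  exact indep_of_indep_of_le_left (indep_of_indep_of_le_right h
    (measurable_iff_comap_le.1 hY)) (measurable_iff_comap_le.1 hX)

/-- The joint law is a product, so Tonelli allows X to be frozen while Y is averaged. This plays the
role of conditional expectation. -/
theorem ProbabilityTheory.IndepFun.lintegral_comp_prodMk {Ω : Type v} [MeasurableSpace Ω]
    {P : Measure Ω} [IsProbabilityMeasure P] {β β' : Type*} [MeasurableSpace β]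
    [MeasurableSpace β'] {X : Ω → β} {Y : Ω → β'} (h : IndepFun X Y P) (hX : Measurable X)
    (hY : Measurable Y) {F : β × β' → ENNReal} (hF : Measurable F) :
    ∫⁻ ω, F (X ω, Y ω) ∂P = ∫⁻ ω, ∫⁻ ω', F (X ω, Y ω') ∂P ∂P := by
  have := Measure.isProbabilityMeasure_map hX.aemeasurable (μ := P)
  have := Measure.isProbabilityMeasure_map hY.aemeasurable (μ := P)
  rw [← lintegral_map (f := F) (g := fun ω => (X ω, Y ω)) hF (hX.prodMk hY),
    h.map_prod_eq_prod_map_map hX.aemeasurable hY.aemeasurable, lintegral_prod _ hF.aemeasurable,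
    lintegral_map hF.lintegral_prod_right' hX]
  congr 1
  funext ω
  exact lintegral_map (f := fun y => F (X ω, y)) (hF.comp measurable_prodMk_left) hY

/-! ### Measurability of an iteration and adaptedness of the run -/

namespace SASS

variable {m : ℕ} {D : Type u} [MeasurableSpace D]

/-- The measurability of the data of a run. -/
structure MeasurableData (A : SASS m D) : Prop where
  loss : Measurable (Function.uncurry A.loss)
  differentiable : ∀ d, Differentiable ℝ (fun x => A.loss x d)
  gradBatch : Measurable A.gradBatch

variable {A : SASS m D}

theorem measurable_minibatchAvg_uncurry {F : Type*} [NormedAddCommGroup F] [NormedSpace ℝ F]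
    [MeasurableSpace F] [BorelSpace F] [SecondCountableTopology F]
    {h : EuclideanSpace ℝ (Fin m) → D → F} (hh : Measurable (Function.uncurry h)) (N : ℕ) :
    Measurable (fun p : EuclideanSpace ℝ (Fin m) × (ℕ → D) => minibatchAvg (h p.1) p.2 N) := by
  unfold minibatchAvg
  refine Measurable.const_smul ?_ ((N : ℝ)⁻¹)
  refine Finset.measurable_sum _ fun i _ => ?_
  exact hh.comp (measurable_fst.prodMk ((measurable_pi_apply i).comp measurable_snd))

/-- The batch size varies with α, hence is random; being a natural number, it can be fixed first. -/
theorem MeasurableData.gradEst (hA : A.MeasurableData) :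
    Measurable (fun p : ((ℕ → D) × EuclideanSpace ℝ (Fin m)) × ℝ =>
      minibatchAvg (lossGradient A.loss p.1.2) p.1.1 (A.gradBatch p.2)) := by
  have h1 : Measurable (fun p : ((ℕ → D) × EuclideanSpace ℝ (Fin m)) × ℕ =>
      minibatchAvg (lossGradient A.loss p.1.2) p.1.1 p.2) := by
    refine measurable_from_prod_countable_left fun n => ?_
    exact (measurable_minibatchAvg_uncurry
      (measurable_lossGradient hA.loss hA.differentiable) n).comp measurable_swap
  have h2 : Measurable (fun p : ((ℕ → D) × EuclideanSpace ℝ (Fin m)) × ℝ =>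
      (p.1, A.gradBatch p.2)) := measurable_fst.prodMk (hA.gradBatch.comp measurable_snd)
  have h3 := h1.comp h2
  exact h3

theorem MeasurableData.trialPoint (hA : A.MeasurableData) :
    Measurable (fun p : ((ℕ → D) × EuclideanSpace ℝ (Fin m)) × ℝ =>
      p.1.2 + -(p.2 • minibatchAvg (lossGradient A.loss p.1.2) p.1.1 (A.gradBatch p.2))) :=
  (measurable_snd.comp measurable_fst).add (measurable_snd.smul hA.gradEst).neg

theorem measurable_stream (j : OracleCall) : Measurable (fun p : (OracleCall → ℕ → D) ×
    (EuclideanSpace ℝ (Fin m) × ℝ) => p.1 j) :=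
  (measurable_pi_apply j).comp measurable_fst

theorem measurable_stream_point (j : OracleCall) : Measurable (fun p : (OracleCall → ℕ → D) ×
    (EuclideanSpace ℝ (Fin m) × ℝ) => (((p.1 j, p.2.1), p.2.2) :
      ((ℕ → D) × EuclideanSpace ℝ (Fin m)) × ℝ)) :=
  ((measurable_stream j).prodMk (measurable_fst.comp measurable_snd)).prodMk
    (measurable_snd.comp measurable_snd)

theorem MeasurableData.gradEst_uncurry (hA : A.MeasurableData) :
    Measurable (fun p : (OracleCall → ℕ → D) × (EuclideanSpace ℝ (Fin m) × ℝ) =>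
      A.gradEst p.1 p.2.1 p.2.2) :=
  by
  have h := hA.gradEst.comp (measurable_stream_point (D := D) (m := m) .grad)
  exact h

theorem MeasurableData.trialPoint_uncurry (hA : A.MeasurableData) :
    Measurable (fun p : (OracleCall → ℕ → D) × (EuclideanSpace ℝ (Fin m) × ℝ) =>
      p.2.1 + A.trialStep p.1 p.2.1 p.2.2) :=
  hA.trialPoint.comp (measurable_stream_point .grad)

theorem MeasurableData.value_uncurry (hA : A.MeasurableData) :
    Measurable (fun p : (OracleCall → ℕ → D) × (EuclideanSpace ℝ (Fin m) × ℝ) =>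
      minibatchAvg (A.loss p.2.1) (p.1 .value) A.valueBatch) :=
  (measurable_minibatchAvg_uncurry hA.loss A.valueBatch).comp
    ((measurable_fst.comp measurable_snd).prodMk (measurable_stream .value))

theorem MeasurableData.trialValue_uncurry (hA : A.MeasurableData) :
    Measurable (fun p : (OracleCall → ℕ → D) × (EuclideanSpace ℝ (Fin m) × ℝ) =>
      minibatchAvg (A.loss (p.2.1 + A.trialStep p.1 p.2.1 p.2.2)) (p.1 .trialValue)
        A.valueBatch) :=
  (measurable_minibatchAvg_uncurry hA.loss A.valueBatch).comp
    (hA.trialPoint_uncurry.prodMk (measurable_stream .trialValue))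

theorem MeasurableData.measurableSet_successful (hA : A.MeasurableData) :
    MeasurableSet {p : (OracleCall → ℕ → D) × (EuclideanSpace ℝ (Fin m) × ℝ) |
      A.Successful p.1 p.2.1 p.2.2} := by
  simp only [Successful, neg_mul_inner_trialStep]
  refine measurableSet_le ?_ (hA.value_uncurry.sub hA.trialValue_uncurry)
  exact (((measurable_snd.comp measurable_snd).const_mul A.θ).mul
    (hA.gradEst_uncurry.norm.pow_const 2)).sub_const _

theorem MeasurableData.next (hA : A.MeasurableData) :
    Measurable (fun p : (OracleCall → ℕ → D) × (EuclideanSpace ℝ (Fin m) × ℝ) =>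
      A.next p.1 p.2) := by
  unfold SASS.next
  have hα : Measurable (fun p : (OracleCall → ℕ → D) × (EuclideanSpace ℝ (Fin m) × ℝ) => p.2.2) :=
    measurable_snd.comp measurable_snd
  refine Measurable.ite hA.measurableSet_successful (hA.trialPoint_uncurry.prodMk ?_)
    ((measurable_fst.comp measurable_snd).prodMk (hα.const_mul _))
  cases A.αmax with
  | top =>
    simp only [min_top_right, WithTop.untopD_coe]
    exact hα.const_mul _
  | coe a =>
    simp only [← WithTop.coe_min, WithTop.untopD_coe]
    exact (hα.const_mul _).min measurable_const

theorem MeasurableData.valueErr_uncurry (hA : A.MeasurableData)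
    {φ : EuclideanSpace ℝ (Fin m) → ℝ} (hφ : Measurable φ) :
    Measurable (fun p : (OracleCall → ℕ → D) × (EuclideanSpace ℝ (Fin m) × ℝ) =>
      A.valueErr φ p.1 p.2.1) := by
  unfold valueErr
  have := hA.value_uncurry.sub (hφ.comp (measurable_fst.comp measurable_snd))
  exact continuous_abs.measurable.comp this

theorem MeasurableData.trialErr_uncurry (hA : A.MeasurableData)
    {φ : EuclideanSpace ℝ (Fin m) → ℝ} (hφ : Measurable φ) :
    Measurable (fun p : (OracleCall → ℕ → D) × (EuclideanSpace ℝ (Fin m) × ℝ) =>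
      A.trialErr φ p.1 p.2.1 p.2.2) := by
  unfold trialErr
  have := hA.trialValue_uncurry.sub (hφ.comp hA.trialPoint_uncurry)
  exact continuous_abs.measurable.comp this

variable {Ω : Type v} {ξ : ℕ × OracleCall × ℕ → Ω → D}

/-- The information in the samples with indices in `S`. -/
abbrev sampleSigma (ξ : ℕ × OracleCall × ℕ → Ω → D) (S : Set (ℕ × OracleCall × ℕ)) :
    MeasurableSpace Ω :=
  ⨆ i ∈ S, MeasurableSpace.comap (ξ i) inferInstance

theorem sampleSigma_mono {S T : Set (ℕ × OracleCall × ℕ)} (h : S ⊆ T) :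
    sampleSigma ξ S ≤ sampleSigma ξ T :=
  biSup_mono h

theorem measurable_sampleSigma {S : Set (ℕ × OracleCall × ℕ)} {i : ℕ × OracleCall × ℕ}
    (hi : i ∈ S) : Measurable[sampleSigma ξ S] (ξ i) :=
  measurable_iff_comap_le.2
    (le_biSup (fun i => MeasurableSpace.comap (ξ i) (inferInstance : MeasurableSpace D)) hi)

theorem measurable_samples_sampleSigma (k : ℕ) :
    Measurable[sampleSigma ξ {i | i.1 = k}] (samples ξ k) := by
  refine @measurable_pi_lambda _ _ _ (sampleSigma ξ {i | i.1 = k}) _ _ fun j => ?_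
  refine @measurable_pi_lambda _ _ _ (sampleSigma ξ {i | i.1 = k}) _ _ fun i => ?_
  exact measurable_sampleSigma (i := (k, j, i)) rfl

theorem MeasurableData.state_sampleSigma (hA : A.MeasurableData) (k : ℕ) :
    Measurable[sampleSigma ξ {i | i.1 < k}] (A.state ξ k) := by
  induction k with
  | zero => exact @measurable_const _ _ _ (sampleSigma ξ {i | i.1 < 0}) _
  | succ k ih =>
    have h1 : Measurable[sampleSigma ξ {i | i.1 < k + 1}] (A.state ξ k) :=
      ih.mono (sampleSigma_mono fun i hi => Nat.lt_succ_of_lt hi) le_rfl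
    have h2 : Measurable[sampleSigma ξ {i | i.1 < k + 1}] (samples ξ k) :=
      (measurable_samples_sampleSigma k).mono
        (sampleSigma_mono fun i hi => by rw [Set.mem_ofPred_eq] at *; omega) le_rfl
    have h3 : Measurable[sampleSigma ξ {i | i.1 < k + 1}]
        (fun ω => (samples ξ k ω, A.state ξ k ω)) := h2.prodMk h1
    have h4 := hA.next.comp h3
    exact h4

/-- The target set has not been reached in the first `k` iterations. -/
def alive (A : SASS m D) (ξ : ℕ × OracleCall × ℕ → Ω → D) (G : Set (EuclideanSpace ℝ (Fin m)))
    (k : ℕ) : Set Ω :=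
  {ω | ∀ j ≤ k, A.iterate ξ j ω ∉ G}

theorem measurableSet_alive (hA : A.MeasurableData) {G : Set (EuclideanSpace ℝ (Fin m))}
    (hG : MeasurableSet G) (k : ℕ) :
    MeasurableSet[sampleSigma ξ {i | i.1 < k}] (A.alive ξ G k) := by
  have h : A.alive ξ G k = ⋂ j ∈ Set.Iic k, (A.state ξ j) ⁻¹' {z | z.1 ∉ G} := by
    ext ω; simp [alive, iterate]
  rw [h]
  refine MeasurableSet.biInter (Set.to_countable _) fun j hj => ?_
  have hmj : Measurable[sampleSigma ξ {i | i.1 < k}] (A.state ξ j) :=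
    (hA.state_sampleSigma j).mono
      (sampleSigma_mono fun i hi => lt_of_lt_of_le hi (Set.mem_Iic.1 hj)) le_rfl
  exact hmj (measurable_fst hG.compl)

end SASS

/-! ### Freshness of the samples -/

namespace IsIIDSampling

variable {m : ℕ} {D : Type u} [MeasurableSpace D] {Ω : Type v} [MeasurableSpace Ω]
  {P : Measure Ω} {𝒟 : Measure D} {ξ : ℕ × OracleCall × ℕ → Ω → D}

theorem sampleSigma_le (h : IsIIDSampling P 𝒟 ξ) (S : Set (ℕ × OracleCall × ℕ)) :
    SASS.sampleSigma ξ S ≤ ‹MeasurableSpace Ω› :=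
  iSup₂_le fun i _ => (h.measurable i).comap_le

theorem indepFun_samples (h : IsIIDSampling P 𝒟 ξ) {β : Type*} [MeasurableSpace β] {X : Ω → β}
    {k : ℕ} (hX : Measurable[SASS.sampleSigma ξ {i | i.1 < k}] X) :
    IndepFun X (SASS.samples ξ k) P := by
  refine indepFun_of_measurable_iSup h.measurable h.indep (S := {i | i.1 < k})
    (T := {i | i.1 = k}) ?_ hX (SASS.measurable_samples_sampleSigma k)
  exact Set.disjoint_left.2 fun i (hi : i.1 < k) (hi' : i.1 = k) => by omega

theorem measurable_samples (h : IsIIDSampling P 𝒟 ξ) (k : ℕ) : Measurable (SASS.samples ξ k) :=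
  (SASS.measurable_samples_sampleSigma k).mono (h.sampleSigma_le _) le_rfl

theorem indep_stream (h : IsIIDSampling P 𝒟 ξ) (k : ℕ) (j : OracleCall) :
    iIndepFun (fun i ω => SASS.samples ξ k ω j i) P :=
  h.indep.precomp (g := fun i => (k, j, i)) fun a b hab => by simpa using hab

/-- With x and α frozen, the trial point depends on the gradient stream only, hence is independent
of the stream used to evaluate the loss there; a bound uniform in the point survives. -/
theorem lintegral_trial_le [IsProbabilityMeasure P] (h : IsIIDSampling P 𝒟 ξ) {A : SASS m D}
    (hA : A.MeasurableData) (k : ℕ) (x : EuclideanSpace ℝ (Fin m)) (α : ℝ)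
    {F : EuclideanSpace ℝ (Fin m) × (ℕ → D) → ENNReal} (hF : Measurable F) {B : ENNReal}
    (hB : ∀ y, ∫⁻ ω, F (y, SASS.samples ξ k ω .trialValue) ∂P ≤ B) :
    ∫⁻ ω, F (x + A.trialStep (SASS.samples ξ k ω) x α, SASS.samples ξ k ω .trialValue) ∂P ≤
      B := by
  have hstream : ∀ j, Measurable[SASS.sampleSigma ξ {i | i.2.1 = j}]
      (fun ω => SASS.samples ξ k ω j) := fun j => by
    refine @measurable_pi_lambda _ _ _ (SASS.sampleSigma ξ {i | i.2.1 = j}) _ _ fun i => ?_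
    exact SASS.measurable_sampleSigma (i := (k, j, i)) rfl
  have hX : Measurable[SASS.sampleSigma ξ {i | i.2.1 = .grad}]
      (fun ω => x + A.trialStep (SASS.samples ξ k ω) x α) := by
    have h1 : Measurable (fun s : ℕ → D => (((s, x), α) :
      ((ℕ → D) × EuclideanSpace ℝ (Fin m)) × ℝ)) :=
      (measurable_id.prodMk measurable_const).prodMk measurable_const
    exact (hA.trialPoint.comp h1).comp (hstream .grad)
  have hind := indepFun_of_measurable_iSup h.measurable h.indep
    (S := {i | i.2.1 = .grad}) (T := {i | i.2.1 = .trialValue})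
    (Set.disjoint_left.2 fun i (hi : i.2.1 = .grad) (hi' : i.2.1 = .trialValue) => by
      rw [hi] at hi'; cases hi') hX (hstream .trialValue)
  rw [hind.lintegral_comp_prodMk (hX.mono (h.sampleSigma_le _) le_rfl)
    ((hstream _).mono (h.sampleSigma_le _) le_rfl) hF]
  exact (lintegral_mono fun ω => hB _).trans (by simp)

end IsIIDSampling

/-! ### Guarantees for the three oracle calls -/

namespace SASS

variable {m : ℕ} {D : Type u} [MeasurableSpace D] {Ω : Type v} [MeasurableSpace Ω]
  {P : Measure Ω} {𝒟 : Measure D} {ξ : ℕ × OracleCall × ℕ → Ω → D}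

/-- The probabilistic guarantees of the three oracles, for every iteration and every state. -/
structure OracleBounds (A : SASS m D) (P : Measure Ω) (ξ : ℕ × OracleCall × ℕ → Ω → D)
    (φ : EuclideanSpace ℝ (Fin m) → ℝ) (κ τ ρ c t δ η t₁ M : ℝ) : Prop where
  accurate : ∀ k x α, 0 < α →
    P {ω | ¬ A.Accurate φ κ τ ρ c t (samples ξ k ω) x α} ≤ ENNReal.ofReal δ
  value : ∀ k x, ∀ u ∈ Set.Icc 0 (t₁ / 2),
    ∫⁻ ω, ENNReal.ofReal (Real.exp (u * (A.valueErr φ (samples ξ k ω) x / t))) ∂P ≤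
      ENNReal.ofReal (1 + u * η + 8 * (u / t₁) ^ 2 * M)
  trial : ∀ k x α, ∀ u ∈ Set.Icc 0 (t₁ / 2),
    ∫⁻ ω, ENNReal.ofReal (Real.exp (u * (A.trialErr φ (samples ξ k ω) x α / t))) ∂P ≤
      ENNReal.ofReal (1 + u * η + 8 * (u / t₁) ^ 2 * M)

theorem measurableData_forERM {l : EuclideanSpace ℝ (Fin m) → D → ℝ} {L : NNReal}
    {σf ν b Mc Mv : ℝ} (h : ERMAssumptions 𝒟 l L σf ν b Mc Mv) (θ γ : ℝ) (αmax : WithTop ℝ)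
    (x₀ : EuclideanSpace ℝ (Fin m)) (α₀ κ τ ρ a₀ a₁ t : ℝ) :
    (forERM l θ γ αmax x₀ α₀ κ τ σf Mc Mv ρ a₀ a₁ t).MeasurableData where
  loss := h.measurable_loss
  differentiable := h.differentiable_loss
  gradBatch := by
    have h1 : Measurable (fun α : ℝ => a₁ * (Mc / t + Mv / (min τ (κ * α)) ^ 2)) :=
      (measurable_const.add (measurable_const.div
        ((measurable_const.min (measurable_id.const_mul κ)).pow_const 2))).const_mul a₁
    exact measurable_const.max (Nat.measurable_ceil.comp h1)

theorem measure_gt_le_of_sq {Z : Ω → ℝ} (hZ : Measurable Z) {t u V : ℝ} (ht : 0 < t) (hu : 0 < u)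
    (h : ∫⁻ ω, ENNReal.ofReal ((Z ω / t) ^ 2) ∂P ≤ ENNReal.ofReal V) :
    P {ω | u * t < Z ω} ≤ ENNReal.ofReal (V / u ^ 2) := by
  have hsub : {ω | u * t < Z ω} ⊆
      {ω | ENNReal.ofReal (u ^ 2) ≤ ENNReal.ofReal ((Z ω / t) ^ 2)} := by
    intro ω hω
    have hω : u * t < Z ω := hω
    refine ENNReal.ofReal_le_ofReal (pow_le_pow_left₀ hu.le ?_ 2)
    rw [le_div_iff₀ ht]; exact hω.le
  refine (measure_mono hsub).trans ((meas_ge_le_lintegral_div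
    ((hZ.div_const t).pow_const 2).ennreal_ofReal.aemeasurable
    (by simp only [ne_eq, ENNReal.ofReal_eq_zero, not_le]; positivity) ENNReal.ofReal_ne_top).trans
    ?_)
  rw [ENNReal.ofReal_div_of_pos (by positivity)]
  gcongr

/-- Chebyshev at level ρt/4 bounds the failure of each value call by 16V/ρ², so the two together by
32V/ρ². -/
theorem oracleBounds_of_stream [IsProbabilityMeasure P] {A : SASS m D} (hA : A.MeasurableData)
    (hξ : IsIIDSampling P 𝒟 ξ) {φ : EuclideanSpace ℝ (Fin m) → ℝ} (hφ : Measurable φ)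
    {κ τ ρ c t δ δ₁ V η t₁ M : ℝ} (hρ : 0 < ρ) (ht : 0 < t) (hη : 0 < η) (ht₁ : 0 < t₁)
    (hM : 0 ≤ M) (hV : 0 ≤ V) (hδ₁ : 0 ≤ δ₁) (hVη : V ≤ η ^ 2) (hδ : δ₁ + 32 * V / ρ ^ 2 ≤ δ)
    (hgrad : ∀ k x α, 0 < α → P {ω | ¬ ‖A.gradEst (samples ξ k ω) x α - gradient φ x‖ ≤
      c * (√t + min τ (κ * α) * ‖gradient φ x‖)} ≤ ENNReal.ofReal δ₁)
    (hsq : ∀ k j x, ∫⁻ ω, ENNReal.ofReal ((|minibatchAvg (A.loss x) (samples ξ k ω j)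
      A.valueBatch - φ x| / t) ^ 2) ∂P ≤ ENNReal.ofReal V)
    (hexp : ∀ k j x, ∫⁻ ω, ENNReal.ofReal (Real.exp (t₁ * (|minibatchAvg (A.loss x)
      (samples ξ k ω j) A.valueBatch - φ x| / t))) ∂P ≤ ENNReal.ofReal M) :
    A.OracleBounds P ξ φ κ τ ρ c t δ η t₁ M := by
  have hsk := hξ.measurable_samples
  have hvm : ∀ k x, Measurable (fun ω => A.valueErr φ (samples ξ k ω) x) := by
    intro k x
    have h1 := (hA.valueErr_uncurry hφ).comp ((hsk k).prodMk (measurable_const (a := (x, (0 : ℝ)))))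
    exact h1
  have htm : ∀ k x α, Measurable (fun ω => A.trialErr φ (samples ξ k ω) x α) := by
    intro k x α
    have h1 := (hA.trialErr_uncurry hφ).comp ((hsk k).prodMk (measurable_const (a := (x, α))))
    exact h1
  have hQ : Measurable (fun p : EuclideanSpace ℝ (Fin m) × (ℕ → D) =>
      |minibatchAvg (A.loss p.1) p.2 A.valueBatch - φ p.1|) :=
    continuous_abs.measurable.comp ((measurable_minibatchAvg_uncurry hA.loss _).sub
      (hφ.comp measurable_fst))
  have htsq : ∀ k x α, ∫⁻ ω, ENNReal.ofReal ((A.trialErr φ (samples ξ k ω) x α / t) ^ 2) ∂P ≤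
      ENNReal.ofReal V := by
    intro k x α
    have h1 := hξ.lintegral_trial_le hA k x α (((hQ.div_const t).pow_const 2).ennreal_ofReal)
      fun y => hsq k .trialValue y
    exact h1
  have htexp : ∀ k x α, ∫⁻ ω, ENNReal.ofReal (Real.exp (t₁ *
      (A.trialErr φ (samples ξ k ω) x α / t))) ∂P ≤ ENNReal.ofReal M := by
    intro k x α
    have h1 := hξ.lintegral_trial_le hA k x α ((hQ.div_const t).const_mul t₁).exp.ennreal_ofReal
      fun y => hexp k .trialValue y
    exact h1
  refine ⟨fun k x α hα => ?_, fun k x u hu => ?_, fun k x α u hu => ?_⟩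
  · have hsub : {ω | ¬ A.Accurate φ κ τ ρ c t (samples ξ k ω) x α} ⊆
        ({ω | ¬ ‖A.gradEst (samples ξ k ω) x α - gradient φ x‖ ≤
          c * (√t + min τ (κ * α) * ‖gradient φ x‖)} ∪
        {ω | ρ / 4 * t < A.valueErr φ (samples ξ k ω) x}) ∪
        {ω | ρ / 4 * t < A.trialErr φ (samples ξ k ω) x α} := by
      intro ω hω
      by_contra hcon
      simp only [Set.mem_union, Set.mem_ofPred_eq, not_or, not_not, not_lt] at hcon hω
      exact hω ⟨hcon.1.1, by linarith [hcon.1.2], by linarith [hcon.2]⟩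
    have hv := measure_gt_le_of_sq (hvm k x) ht (show 0 < ρ / 4 by positivity)
      (hsq k .value x)
    have htr := measure_gt_le_of_sq (htm k x α) ht (show 0 < ρ / 4 by positivity) (htsq k x α)
    calc _ ≤ _ := measure_mono hsub
      _ ≤ _ := measure_union_le _ _
      _ ≤ _ := add_le_add_left (measure_union_le _ _) _
      _ ≤ _ := add_le_add (add_le_add (hgrad k x α hα) hv) htr
      _ = ENNReal.ofReal (δ₁ + 32 * V / ρ ^ 2) := by
        rw [← ENNReal.ofReal_add (by positivity) (by positivity),
          ← ENNReal.ofReal_add (by positivity) (by positivity)]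
        congr 1
        field_simp
        ring
      _ ≤ _ := ENNReal.ofReal_le_ofReal hδ
  · exact lintegral_exp_le_of_sq ((hvm k x).div_const t)
      (fun ω => div_nonneg (abs_nonneg _) ht.le) hη ht₁ hM hu.1 hu.2
      ((hsq k .value x).trans (ENNReal.ofReal_le_ofReal hVη)) (hexp k .value x)
  · exact lintegral_exp_le_of_sq ((htm k x α).div_const t)
      (fun ω => div_nonneg (abs_nonneg _) ht.le) hη ht₁ hM hu.1 hu.2
      ((htsq k x α).trans (ENNReal.ofReal_le_ofReal hVη)) (htexp k x α)

end SASS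

/-! ### Exponential tail of the stopping time -/

theorem Real.exp_half_add_le (a b : ℝ) : Real.exp ((a + b) / 2) ≤ (Real.exp a + Real.exp b) / 2 := by
  have h1 : Real.exp ((a + b) / 2) = Real.exp (a / 2) * Real.exp (b / 2) := by
    rw [← Real.exp_add]; ring_nf
  have h2 : ∀ c : ℝ, Real.exp c = Real.exp (c / 2) ^ 2 := fun c => by
    rw [← Real.exp_nat_mul]; push_cast; ring_nf
  rw [h1, h2 a, h2 b]
  nlinarith [sq_nonneg (Real.exp (a / 2) - Real.exp (b / 2))]

/-- The factor by which the exponential Lyapunov function contracts in one iteration. -/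
noncomputable def contraction (w ρ δ η t₁ M lam : ℝ) : ℝ :=
  (Real.exp (-(2 * lam)) + δ * (Real.exp (2 * lam) - Real.exp (-(2 * lam)))) / 2 +
    Real.exp (2 * lam * w * ρ) * (1 + 4 * lam * w * η + 8 * (4 * lam * w / t₁) ^ 2 * M) / 2

namespace SASS

variable {m : ℕ} {D : Type u} [MeasurableSpace D] {Ω : Type v} [MeasurableSpace Ω]
  {P : Measure Ω} {𝒟 : Measure D} {ξ : ℕ × OracleCall × ℕ → Ω → D}
  {A : SASS m D} {φ : EuclideanSpace ℝ (Fin m) → ℝ}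

/-- The weight and the state belong to the past, so the samples of iteration k can be averaged with
both frozen, and the estimate is needed only where the weight is nonzero. -/
theorem lintegral_mul_state_le [IsProbabilityMeasure P] (hξ : IsIIDSampling P 𝒟 ξ)
    (hA : A.MeasurableData) (k : ℕ) {a : Ω → ENNReal}
    (ha : Measurable[sampleSigma ξ {i | i.1 < k}] a)
    {Q : (EuclideanSpace ℝ (Fin m) × ℝ) × (OracleCall → ℕ → D) → ENNReal} (hQ : Measurable Q)
    {R : EuclideanSpace ℝ (Fin m) × ℝ → ENNReal}
    (hR : ∀ ω, a ω ≠ 0 →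
      ∫⁻ ω', Q (A.state ξ k ω, samples ξ k ω') ∂P ≤ R (A.state ξ k ω)) :
    ∫⁻ ω, a ω * Q (A.state ξ k ω, samples ξ k ω) ∂P ≤ ∫⁻ ω, a ω * R (A.state ξ k ω) ∂P := by
  have hX : Measurable[sampleSigma ξ {i | i.1 < k}] (fun ω => (a ω, A.state ξ k ω)) :=
    ha.prodMk (hA.state_sampleSigma k)
  have hF : Measurable (fun p : (ENNReal × (EuclideanSpace ℝ (Fin m) × ℝ)) ×
      (OracleCall → ℕ → D) => p.1.1 * Q (p.1.2, p.2)) := by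
    have h1 : Measurable (fun p : (ENNReal × (EuclideanSpace ℝ (Fin m) × ℝ)) ×
      (OracleCall → ℕ → D) => (p.1.2, p.2)) :=
      (measurable_snd.comp measurable_fst).prodMk measurable_snd
    exact (measurable_fst.comp measurable_fst).mul (hQ.comp h1)
  have h := (hξ.indepFun_samples hX).lintegral_comp_prodMk (hX.mono (hξ.sampleSigma_le _) le_rfl)
    (hξ.measurable_samples k) hF
  simp only at h
  rw [h]
  refine lintegral_mono fun ω => ?_
  have h2 : Measurable (fun ω' => Q (A.state ξ k ω, samples ξ k ω')) :=
    (hQ.comp measurable_prodMk_left).comp (hξ.measurable_samples k)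
  rw [lintegral_const_mul _ h2]
  by_cases h0 : a ω = 0
  · simp [h0]
  · gcongr; exact hR ω h0

/-- The inaccuracy event and the value errors are dependent. Convexity of exp separates the event
from the noise, then the two errors from each other, at the price of doubled exponents; the
derivative of the bound at λ = 0 is not affected by this. -/
theorem lintegral_exp_lyapunov_next_le [IsProbabilityMeasure P] (hξ : IsIIDSampling P 𝒟 ξ)
    (hA : A.MeasurableData) {L : NNReal} {κ τ αs b₁ ρ c t c₅ w δ η t₁ M lam : ℝ}
    {G : Set (EuclideanSpace ℝ (Fin m))} {Φ : EuclideanSpace ℝ (Fin m) → ℝ}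
    (hf : Differentiable ℝ φ) (hL : LipschitzWith L (gradient φ))
    (hc : IsAccuracyLevel L A.θ κ τ αs b₁ ρ c) (hΦ : IsPotential φ G Φ b₁ c₅ t)
    (hO : A.OracleBounds P ξ φ κ τ ρ c t δ η t₁ M)
    (ht : 0 < t) (hr : A.r = ρ * t) (hγ : A.γ ∈ Set.Ioo (0 : ℝ) 1)
    (hmax : (αs : WithTop ℝ) ≤ A.αmax) (hw0 : 0 ≤ w)
    (hw : 2 ≤ w * (c₅ * (A.θ * A.γ ^ 2 * αs / 4))) (hδ : 0 ≤ δ) (hη : 0 ≤ η) (hM : 0 ≤ M)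
    (hlam : 0 ≤ lam) (hlt : 4 * lam * w ≤ t₁ / 2) (k : ℕ)
    {z : EuclideanSpace ℝ (Fin m) × ℝ} (hz : 0 < z.2) (hzG : z.1 ∉ G) :
    ∫⁻ ω, {y : EuclideanSpace ℝ (Fin m) × ℝ | y.1 ∉ G}.indicator
        (fun y => ENNReal.ofReal (Real.exp (lam * A.lyapunov Φ w αs y)))
        (A.next (samples ξ k ω) z) ∂P ≤
      ENNReal.ofReal (contraction w ρ δ η t₁ M lam) *
        ENNReal.ofReal (Real.exp (lam * A.lyapunov Φ w αs z)) := by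
  have hφ : Measurable φ := hf.continuous.measurable
  set bad : Set Ω := {ω | ¬ A.Accurate φ κ τ ρ c t (samples ξ k ω) z.1 z.2} with hbad
  set e₀ : Ω → ℝ := fun ω => A.valueErr φ (samples ξ k ω) z.1 with he₀
  set e₁ : Ω → ℝ := fun ω => A.trialErr φ (samples ξ k ω) z.1 z.2 with he₁
  have hsub : 0 ≤ Real.exp (2 * lam) - Real.exp (-(2 * lam)) :=
    sub_nonneg.2 (Real.exp_le_exp.2 (by linarith))
  have hm₀ : Measurable e₀ := by
    have h := (hA.valueErr_uncurry hφ).comp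
      ((hξ.measurable_samples k).prodMk (measurable_const (a := z)))
    exact h
  have hm₁ : Measurable e₁ := by
    have h := (hA.trialErr_uncurry hφ).comp
      ((hξ.measurable_samples k).prodMk (measurable_const (a := z)))
    exact h
  have hpt : ∀ ω, {y : EuclideanSpace ℝ (Fin m) × ℝ | y.1 ∉ G}.indicator
        (fun y => ENNReal.ofReal (Real.exp (lam * A.lyapunov Φ w αs y)))
        (A.next (samples ξ k ω) z) ≤
      ENNReal.ofReal (Real.exp (lam * A.lyapunov Φ w αs z)) *
        (bad.indicator (fun _ => ENNReal.ofReal ((Real.exp (2 * lam) - Real.exp (-(2 * lam))) / 2)) ω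
          + (ENNReal.ofReal (Real.exp (-(2 * lam)) / 2) +
          (ENNReal.ofReal (Real.exp (2 * lam * w * ρ) / 4) *
            ENNReal.ofReal (Real.exp (4 * lam * w * (e₀ ω / t))) +
          ENNReal.ofReal (Real.exp (2 * lam * w * ρ) / 4) *
            ENNReal.ofReal (Real.exp (4 * lam * w * (e₁ ω / t)))))) := by
    intro ω
    by_cases hn : (A.next (samples ξ k ω) z).1 ∉ G
    · rw [Set.indicator_of_mem (by exact hn)]
      have hly := lyapunov_next_le hf hL hc hΦ ht hr hγ hmax hw0 hw hz hzG hn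
      set J := {s | A.Accurate φ κ τ ρ c t s z.1 z.2}ᶜ.indicator (fun _ => (2 : ℝ))
        (samples ξ k ω) with hJ
      have hexpJ : ENNReal.ofReal (Real.exp (2 * lam * (J - 1)) / 2) =
          bad.indicator (fun _ =>
            ENNReal.ofReal ((Real.exp (2 * lam) - Real.exp (-(2 * lam))) / 2)) ω +
          ENNReal.ofReal (Real.exp (-(2 * lam)) / 2) := by
        by_cases hb : A.Accurate φ κ τ ρ c t (samples ξ k ω) z.1 z.2
        · have h1 : J = 0 := Set.indicator_of_notMem (by simpa using hb) _
          rw [Set.indicator_of_notMem (by simpa [hbad] using hb), h1, zero_add]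
          ring_nf
        · have h1 : J = 2 := Set.indicator_of_mem (by simpa using hb) _
          rw [Set.indicator_of_mem (by simpa [hbad] using hb), h1,
            ← ENNReal.ofReal_add (by positivity) (by positivity)]
          ring_nf
      have hmain : Real.exp (lam * A.lyapunov Φ w αs (A.next (samples ξ k ω) z)) ≤
          Real.exp (lam * A.lyapunov Φ w αs z) * (Real.exp (2 * lam * (J - 1)) / 2 +
          (Real.exp (2 * lam * w * ρ) / 4 * Real.exp (4 * lam * w * (e₀ ω / t)) +
            Real.exp (2 * lam * w * ρ) / 4 * Real.exp (4 * lam * w * (e₁ ω / t)))) := by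
        have h1 := Real.exp_half_add_le (2 * lam * (J - 1))
          (2 * lam * w * ρ + 2 * lam * w * (e₀ ω / t + e₁ ω / t))
        have h2 := Real.exp_half_add_le (4 * lam * w * (e₀ ω / t)) (4 * lam * w * (e₁ ω / t))
        have h3 : (4 * lam * w * (e₀ ω / t) + 4 * lam * w * (e₁ ω / t)) / 2 =
          2 * lam * w * (e₀ ω / t + e₁ ω / t) := by ring
        rw [h3] at h2
        rw [Real.exp_add] at h1
        have h4 : lam * A.lyapunov Φ w αs (A.next (samples ξ k ω) z) ≤
            lam * A.lyapunov Φ w αs z + (2 * lam * (J - 1) +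
              (2 * lam * w * ρ + 2 * lam * w * (e₀ ω / t + e₁ ω / t))) / 2 := by
          have := mul_le_mul_of_nonneg_left hly hlam
          refine this.trans (le_of_eq ?_)
          simp only [he₀, he₁]
          ring
        refine (Real.exp_le_exp.2 h4).trans ?_
        rw [Real.exp_add]
        refine mul_le_mul_of_nonneg_left (h1.trans ?_) (Real.exp_pos _).le
        have := mul_le_mul_of_nonneg_left h2 (Real.exp_pos (2 * lam * w * ρ)).le
        linarith
      refine (ENNReal.ofReal_le_ofReal hmain).trans (le_of_eq ?_)
      rw [ENNReal.ofReal_mul (by positivity), ENNReal.ofReal_add (by positivity) (by positivity),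
        ENNReal.ofReal_add (by positivity) (by positivity), ENNReal.ofReal_mul (by positivity),
        ENNReal.ofReal_mul (by positivity), hexpJ, add_assoc]
    · rw [Set.indicator_of_notMem (by exact hn)]
      exact zero_le
  refine (lintegral_mono hpt).trans ?_
  rw [lintegral_const_mul' _ _ ENNReal.ofReal_ne_top, mul_comm]
  gcongr
  have hx₀ : Measurable fun ω => ENNReal.ofReal (Real.exp (4 * lam * w * (e₀ ω / t))) :=
    ((hm₀.div_const t).const_mul _).exp.ennreal_ofReal
  have hx₁ : Measurable fun ω => ENNReal.ofReal (Real.exp (4 * lam * w * (e₁ ω / t))) :=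
    ((hm₁.div_const t).const_mul _).exp.ennreal_ofReal
  have hu : 4 * lam * w ∈ Set.Icc 0 (t₁ / 2) := ⟨by positivity, hlt⟩
  have hx₂ : Measurable fun ω => ENNReal.ofReal (Real.exp (-(2 * lam)) / 2) +
      (ENNReal.ofReal (Real.exp (2 * lam * w * ρ) / 4) *
        ENNReal.ofReal (Real.exp (4 * lam * w * (e₀ ω / t))) +
      ENNReal.ofReal (Real.exp (2 * lam * w * ρ) / 4) *
        ENNReal.ofReal (Real.exp (4 * lam * w * (e₁ ω / t)))) :=
    measurable_const.add ((hx₀.const_mul _).add (hx₁.const_mul _))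
  rw [lintegral_add_right _ hx₂,
    lintegral_add_left measurable_const, lintegral_add_left (hx₀.const_mul _),
    lintegral_const_mul _ hx₀, lintegral_const_mul _ hx₁, lintegral_const, measure_univ, mul_one]
  have hb1 := hO.accurate k z.1 z.2 hz
  have hb2 := hO.value k z.1 _ hu
  have hb3 := hO.trial k z.1 z.2 _ hu
  calc _ ≤ ENNReal.ofReal ((Real.exp (2 * lam) - Real.exp (-(2 * lam))) / 2) * ENNReal.ofReal δ +
        (ENNReal.ofReal (Real.exp (-(2 * lam)) / 2) +
        (ENNReal.ofReal (Real.exp (2 * lam * w * ρ) / 4) * ENNReal.ofReal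
          (1 + 4 * lam * w * η + 8 * (4 * lam * w / t₁) ^ 2 * M) +
        ENNReal.ofReal (Real.exp (2 * lam * w * ρ) / 4) * ENNReal.ofReal
          (1 + 4 * lam * w * η + 8 * (4 * lam * w / t₁) ^ 2 * M))) := by
        refine add_le_add ((lintegral_indicator_const_le _ _).trans ?_) ?_
        · gcongr
        · gcongr
    _ = _ := by
        rw [← ENNReal.ofReal_mul (by positivity), ← ENNReal.ofReal_mul (by positivity),
          ← ENNReal.ofReal_add (by positivity) (by positivity),
          ← ENNReal.ofReal_add (by positivity) (by positivity),
          ← ENNReal.ofReal_add (by positivity) (by positivity), contraction]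
        congr 1
        ring

/-- A supermartingale argument on the survival events. The indicator removes points of the target,
where neither the drift nor W ≥ 1 is available. -/
theorem measure_alive_le_of_step [IsProbabilityMeasure P] (hξ : IsIIDSampling P 𝒟 ξ)
    (hA : A.MeasurableData) {G : Set (EuclideanSpace ℝ (Fin m))} (hG : MeasurableSet G)
    {W : EuclideanSpace ℝ (Fin m) × ℝ → ENNReal} (hW : Measurable W) {C : ENNReal} (hC : C ≠ ⊤)
    (hpos : ∀ k ω, 0 < (A.state ξ k ω).2) (hW1 : ∀ z, z.1 ∉ G → 1 ≤ W z)
    (hstep : ∀ k z, 0 < z.2 → z.1 ∉ G → ∫⁻ ω, {y : EuclideanSpace ℝ (Fin m) × ℝ | y.1 ∉ G}.indicator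
      W (A.next (samples ξ k ω) z) ∂P ≤ C * W z) (n : ℕ) :
    P (A.alive ξ G n) ≤ C ^ n * W (A.x₀, A.α₀) := by
  have hle := hξ.sampleSigma_le
  have key : ∀ n, ∫⁻ ω, (A.alive ξ G n).indicator (fun _ => 1) ω * W (A.state ξ n ω) ∂P ≤
      C ^ n * W (A.x₀, A.α₀) := by
    intro n
    induction n with
    | zero =>
      rw [pow_zero, one_mul]
      calc _ ≤ ∫⁻ _, W (A.x₀, A.α₀) ∂P := by
            refine lintegral_mono fun ω => ?_
            refine mul_le_of_le_one_left' ?_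
            exact Set.indicator_le_self' (fun _ _ => zero_le) ω
        _ = _ := by simp
    | succ n ih =>
      have hQ : Measurable (fun p : (EuclideanSpace ℝ (Fin m) × ℝ) × (OracleCall → ℕ → D) =>
          {y : EuclideanSpace ℝ (Fin m) × ℝ | y.1 ∉ G}.indicator W (A.next p.2 p.1)) := by
        have h1 : MeasurableSet {y : EuclideanSpace ℝ (Fin m) × ℝ | y.1 ∉ G} :=
          measurable_fst hG.compl
        have h := (hW.indicator h1).comp (hA.next.comp measurable_swap)
        exact h
      have ha : Measurable[sampleSigma ξ {i | i.1 < n}]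
          ((A.alive ξ G n).indicator fun _ => (1 : ENNReal)) :=
        measurable_const.indicator (measurableSet_alive hA hG n)
      have hR : ∀ ω, (A.alive ξ G n).indicator (fun _ => (1 : ENNReal)) ω ≠ 0 →
          ∫⁻ ω', {y : EuclideanSpace ℝ (Fin m) × ℝ | y.1 ∉ G}.indicator W
            (A.next (samples ξ n ω') (A.state ξ n ω)) ∂P ≤ C * W (A.state ξ n ω) := by
        intro ω hω
        have hal : ω ∈ A.alive ξ G n := by
          by_contra hcon
          exact hω (Set.indicator_of_notMem hcon _)
        exact hstep n _ (hpos n ω) (hal n le_rfl)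
      have hs := lintegral_mul_state_le hξ hA n ha hQ (R := fun z => C * W z) hR
      calc _ ≤ ∫⁻ ω, (A.alive ξ G n).indicator (fun _ => 1) ω *
            {y : EuclideanSpace ℝ (Fin m) × ℝ | y.1 ∉ G}.indicator W
              (A.next (samples ξ n ω) (A.state ξ n ω)) ∂P := by
            refine lintegral_mono fun ω => ?_
            by_cases h : ω ∈ A.alive ξ G (n + 1)
            · have h1 : ω ∈ A.alive ξ G n := fun j hj => h j (hj.trans n.le_succ)
              have h2 : A.next (samples ξ n ω) (A.state ξ n ω) ∈
                {y : EuclideanSpace ℝ (Fin m) × ℝ | y.1 ∉ G} := h (n + 1) le_rfl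
              simp only
              rw [Set.indicator_of_mem h, Set.indicator_of_mem h1, Set.indicator_of_mem h2]
              rfl
            · simp only
              rw [Set.indicator_of_notMem h, zero_mul]
              exact zero_le
        _ ≤ _ := hs
        _ = C * ∫⁻ ω, (A.alive ξ G n).indicator (fun _ => 1) ω * W (A.state ξ n ω) ∂P := by
            rw [← lintegral_const_mul' _ _ hC]
            refine lintegral_congr fun ω => ?_
            ring
        _ ≤ _ := by
            rw [pow_succ', mul_assoc]
            gcongr
  refine le_trans ?_ (key n)
  rw [← lintegral_indicator_one (hle _ _ (measurableSet_alive hA hG n))]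
  refine lintegral_mono fun ω => ?_
  by_cases h : ω ∈ A.alive ξ G n
  · rw [Set.indicator_of_mem h, Set.indicator_of_mem h, one_mul, Pi.one_apply]
    exact hW1 _ (h n le_rfl)
  · rw [Set.indicator_of_notMem h]; exact zero_le

theorem measure_alive_le [IsProbabilityMeasure P] (hξ : IsIIDSampling P 𝒟 ξ)
    (hA : A.MeasurableData) {L : NNReal} {κ τ αs b₁ ρ c t c₅ w δ η t₁ M lam : ℝ}
    {G : Set (EuclideanSpace ℝ (Fin m))} {Φ : EuclideanSpace ℝ (Fin m) → ℝ}
    (hf : Differentiable ℝ φ) (hL : LipschitzWith L (gradient φ))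
    (hc : IsAccuracyLevel L A.θ κ τ αs b₁ ρ c) (hΦ : IsPotential φ G Φ b₁ c₅ t)
    (hO : A.OracleBounds P ξ φ κ τ ρ c t δ η t₁ M)
    (ht : 0 < t) (hr : A.r = ρ * t) (hγ : A.γ ∈ Set.Ioo (0 : ℝ) 1)
    (hmax : (αs : WithTop ℝ) ≤ A.αmax) (hw0 : 0 ≤ w)
    (hw : 2 ≤ w * (c₅ * (A.θ * A.γ ^ 2 * αs / 4))) (hδ : 0 ≤ δ) (hη : 0 ≤ η) (hM : 0 ≤ M)
    (hlam : 0 ≤ lam) (hlt : 4 * lam * w ≤ t₁ / 2) (hα₀ : 0 < A.α₀) (n : ℕ) :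
    P (A.alive ξ G n) ≤ ENNReal.ofReal (contraction w ρ δ η t₁ M lam) ^ n *
        ENNReal.ofReal (Real.exp (lam * A.lyapunov Φ w αs (A.x₀, A.α₀))) := by
  have hWm : Measurable (fun z => ENNReal.ofReal (Real.exp (lam * A.lyapunov Φ w αs z))) :=
    ((measurable_lyapunov hΦ.measurable w αs).const_mul lam).exp.ennreal_ofReal
  refine measure_alive_le_of_step hξ hA hΦ.measurableSet hWm ENNReal.ofReal_ne_top
    (state_snd_pos hγ.1 hc.αs_pos hmax hα₀) (fun z hz => ?_) (fun k z hz hzG =>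
      lintegral_exp_lyapunov_next_le hξ hA hf hL hc hΦ hO ht hr hγ hmax hw0 hw hδ hη hM
            hlam hlt k hz hzG) n
  rw [← ENNReal.ofReal_one]
  refine ENNReal.ofReal_le_ofReal (Real.one_le_exp (mul_nonneg hlam ?_))
  unfold lyapunov
  have := hΦ.nonneg _ hz
  positivity

end SASS

/-! ### Lower bound for the step size -/

/-- The Lyapunov function that controls how far the step size falls below `αb`. -/
noncomputable def stepPotential (αb e α : ℝ) : ℝ := max 1 ((αb / α) ^ e)

theorem one_le_stepPotential (αb e α : ℝ) : 1 ≤ stepPotential αb e α := le_max_left _ _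

theorem stepPotential_eq_one {αb e α : ℝ} (hαb : 0 < αb) (he : 0 ≤ e) (h : αb ≤ α) :
    stepPotential αb e α = 1 :=
  max_eq_left (Real.rpow_le_one (div_nonneg hαb.le (hαb.le.trans h))
    ((div_le_one (hαb.trans_le h)).2 h) he)

theorem measurable_stepPotential (αb e : ℝ) : Measurable (stepPotential αb e) :=
  measurable_const.max ((measurable_const.div measurable_id).pow_const e)

theorem stepPotential_mul_le {αb e α γ : ℝ} (hγ : γ ∈ Set.Ioo (0 : ℝ) 1) (hαb : 0 < αb)
    (he : 0 ≤ e) (hα : 0 < α) :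
    stepPotential αb e (γ * α) ≤ γ⁻¹ ^ e * stepPotential αb e α := by
  have hγ0 := hγ.1
  have hR : 1 ≤ γ⁻¹ ^ e := Real.one_le_rpow ((one_lt_inv₀ hγ.1).2 hγ.2).le he
  have h1 : (αb / (γ * α)) ^ e = γ⁻¹ ^ e * (αb / α) ^ e := by
    rw [← Real.mul_rpow (by positivity) (by positivity)]
    congr 1
    field_simp
  unfold stepPotential
  rw [h1]
  refine max_le ?_ (by gcongr; exact le_max_right _ _)
  exact one_le_mul_of_one_le_of_one_le hR (le_max_left _ _)

theorem stepPotential_success_le {αb e α α' γ : ℝ} (hγ : γ ∈ Set.Ioo (0 : ℝ) 1) (hαb : 0 < αb)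
    (he : 0 ≤ e) (hα : 0 < α) (h : α' = γ⁻¹ * α ∨ αb ≤ α') :
    stepPotential αb e α' ≤ 1 + stepPotential αb e α / γ⁻¹ ^ e := by
  have hγ0 := hγ.1
  have hR : 0 < γ⁻¹ ^ e := Real.rpow_pos_of_pos (by positivity) e
  have hV := one_le_stepPotential αb e α
  have hnn : 0 ≤ stepPotential αb e α / γ⁻¹ ^ e := by positivity
  rcases h with h | h
  · have h1 : (αb / α') ^ e = (αb / α) ^ e / γ⁻¹ ^ e := by
      rw [← Real.div_rpow (by positivity) (by positivity), h]
      congr 1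
      field_simp
    refine max_le (by linarith) ?_
    rw [h1]
    have : (αb / α) ^ e ≤ stepPotential αb e α := le_max_right _ _
    have h2 : (αb / α) ^ e / γ⁻¹ ^ e ≤ stepPotential αb e α / γ⁻¹ ^ e := by gcongr
    linarith
  · rw [stepPotential_eq_one hαb he h]; linarith

namespace SASS

variable {m : ℕ} {D : Type u} {Ω : Type v} [MeasurableSpace Ω]
  {P : Measure Ω} {ξ : ℕ × OracleCall × ℕ → Ω → D}
  {A : SASS m D} {φ : EuclideanSpace ℝ (Fin m) → ℝ}

theorem OracleBounds.not_successful_le {L : NNReal} {κ τ αs b₁ ρ c t δ η t₁ M : ℝ}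
    (hO : A.OracleBounds P ξ φ κ τ ρ c t δ η t₁ M)
    (hf : Differentiable ℝ φ) (hL : LipschitzWith L (gradient φ))
    (hc : IsAccuracyLevel L A.θ κ τ αs b₁ ρ c) (ht : 0 < t) (hr : A.r = ρ * t) (k : ℕ)
    (x : EuclideanSpace ℝ (Fin m)) {α : ℝ} (hα : 0 < α) (hαs : α ≤ αs) :
    P {ω | ¬ A.Successful (samples ξ k ω) x α} ≤ ENNReal.ofReal δ := by
  have hsub : {ω | ¬ A.Successful (samples ξ k ω) x α} ⊆
      {ω | ¬ A.Accurate φ κ τ ρ c t (samples ξ k ω) x α} := fun ω hω hacc =>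
    hω (Accurate.successful hf hL hc ht hr hα hαs hacc)
  exact (measure_mono hsub).trans (hO.accurate k x α hα)

/-- Write R = γ^{−e}. Below αb a success divides the potential by R, up to an additive 1, and a
failure multiplies it by at most R; 1/R + Rδ ≤ 1 excludes multiplicative growth. Above αb the
potential is 1 and a failure raises it to at most R. Hence the growth of the mean is additive. -/
theorem lintegral_stepPotential_next_le [IsProbabilityMeasure P] {αb e δ : ℝ}
    (hγ : A.γ ∈ Set.Ioo (0 : ℝ) 1) (hαb : 0 < αb) (hmax : (αb : WithTop ℝ) ≤ A.αmax)
    (he : 0 ≤ e) (hδ : 0 ≤ δ) (hδe : 1 / A.γ⁻¹ ^ e + A.γ⁻¹ ^ e * δ ≤ 1) (k : ℕ)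
    (hfail : ∀ x α, 0 < α → α ≤ αb →
      P {ω | ¬ A.Successful (samples ξ k ω) x α} ≤ ENNReal.ofReal δ)
    {z : EuclideanSpace ℝ (Fin m) × ℝ} (hz : 0 < z.2) :
    ∫⁻ ω, ENNReal.ofReal (stepPotential αb e (A.next (samples ξ k ω) z).2) ∂P ≤
      ENNReal.ofReal (stepPotential αb e z.2 + A.γ⁻¹ ^ e) := by
  have hR : 1 ≤ A.γ⁻¹ ^ e := Real.one_le_rpow ((one_lt_inv₀ hγ.1).2 hγ.2).le he
  set R := A.γ⁻¹ ^ e with hRdef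
  have hV := one_le_stepPotential αb e z.2
  set V := stepPotential αb e z.2 with hVdef
  have hsucc : ∀ ω, A.Successful (samples ξ k ω) z.1 z.2 →
      stepPotential αb e (A.next (samples ξ k ω) z).2 ≤ 1 + V / R := fun ω h =>
    stepPotential_success_le hγ hαb he hz (next_of_successful h hmax).2.2
  have hunsucc : ∀ ω, ¬ A.Successful (samples ξ k ω) z.1 z.2 →
      stepPotential αb e (A.next (samples ξ k ω) z).2 ≤ R * V := fun ω h => by
    rw [next_of_not_successful h]
    exact stepPotential_mul_le hγ hαb he hz
  rcases le_or_gt z.2 αb with hle | hgt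
  · have hpt : ∀ ω, ENNReal.ofReal (stepPotential αb e (A.next (samples ξ k ω) z).2) ≤
        ENNReal.ofReal (1 + V / R) + {ω | ¬ A.Successful (samples ξ k ω) z.1 z.2}.indicator
          (fun _ => ENNReal.ofReal (R * V)) ω := by
      intro ω
      by_cases h : A.Successful (samples ξ k ω) z.1 z.2
      · exact (ENNReal.ofReal_le_ofReal (hsucc ω h)).trans le_self_add
      · rw [Set.indicator_of_mem (by exact h)]
        exact (ENNReal.ofReal_le_ofReal (hunsucc ω h)).trans le_add_self
    refine (lintegral_mono hpt).trans ?_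
    rw [lintegral_add_left measurable_const, lintegral_const, measure_univ, mul_one]
    calc _ ≤ ENNReal.ofReal (1 + V / R) + ENNReal.ofReal (R * V) * ENNReal.ofReal δ := by
          gcongr
          refine (lintegral_indicator_const_le _ _).trans ?_
          gcongr
          exact hfail z.1 z.2 hz hle
      _ = ENNReal.ofReal (1 + V * (1 / R + R * δ)) := by
          rw [← ENNReal.ofReal_mul (by positivity), ← ENNReal.ofReal_add (by positivity)
            (by positivity)]
          congr 1
          ring
      _ ≤ _ := by
          refine ENNReal.ofReal_le_ofReal ?_
          nlinarith
  · have hV1 : V = 1 := stepPotential_eq_one hαb he hgt.le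
    calc _ ≤ ∫⁻ _, ENNReal.ofReal (V + R) ∂P := by
          refine lintegral_mono fun ω => ENNReal.ofReal_le_ofReal ?_
          by_cases h : A.Successful (samples ξ k ω) z.1 z.2
          · have h1 := (next_of_successful h hmax).2.2
            have h2 : αb ≤ (A.next (samples ξ k ω) z).2 := by
              rcases h1 with h1 | h1
              · rw [h1]
                exact hgt.le.trans (le_mul_of_one_le_left hz.le ((one_lt_inv₀ hγ.1).2 hγ.2).le)
              · exact h1
            rw [stepPotential_eq_one hαb he h2]
            linarith
          · refine (hunsucc ω h).trans ?_
            rw [hV1]; linarith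
      _ = _ := by simp

variable [MeasurableSpace D] [IsProbabilityMeasure P] {𝒟 : Measure D}

theorem lintegral_stepPotential_le (hξ : IsIIDSampling P 𝒟 ξ) (hA : A.MeasurableData)
    {αb e δ : ℝ} (hγ : A.γ ∈ Set.Ioo (0 : ℝ) 1) (hαb : 0 < αb)
    (hmax : (αb : WithTop ℝ) ≤ A.αmax) (hα₀ : αb ≤ A.α₀) (he : 0 ≤ e) (hδ : 0 ≤ δ)
    (hδe : 1 / A.γ⁻¹ ^ e + A.γ⁻¹ ^ e * δ ≤ 1)
    (hfail : ∀ k x α, 0 < α → α ≤ αb →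
      P {ω | ¬ A.Successful (samples ξ k ω) x α} ≤ ENNReal.ofReal δ) (k : ℕ) :
    ∫⁻ ω, ENNReal.ofReal (stepPotential αb e (A.stepSize ξ k ω)) ∂P ≤
      ENNReal.ofReal (1 + k * A.γ⁻¹ ^ e) := by
  have hR : 0 < A.γ⁻¹ ^ e := Real.rpow_pos_of_pos (inv_pos.2 hγ.1) e
  induction k with
  | zero =>
    have h0 : ∀ ω, stepPotential αb e (A.stepSize ξ 0 ω) = 1 := fun ω =>
      stepPotential_eq_one hαb he hα₀
    simp [h0]
  | succ k ih =>
    have hQ : Measurable (fun p : (EuclideanSpace ℝ (Fin m) × ℝ) × (OracleCall → ℕ → D) =>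
        ENNReal.ofReal (stepPotential αb e (A.next p.2 p.1).2)) := by
      have h := ((measurable_stepPotential αb e).comp
        (measurable_snd.comp (hA.next.comp measurable_swap))).ennreal_ofReal
      exact h
    have h := lintegral_mul_state_le hξ hA k (a := fun _ => 1) (@measurable_const _ _ _ _ _) hQ
      (R := fun z => ENNReal.ofReal (stepPotential αb e z.2 + A.γ⁻¹ ^ e))
      (fun ω _ => lintegral_stepPotential_next_le hγ hαb hmax he hδ hδe k (hfail k)
        (state_snd_pos hγ.1 hαb hmax (hαb.trans_le hα₀) k ω))
    simp only [one_mul] at h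
    refine h.trans ?_
    have h2 : ∀ ω, ENNReal.ofReal (stepPotential αb e (A.state ξ k ω).2 + A.γ⁻¹ ^ e) =
        ENNReal.ofReal (stepPotential αb e (A.stepSize ξ k ω)) + ENNReal.ofReal (A.γ⁻¹ ^ e) :=
      fun ω => ENNReal.ofReal_add (zero_le_one.trans (one_le_stepPotential _ _ _)) hR.le
    simp only [h2]
    rw [lintegral_add_right _ measurable_const, lintegral_const, measure_univ, mul_one]
    calc _ ≤ ENNReal.ofReal (1 + k * A.γ⁻¹ ^ e) + ENNReal.ofReal (A.γ⁻¹ ^ e) := by gcongr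
      _ = _ := by
        rw [← ENNReal.ofReal_add (by positivity) (by positivity)]
        congr 1
        push_cast
        ring

/-- The event forces the potential above n^{ae} ≥ n^{2+ϖ}, while its mean is O(n). The linear mean
and the union over n iterations each cost one power of n. -/
theorem measure_exists_stepSize_lt_le (hξ : IsIIDSampling P 𝒟 ξ) (hA : A.MeasurableData)
    {αb e δ a ϖ : ℝ} (hγ : A.γ ∈ Set.Ioo (0 : ℝ) 1) (hαb : 0 < αb)
    (hmax : (αb : WithTop ℝ) ≤ A.αmax) (hα₀ : αb ≤ A.α₀) (he : 0 ≤ e) (hδ : 0 ≤ δ)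
    (hδe : 1 / A.γ⁻¹ ^ e + A.γ⁻¹ ^ e * δ ≤ 1)
    (hfail : ∀ k x α, 0 < α → α ≤ αb →
      P {ω | ¬ A.Successful (samples ξ k ω) x α} ≤ ENNReal.ofReal δ)
    (hae : 2 + ϖ ≤ a * e) {n : ℕ} (hn : 0 < n) :
    P {ω | ∃ k < n, A.stepSize ξ k ω < αb * (n : ℝ) ^ (-a)} ≤
      ENNReal.ofReal ((1 + A.γ⁻¹ ^ e) * (n : ℝ) ^ (-ϖ)) := by
  have hR : 0 < A.γ⁻¹ ^ e := Real.rpow_pos_of_pos (inv_pos.2 hγ.1) e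
  have hn1 : (1 : ℝ) ≤ n := by exact_mod_cast hn
  have hn0 : (0 : ℝ) < n := by linarith
  have hpow : 0 < (n : ℝ) ^ (2 + ϖ) := Real.rpow_pos_of_pos hn0 _
  have hone : ∀ k < n, P {ω | A.stepSize ξ k ω < αb * (n : ℝ) ^ (-a)} ≤
      ENNReal.ofReal (((1 + A.γ⁻¹ ^ e) * n) / (n : ℝ) ^ (2 + ϖ)) := by
    intro k hk
    have hsub : {ω | A.stepSize ξ k ω < αb * (n : ℝ) ^ (-a)} ⊆
        {ω | ENNReal.ofReal ((n : ℝ) ^ (2 + ϖ)) ≤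
          ENNReal.ofReal (stepPotential αb e (A.stepSize ξ k ω))} := by
      intro ω hω
      have hω : A.stepSize ξ k ω < αb * (n : ℝ) ^ (-a) := hω
      refine ENNReal.ofReal_le_ofReal (le_trans ?_ (le_max_right _ _))
      have hpos : 0 < A.stepSize ξ k ω :=
        state_snd_pos hγ.1 hαb hmax (hαb.trans_le hα₀) k ω
      have h1 : (n : ℝ) ^ a ≤ αb / A.stepSize ξ k ω := by
        rw [le_div_iff₀ hpos]
        rw [Real.rpow_neg hn0.le, ← div_eq_mul_inv, lt_div_iff₀ (Real.rpow_pos_of_pos hn0 _)] at hω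
        linarith
      calc (n : ℝ) ^ (2 + ϖ) ≤ (n : ℝ) ^ (a * e) := Real.rpow_le_rpow_of_exponent_le hn1 hae
        _ = ((n : ℝ) ^ a) ^ e := Real.rpow_mul hn0.le _ _
        _ ≤ _ := Real.rpow_le_rpow (Real.rpow_nonneg hn0.le _) h1 he
    have hmk : Measurable (fun ω => ENNReal.ofReal (stepPotential αb e (A.stepSize ξ k ω))) := by
      have h := ((measurable_stepPotential αb e).comp (measurable_snd.comp
        ((hA.state_sampleSigma k).mono (hξ.sampleSigma_le _) le_rfl))).ennreal_ofReal
      exact h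
    refine (measure_mono hsub).trans ((meas_ge_le_lintegral_div hmk.aemeasurable
      (by simpa using hpow) ENNReal.ofReal_ne_top).trans ?_)
    rw [ENNReal.ofReal_div_of_pos hpow]
    gcongr
    refine (lintegral_stepPotential_le hξ hA hγ hαb hmax hα₀ he hδ hδe hfail k).trans
      (ENNReal.ofReal_le_ofReal ?_)
    have hk1 : (k : ℝ) ≤ n := by exact_mod_cast hk.le
    nlinarith
  have hunion : {ω | ∃ k < n, A.stepSize ξ k ω < αb * (n : ℝ) ^ (-a)} =
      ⋃ k ∈ Finset.range n, {ω | A.stepSize ξ k ω < αb * (n : ℝ) ^ (-a)} := by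
    ext ω; simp
  rw [hunion]
  refine (measure_biUnion_finset_le _ _).trans ?_
  refine (Finset.sum_le_sum fun k hk => hone k (Finset.mem_range.1 hk)).trans (le_of_eq ?_)
  rw [Finset.sum_const, Finset.card_range, nsmul_eq_mul, ← ENNReal.ofReal_natCast,
    ← ENNReal.ofReal_mul hn0.le]
  congr 1
  rw [Real.rpow_add hn0, Real.rpow_neg hn0.le, Real.rpow_two]
  have := Real.rpow_pos_of_pos hn0 ϖ
  field_simp

end SASS

/-! ### Choice of the constants -/

theorem hasDerivAt_contraction_zero (w ρ δ η t₁ M : ℝ) :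
    HasDerivAt (contraction w ρ δ η t₁ M) (-1 + 2 * δ + w * ρ + 2 * w * η) 0 := by
  have h2 : HasDerivAt (fun x : ℝ => 2 * x) 2 0 := by
    simpa using (hasDerivAt_id (0 : ℝ)).const_mul 2
  have h4 : HasDerivAt (fun x : ℝ => 4 * x * w) (4 * w) 0 := by
    simpa using ((hasDerivAt_id (0 : ℝ)).const_mul 4).mul_const w
  have h2w : HasDerivAt (fun x : ℝ => 2 * x * w * ρ) (2 * w * ρ) 0 := by
    simpa using (((hasDerivAt_id (0 : ℝ)).const_mul 2).mul_const w).mul_const ρ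
  have h := (((h2.neg.exp).add ((h2.exp.sub h2.neg.exp).const_mul δ)).div_const 2).add
    (((h2w.exp).mul (((h4.mul_const η).const_add 1).add
      ((((h4.div_const t₁).pow 2).const_mul 8).mul_const M))).div_const 2)
  refine h.congr_deriv ?_
  simp
  ring

/-- Both sides equal 1 at λ = 0, so it suffices to compare derivatives there. The constants t₁ and M
only influence how small λ has to be. -/
theorem exists_contraction_le {w ρ δ η t₁ M ζ : ℝ} (ht₁ : 0 < t₁)
    (h : 2 * δ + w * ρ + 2 * w * η < ζ / 2) :
    ∃ lam > 0, 4 * lam * w ≤ t₁ / 2 ∧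
      contraction w ρ δ η t₁ M lam ≤ Real.exp (-(lam * (1 - ζ / 2))) := by
  have hlin : HasDerivAt (fun x : ℝ => x * (1 - ζ / 2)) (1 - ζ / 2) 0 := by
    simpa using (hasDerivAt_id (0 : ℝ)).mul_const (1 - ζ / 2)
  have hd := (hasDerivAt_contraction_zero w ρ δ η t₁ M).sub hlin.neg.exp
  have hneg : -1 + 2 * δ + w * ρ + 2 * w * η -
      Real.exp (-(0 * (1 - ζ / 2))) * -(1 - ζ / 2) < 0 := by
    simp; linarith
  have hs := hd.tendsto_slope_zero_right
  have hev := hs.eventually (gt_mem_nhds hneg)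
  have hsmall : ∀ᶠ x : ℝ in nhdsWithin 0 (Set.Ioi 0), 4 * x * w ≤ t₁ / 2 := by
    have hc : Filter.Tendsto (fun x : ℝ => 4 * x * w) (nhdsWithin 0 (Set.Ioi 0)) (nhds (4 * 0 * w)) :=
      (Continuous.tendsto (by fun_prop) 0).mono_left nhdsWithin_le_nhds
    have : 4 * 0 * w < t₁ / 2 := by simp; positivity
    exact (hc.eventually (gt_mem_nhds this)).mono fun x hx => hx.le
  obtain ⟨x, ⟨hx1, hx2⟩, hx3⟩ := ((hev.and hsmall).and self_mem_nhdsWithin).exists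
  have hx0 : (0 : ℝ) < x := hx3
  refine ⟨x, hx0, hx2, ?_⟩
  have hone : contraction w ρ δ η t₁ M 0 = 1 := by
    simp [contraction]; norm_num
  simp only [zero_add, Pi.sub_apply, Pi.neg_apply, hone, zero_mul, neg_zero, Real.exp_zero, sub_self, sub_zero,
    smul_eq_mul] at hx1
  have : contraction w ρ δ η t₁ M x - Real.exp (-(x * (1 - ζ / 2))) < 0 := by
    by_contra hcon
    have := mul_nonneg (inv_pos.2 hx0).le (not_lt.1 hcon)
    linarith
  linarith

/-- The bound (1 − θ)/(L/2 + κ/2) strictly exceeds αbar. If it also exceeds α₀, take αs = α₀ and ζ =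
1; otherwise take it as αs, and ζ is the share of log(α₀/αbar) gained. -/
theorem exists_threshold {L : NNReal} {θ κ αbar α₀ : ℝ} (hκ : 0 < κ) (hθ : θ < 1)
    (hαbar : 0 < αbar) (hle : αbar ≤ (1 - θ) / (L / 2 + κ)) (hα₀ : αbar ≤ α₀) :
    ∃ αs ζ : ℝ, αbar ≤ αs ∧ αs ≤ α₀ ∧ (L / 2 + κ / 2) * αs ≤ 1 - θ ∧ 0 < ζ ∧ ζ ≤ 1 ∧
      Real.log (α₀ / αs) ≤ (1 - ζ) * Real.log (α₀ / αbar) := by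
  have hL : (0 : ℝ) ≤ L := L.2
  set X := (1 - θ) / (L / 2 + κ / 2) with hX
  have hXgt : αbar < X := by
    refine hle.trans_lt ?_
    apply div_lt_div_of_pos_left (by linarith) (by positivity) (by linarith)
  have hXmul : (L / 2 + κ / 2) * X = 1 - θ := mul_div_cancel₀ _ (by positivity)
  rcases le_or_gt α₀ X with h | h
  · refine ⟨α₀, 1, hα₀, le_rfl, ?_, one_pos, le_rfl, ?_⟩
    · rw [← hXmul]; gcongr
    · rw [div_self (hαbar.trans_le hα₀).ne']; simp
  · have h1 : 0 < Real.log (X / αbar) := Real.log_pos ((one_lt_div hαbar).2 hXgt)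
    have hXpos : 0 < X := hαbar.trans hXgt
    have h2 : Real.log (α₀ / αbar) = Real.log (α₀ / X) + Real.log (X / αbar) := by
      rw [← Real.log_mul (div_pos (hXpos.trans h) hXpos).ne' (div_pos hXpos hαbar).ne']
      congr 1
      field_simp
    have h3 : 0 < Real.log (α₀ / X) := Real.log_pos ((one_lt_div hXpos).2 h)
    have h4 : 0 < Real.log (α₀ / αbar) := by linarith
    refine ⟨X, Real.log (X / αbar) / Real.log (α₀ / αbar), hXgt.le, h.le, hXmul.le,
      div_pos h1 h4, (div_le_one h4).2 (by linarith), ?_⟩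
    rw [sub_mul, div_mul_cancel₀ _ h4.ne']
    linarith

theorem one_sub_le_real_of_compl {Ω : Type v} [MeasurableSpace Ω] {P : Measure Ω}
    [IsProbabilityMeasure P] {S : Set Ω} {x : ℝ} (hx : 0 ≤ x) (h : P Sᶜ ≤ ENNReal.ofReal x) :
    1 - x ≤ P.real S := by
  have h1 : 1 ≤ P.real S + P.real Sᶜ := by
    have := measureReal_union_le (μ := P) S Sᶜ
    rwa [Set.union_compl_self, probReal_univ] at this
  have h2 : P.real Sᶜ ≤ x := ENNReal.toReal_le_of_le_ofReal hx h
  linarith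

/-! ### Stopping before time n with a controlled step size -/

namespace SASS

variable {m : ℕ} {D : Type u} [MeasurableSpace D] {Ω : Type v} [MeasurableSpace Ω]
  {P : Measure Ω} [IsProbabilityMeasure P] {𝒟 : Measure D} {ξ : ℕ × OracleCall × ℕ → Ω → D}
  {A : SASS m D} {φ : EuclideanSpace ℝ (Fin m) → ℝ}

/-- The initial value is at most wB₀ℓ + (1 − ζ)Λ + 1 ≤ (1 − 3ζ/4)n, and each iteration gains 1 −
ζ/2; the difference ζ/4 per iteration is the exponential rate. -/
theorem measure_alive_le_exp (hξ : IsIIDSampling P 𝒟 ξ)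
    (hA : A.MeasurableData) {L : NNReal} {κ τ αs αbar b₁ ρ c t c₅ w δ η t₁ M lam ζ B₀ ℓ₀ ℓ : ℝ}
    {G : Set (EuclideanSpace ℝ (Fin m))} {Φ : EuclideanSpace ℝ (Fin m) → ℝ}
    (hf : Differentiable ℝ φ) (hL : LipschitzWith L (gradient φ))
    (hc : IsAccuracyLevel L A.θ κ τ αs b₁ ρ c) (hΦ : IsPotential φ G Φ b₁ c₅ t)
    (hO : A.OracleBounds P ξ φ κ τ ρ c t δ η t₁ M)
    (ht : 0 < t) (hr : A.r = ρ * t) (hγ : A.γ ∈ Set.Ioo (0 : ℝ) 1)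
    (hmax : (αs : WithTop ℝ) ≤ A.αmax) (hw0 : 0 ≤ w)
    (hw : 2 ≤ w * (c₅ * (A.θ * A.γ ^ 2 * αs / 4))) (hδ : 0 ≤ δ) (hη : 0 ≤ η) (hM : 0 ≤ M)
    (hlam : 0 ≤ lam) (hlt : 4 * lam * w ≤ t₁ / 2)
    (hcon : contraction w ρ δ η t₁ M lam ≤ Real.exp (-(lam * (1 - ζ / 2))))
    (hαs : αs ≤ A.α₀) (hαbar : 0 < αbar) (hαbar₀ : αbar ≤ A.α₀) (hζ : 0 < ζ) (hζ1 : ζ ≤ 1)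
    (hlog : Real.log (A.α₀ / αs) ≤ (1 - ζ) * Real.log (A.α₀ / αbar))
    (hΦ₀ : A.x₀ ∉ G → Φ A.x₀ ≤ B₀ * ℓ) (hB₀ : 0 ≤ B₀) (hℓ₀ : 0 < ℓ₀) (hℓ : ℓ₀ ≤ ℓ) {n : ℕ}
    (hn : 4 * (w * B₀ + 1 / ℓ₀) * ℓ + Real.logb (1 / A.γ) (A.α₀ / αbar) ≤ n) :
    P (A.alive ξ G n) ≤ ENNReal.ofReal (Real.exp (-(lam * ζ / 4) * n)) := by
  by_cases hx₀ : A.x₀ ∈ G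
  · have : A.alive ξ G n = ∅ := by
      ext ω
      simp only [Set.mem_empty_iff_false, iff_false]
      exact fun h => h 0 (Nat.zero_le _) hx₀
    rw [this, measure_empty]
    exact zero_le
  have hα₀ : 0 < A.α₀ := hc.αs_pos.trans_le hαs
  refine (measure_alive_le hξ hA hf hL hc hΦ hO ht hr hγ hmax hw0 hw hδ hη hM hlam hlt hα₀
    n).trans ?_
  have hb : 1 < 1 / A.γ := by rw [one_div]; exact (one_lt_inv₀ hγ.1).2 hγ.2
  have hlb : 0 < Real.log (1 / A.γ) := Real.log_pos hb
  set d := Real.logb (1 / A.γ) (A.α₀ / αbar) with hd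
  have hd0 : 0 ≤ d := Real.logb_nonneg hb ((one_le_div hαbar).2 hαbar₀)
  have hu : Real.logb (1 / A.γ) (A.α₀ / αs) ≤ (1 - ζ) * d := by
    rw [hd, Real.logb, Real.logb, ← mul_div_assoc]
    gcongr
  have hu0 : 0 ≤ Real.logb (1 / A.γ) (A.α₀ / αs) :=
    Real.logb_nonneg hb ((one_le_div hc.αs_pos).2 hαs)
  have hH : A.lyapunov Φ w αs (A.x₀, A.α₀) ≤ (1 - 3 * ζ / 4) * n := by
    unfold lyapunov
    simp only
    rw [abs_of_nonneg (by linarith)]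
    have h1 := mul_le_mul_of_nonneg_left (hΦ₀ hx₀) hw0
    have h2 : 1 ≤ 1 / ℓ₀ * ℓ := by
      rw [one_div, ← div_eq_inv_mul]; exact (one_le_div hℓ₀).2 hℓ
    have h3 : (1 - 3 * ζ / 4) * (4 * (w * B₀ + 1 / ℓ₀) * ℓ + d) ≤ (1 - 3 * ζ / 4) * n :=
      mul_le_mul_of_nonneg_left hn (by linarith)
    have h4 : 0 ≤ w * B₀ * ℓ := mul_nonneg (mul_nonneg hw0 hB₀) (hℓ₀.le.trans hℓ)
    -- As ζ ≤ 1, the factor 1 − 3ζ/4 is at least 1/4: this is why the condition on n carries a 4.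
    have h5 : (1 : ℝ) / 4 * (4 * (w * B₀ * ℓ + 1 / ℓ₀ * ℓ)) ≤
        (1 - 3 * ζ / 4) * (4 * (w * B₀ * ℓ + 1 / ℓ₀ * ℓ)) := by
      refine mul_le_mul_of_nonneg_right (by linarith) (by linarith)
    have h6 : (1 - ζ) * d ≤ (1 - 3 * ζ / 4) * d := mul_le_mul_of_nonneg_right (by linarith) hd0
    nlinarith
  calc _ ≤ ENNReal.ofReal (Real.exp (-(lam * (1 - ζ / 2)))) ^ n *
        ENNReal.ofReal (Real.exp (lam * ((1 - 3 * ζ / 4) * n))) := by gcongr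
    _ = _ := by
      rw [← ENNReal.ofReal_pow (Real.exp_pos _).le, ← ENNReal.ofReal_mul (by positivity),
        ← Real.exp_nat_mul, ← Real.exp_add]
      congr 2
      ring

end SASS

/-- The stopping time is at most `n` and the step size stays above `αbar n^{-a}`, up to
exponentially and polynomially small probabilities. -/
theorem SASS.reach_and_stepSize_prob {m : ℕ} {D : Type u} {Ω : Type v}
    [MeasurableSpace Ω] {P : Measure Ω} [IsProbabilityMeasure P]
    {ξ : ℕ × OracleCall × ℕ → Ω → D} {A : SASS m D}
    {G : Set (EuclideanSpace ℝ (Fin m))} {αbar a lam' C ϖ : ℝ} {n : ℕ} (hC : 0 ≤ C)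
    (h1 : P (A.alive ξ G n) ≤ ENNReal.ofReal (Real.exp (-lam' * n)))
    (h2 : P {ω | ∃ k < n, A.stepSize ξ k ω < αbar * (n : ℝ) ^ (-a)} ≤
      ENNReal.ofReal (C * (n : ℝ) ^ (-ϖ))) :
    1 - 2 * Real.exp (-lam' * n) - C * (n : ℝ) ^ (-ϖ) ≤
      P.real {ω | (∃ j ≤ n, A.iterate ξ j ω ∈ G) ∧
        ∀ k < n, αbar * (n : ℝ) ^ (-a) ≤ A.stepSize ξ k ω} := by
  have hr : 0 ≤ C * (n : ℝ) ^ (-ϖ) := mul_nonneg hC (Real.rpow_nonneg (Nat.cast_nonneg _) _)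
  have he := Real.exp_pos (-lam' * n)
  refine le_trans ?_ (one_sub_le_real_of_compl (add_nonneg he.le hr) ?_)
  · linarith
  · have hsub : {ω | (∃ j ≤ n, A.iterate ξ j ω ∈ G) ∧
        ∀ k < n, αbar * (n : ℝ) ^ (-a) ≤ A.stepSize ξ k ω}ᶜ ⊆
        A.alive ξ G n ∪ {ω | ∃ k < n, A.stepSize ξ k ω < αbar * (n : ℝ) ^ (-a)} := by
      intro ω hω
      by_contra hcon
      simp only [Set.mem_union, Set.mem_ofPred_eq, not_or, not_exists, not_and, not_lt, SASS.alive,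
        not_forall, not_not] at hcon
      obtain ⟨⟨j, hj, hjG⟩, hk⟩ := hcon
      exact hω ⟨⟨j, hj, hjG⟩, hk⟩
    refine (measure_mono hsub).trans ((measure_union_le _ _).trans ?_)
    rw [ENNReal.ofReal_add he.le hr]
    exact add_le_add h1 h2

theorem exists_accuracy_constant {κ τ b₁ ρ : ℝ} (hκ : 0 < κ) (hτ : 0 < τ) (hb₁ : 0 < b₁)
    (hρ : 0 < ρ) :
    ∃ c > 0, c * τ ≤ 1 / 2 ∧ c ≤ ρ / 2 ∧ c * (1 + 2 * κ) ≤ κ / 2 ∧ c * (1 / b₁ + τ) ≤ 1 / 2 := by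
  have key : ∀ x y : ℝ, 0 < x → 0 < y → ∀ᶠ c : ℝ in nhdsWithin 0 (Set.Ioi 0), c * x ≤ y := by
    intro x y hx hy
    have hc : Filter.Tendsto (fun c : ℝ => c * x) (nhdsWithin 0 (Set.Ioi 0)) (nhds (0 * x)) :=
      (Continuous.tendsto (by fun_prop) 0).mono_left nhdsWithin_le_nhds
    rw [zero_mul] at hc
    exact (hc.eventually (gt_mem_nhds hy)).mono fun c hc => hc.le
  obtain ⟨c, ⟨⟨⟨h1, h2⟩, h3⟩, h4⟩, h5⟩ := (((((key τ (1 / 2) hτ (by norm_num)).and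
    (key 1 (ρ / 2) one_pos (by linarith))).and
    (key (1 + 2 * κ) (κ / 2) (by linarith) (by linarith))).and
    (key (1 / b₁ + τ) (1 / 2) (by positivity) (by norm_num))).and self_mem_nhdsWithin).exists
  exact ⟨c, h5, h1, by linarith, h3, h4⟩

theorem exists_batch_constant {c ρ δ η : ℝ} (hc : 0 < c) (hρ : 0 < ρ) (hδ : 0 < δ) (hη : 0 < η) :
    ∃ amin > (0 : ℝ), ∀ a₀ ≥ amin, ∀ a₁ ≥ amin, 1 / a₀ ≤ η ^ 2 ∧
      1 / (a₁ * c ^ 2) + 32 * (1 / a₀) / ρ ^ 2 ≤ δ := by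
  refine ⟨1 / η ^ 2 + 2 / (c ^ 2 * δ) + 64 / (ρ ^ 2 * δ), by positivity, fun a₀ h₀ a₁ h₁ => ?_⟩
  have e1 : 0 < 1 / η ^ 2 := by positivity
  have e2 : 0 < 2 / (c ^ 2 * δ) := by positivity
  have e3 : 0 < 64 / (ρ ^ 2 * δ) := by positivity
  have hp₀ : 0 < a₀ := by linarith
  have hp₁ : 0 < a₁ := by linarith
  have f1 : 1 / η ^ 2 ≤ a₀ := by linarith
  have f2 : 2 / (c ^ 2 * δ) ≤ a₁ := by linarith
  have f3 : 64 / (ρ ^ 2 * δ) ≤ a₀ := by linarith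
  rw [div_le_iff₀ (by positivity)] at f1 f2 f3
  refine ⟨by rw [div_le_iff₀ hp₀]; linarith, ?_⟩
  have g1 : 1 / (a₁ * c ^ 2) ≤ δ / 2 := by
    rw [div_le_iff₀ (by positivity)]; linarith
  have g2 : 32 * (1 / a₀) / ρ ^ 2 ≤ δ / 2 := by
    rw [mul_one_div, div_div, div_le_iff₀ (by positivity)]; linarith
  linarith

theorem inv_rpow_log_div_log {γ R : ℝ} (hγ : γ ∈ Set.Ioo (0 : ℝ) 1) (hR : 0 < R) (y : ℝ) :
    γ⁻¹ ^ (y * Real.log R / Real.log (1 / γ)) = R ^ y := by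
  have h1 : 1 < γ⁻¹ := (one_lt_inv₀ hγ.1).2 hγ.2
  have hl : Real.log γ⁻¹ ≠ 0 := (Real.log_pos h1).ne'
  rw [one_div, Real.rpow_def_of_pos (by linarith), Real.rpow_def_of_pos hR]
  rw [mul_div_assoc', mul_comm, mul_div_assoc, div_self hl, mul_one, mul_comm]

theorem logb_two_mul_eq {γ q : ℝ} :
    Real.logb (2 * q) γ = Real.log (1 / γ) / Real.log (1 / (2 * q)) := by
  rw [Real.logb, one_div, one_div, Real.log_inv, Real.log_inv, neg_div_neg_eq]

/-- What matters is the order of choices: w, δ, η and ρ come from the fixed constants, then c and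
the batch constants, then C₁, and only afterwards t₁, M, λ, which see σf, ν and b. -/
theorem SASS.exists_reach_and_stepSize
    (L : NNReal) (θ κ τ αbar α₀ p ϖ γ₀ b₁ c₅ B₀ ℓ₀ tmax : ℝ)
    (hθ : θ ∈ Set.Ioo (0 : ℝ) 1) (hκ : 0 < κ)
    (hαbar : 0 < αbar) (hαbar_le : αbar ≤ (1 - θ) / (L / 2 + κ)) (hτ : κ * αbar ≤ τ)
    (hα₀ : αbar ≤ α₀) (hp : p ∈ Set.Ioo (1 / 2 : ℝ) 1) (hϖ : 0 < ϖ) (hγ₀ : 0 < γ₀)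
    (hb₁ : 0 < b₁) (hc₅ : 0 < c₅) (hB₀ : 0 ≤ B₀) (hℓ₀ : 0 < ℓ₀) (htmax : 0 < tmax) :
    ∃ ρmax > (0 : ℝ), ∀ ρ ∈ Set.Ioc (0 : ℝ) ρmax,
    ∃ amin > (0 : ℝ), ∀ a₀ ≥ amin, ∀ a₁ ≥ amin, ∃ C₁ > (0 : ℝ),
    ∀ σf ν b : ℝ, 0 ≤ σf → ∃ C₃ > (0 : ℝ), ∃ C₄ : ℝ,
    ∀ (m : ℕ) (D : Type u) [MeasurableSpace D] (𝒟 : Measure D)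
      (l : EuclideanSpace ℝ (Fin m) → D → ℝ) (Mc Mv : ℝ), 0 ≤ Mc → 0 ≤ Mv →
      ERMAssumptions 𝒟 l L σf ν b Mc Mv →
    ∀ (x₀ : EuclideanSpace ℝ (Fin m)) (Ω : Type v) [MeasurableSpace Ω] (P : Measure Ω)
      [IsProbabilityMeasure P] (ξ : ℕ × OracleCall × ℕ → Ω → D), IsIIDSampling P 𝒟 ξ →
    ∀ (αmax : WithTop ℝ), (α₀ : WithTop ℝ) ≤ αmax →
    ∀ γ ∈ Set.Ico γ₀ 1, ∀ t ∈ Set.Ioc 0 tmax,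
    ∀ (G : Set (EuclideanSpace ℝ (Fin m))) (Φ : EuclideanSpace ℝ (Fin m) → ℝ) (ℓ : ℝ),
      IsPotential (expectedRisk 𝒟 l) G Φ b₁ c₅ t → (x₀ ∉ G → Φ x₀ ≤ B₀ * ℓ) → ℓ₀ ≤ ℓ →
      let A := SASS.forERM l θ γ αmax x₀ α₀ κ τ σf Mc Mv ρ a₀ a₁ t
      (∀ k x, ∀ α ∈ Set.Ioc 0 αbar, p ≤ P.real {o | A.Successful (SASS.samples ξ k o) x α}) ∧
      ∀ n : ℕ, C₁ * ℓ + Real.logb (1 / γ) (α₀ / αbar) ≤ n →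
        1 - 2 * Real.exp (-C₃ * n) - C₄ * (n : ℝ) ^ (-ϖ) ≤
          P.real {o | (∃ j ≤ n, A.iterate ξ j o ∈ G) ∧ ∀ k < n,
            αbar * (n : ℝ) ^ (-((1 + ϖ) * Real.logb (2 * (1 - p)) γ)) ≤ A.stepSize ξ k o} := by
  obtain ⟨αs, ζ, hαs1, hαs2, hαs3, hζ, hζ1, hlog⟩ :=
    exists_threshold hκ hθ.2 hαbar hαbar_le hα₀
  have hαs : 0 < αs := hαbar.trans_le hαs1
  have hτ0 : 0 < τ := lt_of_lt_of_le (by positivity) hτ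
  have hθ0 := hθ.1
  obtain ⟨hp1, hp2⟩ := hp
  set R := 1 / (2 * (1 - p)) with hR
  have hR1 : 1 < R := by
    rw [hR, one_div]; exact (one_lt_inv₀ (by linarith)).2 (by linarith)
  have hR2 : 1 < R ^ 2 := by nlinarith
  -- Makes w c₅ θ γ₀² αbar/4 equal to 2; γ ≥ γ₀ and αs ≥ αbar only help.
  set w := 8 / (c₅ * θ * γ₀ ^ 2 * αbar) with hw
  have hw0 : 0 < w := by positivity
  -- The three bounds serve the drift, the success probability p, and the inequality 1/R² + R²δ ≤ 1
  -- of the step size potential.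
  set δ := min (ζ / 32) (min (1 - p) ((1 - 1 / R ^ 2) / R ^ 2)) with hδdef
  have hR3 : 1 / R ^ 2 < 1 := by rw [div_lt_one (by positivity)]; exact hR2
  have hδ : 0 < δ := lt_min (by positivity) (lt_min (by linarith)
    (div_pos (by linarith) (by positivity)))
  have hδ1 : δ ≤ ζ / 32 := min_le_left _ _
  have hδ2 : δ ≤ 1 - p := (min_le_right _ _).trans (min_le_left _ _)
  have hδ3 : δ ≤ (1 - 1 / R ^ 2) / R ^ 2 := (min_le_right _ _).trans (min_le_right _ _)
  set η := ζ / (32 * w) with hηdef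
  have hη : 0 < η := by positivity
  refine ⟨ζ / (16 * w), by positivity, fun ρ hρ => ?_⟩
  obtain ⟨hρ0, hρ1⟩ := hρ
  obtain ⟨c, hc0, hcτ, hcρ, hcκ, hcb⟩ := exists_accuracy_constant hκ hτ0 hb₁ hρ0
  obtain ⟨amin, hamin, hbatch⟩ := exists_batch_constant hc0 hρ0 hδ hη
  refine ⟨amin, hamin, fun a₀ ha₀ a₁ ha₁ => ?_⟩
  obtain ⟨hbη, hbδ⟩ := hbatch a₀ ha₀ a₁ ha₁
  have ha₀0 : 0 < a₀ := hamin.trans_le ha₀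
  have ha₁0 : 0 < a₁ := hamin.trans_le ha₁
  refine ⟨4 * (w * B₀ + 1 / ℓ₀), by positivity, fun σf ν b hσ => ?_⟩
  -- For b ≤ 0 the assumptions are contradictory, and any constants do.
  by_cases hb : 0 < b
  swap
  · refine ⟨1, one_pos, 0, ?_⟩
    intro m D _ 𝒟 l Mc Mv _ _ h x₀
    exact absurd (h.subexponential x₀).1 hb
  obtain ⟨t₁, ht₁, M, hM, hexp⟩ := exists_lintegral_exp_value_le.{u, v} (ν := ν) hσ ha₀0 hb htmax
  obtain ⟨lam, hlam, hlt, hcon⟩ := exists_contraction_le (w := w) (ρ := ρ) (δ := δ) (η := η)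
    (t₁ := t₁) (M := M) (ζ := ζ) ht₁ (by
      have h1 : w * ρ ≤ ζ / 16 := by
        rw [le_div_iff₀ (by positivity)] at hρ1; linarith
      have h2 : w * η = ζ / 32 := by rw [hηdef]; field_simp
      nlinarith)
  refine ⟨lam * ζ / 4, by positivity, 1 + R ^ 2, ?_⟩
  intro m D _ 𝒟 l Mc Mv hMc hMv h x₀ Ω _ P _ ξ hξ αmax hmax γ hγ t ht G Φ ℓ hΦ hΦ₀ hℓ A
  have hγ0 : 0 < γ := hγ₀.trans_le hγ.1
  have hγ' : γ ∈ Set.Ioo (0 : ℝ) 1 := ⟨hγ0, hγ.2⟩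
  have hφd := h.differentiable_risk
  have hφL := h.lipschitz_gradient
  have hA : A.MeasurableData := measurableData_forERM h _ _ _ _ _ _ _ _ _ _ _
  have hm : ∀ k j i, Measurable (fun ω => samples ξ k ω j i) := fun k j i => hξ.measurable _
  have hl : ∀ k j i, P.map (fun ω => samples ξ k ω j i) = 𝒟 := fun k j i => hξ.law _
  have hind := hξ.indep_stream
  have hO : A.OracleBounds P ξ (expectedRisk 𝒟 l) κ τ ρ c t δ η t₁ M := by
    refine oracleBounds_of_stream hA hξ hφd.continuous.measurable hρ0 ht.1 hη ht₁ hM.le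
      (V := 1 / a₀) (δ₁ := 1 / (a₁ * c ^ 2)) (by positivity) (by positivity) hbη hbδ ?_ ?_ ?_
    · intro k x α hα
      exact h.measure_gradient_inaccurate_le hMc hMv (hm k .grad) (hl k .grad) (hind k .grad) ha₁0
        ht.1 (lt_min hτ0 (mul_pos hκ hα)) hc0 x
    · intro k j x
      exact h.lintegral_sq_value_le (hm k j) (hl k j) (hind k j) ha₀0 ht.1 x
    · intro k j x
      exact hexp h (hm k j) (hl k j) (hind k j) t ht x
  have hc : IsAccuracyLevel L A.θ κ τ αs b₁ ρ c :=
    ⟨hθ0, hκ, hτ0, hαs, hαs3, hb₁, hc0, hcτ, hcρ, hcκ, hcb⟩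
  have hfail : ∀ k x α, 0 < α → α ≤ αbar →
      P {ω | ¬ A.Successful (samples ξ k ω) x α} ≤ ENNReal.ofReal δ := fun k x α h0 h1 =>
    hO.not_successful_le hφd hφL hc ht.1 rfl k x h0 (h1.trans hαs1)
  refine ⟨fun k x α hα => ?_, fun n hn => ?_⟩
  · have h1 := one_sub_le_real_of_compl (P := P)
      (S := {o | A.Successful (SASS.samples ξ k o) x α}) hδ.le (hfail k x α hα.1 hα.2)
    linarith
  · have hbγ : 1 < 1 / γ := by rw [one_div]; exact (one_lt_inv₀ hγ0).2 hγ.2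
    have hlγ : 0 < Real.log (1 / γ) := Real.log_pos hbγ
    have hlR : 0 < Real.log R := Real.log_pos hR1
    have hd0 : 0 ≤ Real.logb (1 / γ) (α₀ / αbar) :=
      Real.logb_nonneg hbγ ((one_le_div hαbar).2 hα₀)
    have hn0 : 0 < n := by
      have : (0 : ℝ) < n := by
        refine lt_of_lt_of_le ?_ hn
        have : 0 < 4 * (w * B₀ + 1 / ℓ₀) * ℓ := by
          have := hℓ₀.trans_le hℓ
          positivity
        linarith
      exact_mod_cast this
    have hmaxs : (αs : WithTop ℝ) ≤ A.αmax := le_trans (WithTop.coe_le_coe.2 hαs2) hmax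
    have hmaxb : (αbar : WithTop ℝ) ≤ A.αmax := le_trans (WithTop.coe_le_coe.2 hα₀) hmax
    have hww : 2 ≤ w * (c₅ * (A.θ * A.γ ^ 2 * αs / 4)) := by
      have h1 : 2 = w * (c₅ * (θ * γ₀ ^ 2 * αbar / 4)) := by
        rw [hw]; field_simp; norm_num
      rw [h1]
      change _ ≤ w * (c₅ * (θ * γ ^ 2 * αs / 4))
      have := hγ.1
      gcongr
    have hal : P (A.alive ξ G n) ≤ ENNReal.ofReal (Real.exp (-(lam * ζ / 4) * n)) :=
      measure_alive_le_exp hξ hA hφd hφL hc hΦ hO ht.1 rfl hγ' hmaxs hw0.le hww hδ.le hη.le hM.le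
        hlam.le hlt hcon hαs2 hαbar hα₀ hζ hζ1 hlog hΦ₀ hB₀ hℓ₀ hℓ hn
    -- The exponent e is chosen so that γ^{−e} = R² for every γ. Squaring R = 1/(2q) gives ae = 2(1
    -- + ϖ) ≥ 2 + ϖ for the prescribed a; the price is a δ possibly well below q.
    have hRe : A.γ⁻¹ ^ (2 * Real.log R / Real.log (1 / γ)) = R ^ 2 := by
      have := inv_rpow_log_div_log hγ' (by positivity : 0 < R) 2
      rw [Real.rpow_two] at this
      exact this
    have hstep := measure_exists_stepSize_lt_le hξ hA (αb := αbar)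
      (e := 2 * Real.log R / Real.log (1 / γ)) (δ := δ)
      (a := (1 + ϖ) * Real.logb (2 * (1 - p)) γ) (ϖ := ϖ) hγ' hαbar hmaxb hα₀ (by positivity)
      hδ.le (by
        rw [hRe]
        have := mul_le_mul_of_nonneg_left hδ3 (by positivity : 0 ≤ R ^ 2)
        rw [mul_div_cancel₀ _ (by positivity : R ^ 2 ≠ 0)] at this
        linarith) hfail (by
        rw [logb_two_mul_eq, ← hR]
        have : (1 + ϖ) * (Real.log (1 / γ) / Real.log R) * (2 * Real.log R / Real.log (1 / γ)) =
            2 * (1 + ϖ) := by field_simp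
        rw [this]; linarith) hn0
    rw [hRe] at hstep
    exact SASS.reach_and_stepSize_prob (by positivity) hal hstep

/-! ### Sample complexity -/

theorem natCast_max_one_ceil_le {x : ℝ} (hx : 0 ≤ x) : ((max 1 ⌈x⌉₊ : ℕ) : ℝ) ≤ 1 + x := by
  rw [Nat.cast_max, Nat.cast_one]
  exact max_le (by linarith) (by linarith [Nat.ceil_lt_add_one hx])

/-- Since καbar ≤ τ and n^{−a} ≤ 1, the floor on the step size gives min τ (κα) ≥ καbar n^{−a}. The
parameter Q stands for whichever bound on n^{2a} is in force. -/
theorem SASS.TOC_forERM_le {m : ℕ} {D : Type u} {Ω : Type v}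
    {l : EuclideanSpace ℝ (Fin m) → D → ℝ} {θ γ : ℝ} {αmax : WithTop ℝ}
    {x₀ : EuclideanSpace ℝ (Fin m)} {α₀ κ τ σf Mc Mv ρ a₀ a₁ t : ℝ}
    {ξ : ℕ × OracleCall × ℕ → Ω → D} {o : Ω} {αbar a Q CQ : ℝ} {n T : ℕ}
    (hκ : 0 < κ) (hαbar : 0 < αbar) (hτ : κ * αbar ≤ τ) (hMc : 0 ≤ Mc) (hMv : 0 ≤ Mv)
    (ha₀ : 0 < a₀) (ha₁ : 0 < a₁) (ht : 0 < t) (ha : 0 ≤ a) (hn : 1 ≤ n) (hT : T ≤ n)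
    (hQ : ((n : ℝ) ^ a) ^ 2 ≤ CQ * Q) (hCQ : 0 ≤ CQ)
    (hstep : ∀ k < n, αbar * (n : ℝ) ^ (-a) ≤
      (forERM l θ γ αmax x₀ α₀ κ τ σf Mc Mv ρ a₀ a₁ t).stepSize ξ k o) :
    ((forERM l θ γ αmax x₀ α₀ κ τ σf Mc Mv ρ a₀ a₁ t).TOC ξ T o : ℝ) ≤
      n * ((3 + 2 * a₀ + a₁ * (1 + CQ / (κ * αbar) ^ 2)) *
        max 1 (σf ^ 2 / t ^ 2 + Mc / t + Mv * Q)) := by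
  have hn1 : (1 : ℝ) ≤ n := by exact_mod_cast hn
  have hX : 0 < (n : ℝ) ^ a := Real.rpow_pos_of_pos (by linarith) _
  set S := σf ^ 2 / t ^ 2 with hS
  have hS0 : 0 ≤ S := by positivity
  have hMct : 0 ≤ Mc / t := by positivity
  set X := (n : ℝ) ^ a with hXdef
  have hMX : Mv * X ^ 2 ≤ CQ * (Mv * Q) := by
    calc Mv * X ^ 2 ≤ Mv * (CQ * Q) := by gcongr
      _ = _ := by ring
  have hterm : ∀ k < n, ((2 * max 1 ⌈a₀ * S⌉₊ + max 1 ⌈a₁ * (Mc / t + Mv /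
      (min τ (κ * (forERM l θ γ αmax x₀ α₀ κ τ σf Mc Mv ρ a₀ a₁ t).stepSize ξ k o)) ^ 2)⌉₊ : ℕ) : ℝ)
      ≤ (3 + 2 * a₀ + a₁ * (1 + CQ / (κ * αbar) ^ 2)) * max 1 (S + Mc / t + Mv * Q) := by
    intro k hk
    set q := min τ (κ * (forERM l θ γ αmax x₀ α₀ κ τ σf Mc Mv ρ a₀ a₁ t).stepSize ξ k o) with hq
    have hXinv : (n : ℝ) ^ (-a) = X⁻¹ := Real.rpow_neg (by linarith) a
    have hX1 : 1 ≤ X := Real.one_le_rpow hn1 ha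
    have hXi1 : X⁻¹ ≤ 1 := inv_le_one_of_one_le₀ hX1
    have hqle : κ * αbar * X⁻¹ ≤ q := by
      refine le_min ?_ ?_
      · have : κ * αbar * X⁻¹ ≤ κ * αbar * 1 := by gcongr
        linarith
      · have := hstep k hk
        rw [hXinv] at this
        calc κ * αbar * X⁻¹ = κ * (αbar * X⁻¹) := by ring
          _ ≤ _ := by gcongr
    have hq2 : Mv / q ^ 2 ≤ CQ / (κ * αbar) ^ 2 * (Mv * Q) := by
      have h1 : Mv / q ^ 2 ≤ Mv / (κ * αbar * X⁻¹) ^ 2 := by gcongr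
      have h2 : Mv / (κ * αbar * X⁻¹) ^ 2 = Mv * X ^ 2 / (κ * αbar) ^ 2 := by field_simp
      rw [h2] at h1
      refine h1.trans ?_
      rw [div_mul_eq_mul_div]
      gcongr
    have hq0 : 0 ≤ Mv / q ^ 2 := by positivity
    push_cast [-Nat.cast_max]
    have e1 := natCast_max_one_ceil_le (show 0 ≤ a₀ * S by positivity)
    have e2 := natCast_max_one_ceil_le (show 0 ≤ a₁ * (Mc / t + Mv / q ^ 2) by positivity)
    have hMvQ : 0 ≤ CQ / (κ * αbar) ^ 2 * (Mv * Q) := hq0.trans hq2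
    set W := max 1 (S + Mc / t + Mv * Q) with hW
    have hW1 : 1 ≤ W := le_max_left _ _
    have hWS : S + Mc / t + Mv * Q ≤ W := le_max_right _ _
    have hCk : 0 ≤ CQ / (κ * αbar) ^ 2 := by positivity
    -- No sign of Q is assumed; a negative product would force Mv = 0.
    have hMvQ' : 0 ≤ Mv * Q := by
      by_contra hneg
      push Not at hneg
      have h0 : CQ * (Mv * Q) ≤ 0 := mul_nonpos_of_nonneg_of_nonpos hCQ hneg.le
      have h1 : 0 ≤ Mv * X ^ 2 := by positivity
      have hMv0 : Mv = 0 := by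
        have : Mv * X ^ 2 = 0 := le_antisymm (hMX.trans h0) h1
        rcases mul_eq_zero.1 this with h | h
        · exact h
        · exact absurd h (by positivity)
      rw [hMv0, zero_mul] at hneg
      exact lt_irrefl _ hneg
    have f1 : a₀ * S ≤ a₀ * W := by gcongr; linarith
    have f2 : a₁ * (Mc / t + Mv / q ^ 2) ≤ a₁ * ((1 + CQ / (κ * αbar) ^ 2) * W) := by
      gcongr
      have : CQ / (κ * αbar) ^ 2 * (Mv * Q) ≤ CQ / (κ * αbar) ^ 2 * W := by gcongr; linarith
      linarith
    nlinarith
  set B := (3 + 2 * a₀ + a₁ * (1 + CQ / (κ * αbar) ^ 2)) * max 1 (S + Mc / t + Mv * Q) with hB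
  have hB0 : 0 ≤ B := by
    refine mul_nonneg (by positivity) (zero_le_one.trans (le_max_left _ _))
  rw [TOC, Nat.cast_sum]
  calc _ ≤ ∑ k ∈ Finset.range T, B :=
        Finset.sum_le_sum fun k hk => hterm k ((Finset.mem_range.1 hk).trans_le hT)
    _ = T * B := by rw [Finset.sum_const, Finset.card_range, nsmul_eq_mul]
    _ ≤ n * B := by gcongr

/-- The exponent a is proportional to log(1/γ) and d to its inverse, so ad does not depend on γ.
With ℓ + d ≤ ℓ e^{d/ℓ₀}, the contribution of d to n^{2a} is a constant, uniformly as γ tends to 1.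
-/
theorem rpow_sq_le_of_le_mul {αbar α₀ ϖ γ₀ γ R K ℓ₀ ℓ : ℝ} {n : ℕ} (hαbar : 0 < αbar)
    (hα₀ : αbar ≤ α₀) (hϖ : 0 < ϖ) (hγ₀ : 0 < γ₀) (hγ : γ ∈ Set.Ico γ₀ 1) (hR : 1 < R)
    (hK : 1 ≤ K) (hℓ₀ : 0 < ℓ₀) (hℓ : ℓ₀ ≤ ℓ)
    (hn : n ≤ K * (ℓ + Real.logb (1 / γ) (α₀ / αbar))) :
    ((n : ℝ) ^ ((1 + ϖ) * (Real.log (1 / γ) / Real.log R))) ^ 2 ≤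
      K ^ (2 * ((1 + ϖ) * (Real.log (1 / γ₀) / Real.log R))) *
        Real.exp (2 * ((1 + ϖ) * (Real.log (α₀ / αbar) / Real.log R)) / ℓ₀) *
        ℓ ^ (2 * ((1 + ϖ) * (Real.log (1 / γ) / Real.log R))) := by
  have hγ0 : 0 < γ := hγ₀.trans_le hγ.1
  have hb : 1 < 1 / γ := by rw [one_div]; exact (one_lt_inv₀ hγ0).2 hγ.2
  have hlb : 0 < Real.log (1 / γ) := Real.log_pos hb
  have hlR : 0 < Real.log R := Real.log_pos hR
  have hℓp : 0 < ℓ := hℓ₀.trans_le hℓ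
  have hd0 : 0 ≤ Real.logb (1 / γ) (α₀ / αbar) :=
    Real.logb_nonneg hb ((one_le_div hαbar).2 hα₀)
  set d := Real.logb (1 / γ) (α₀ / αbar) with hd
  set a := (1 + ϖ) * (Real.log (1 / γ) / Real.log R) with ha
  have ha0 : 0 ≤ a := by positivity
  have had : a * d = (1 + ϖ) * (Real.log (α₀ / αbar) / Real.log R) := by
    rw [ha, hd, Real.logb]; field_simp
  have hn2 : (n : ℝ) ≤ K * (ℓ * Real.exp (d / ℓ₀)) := by
    refine hn.trans ?_
    gcongr
    have h1 := Real.add_one_le_exp (d / ℓ₀)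
    have h2 : d ≤ ℓ * (d / ℓ₀) := by
      rw [mul_div_assoc', le_div_iff₀ hℓ₀, mul_comm d]; gcongr
    nlinarith
  have hlog : Real.log (1 / γ) ≤ Real.log (1 / γ₀) :=
    Real.log_le_log (by positivity) (one_div_le_one_div_of_le hγ₀ hγ.1)
  calc ((n : ℝ) ^ a) ^ 2 = (n : ℝ) ^ (2 * a) := by
        rw [← Real.rpow_natCast, ← Real.rpow_mul (Nat.cast_nonneg n), mul_comm a]; norm_num
    _ ≤ (K * (ℓ * Real.exp (d / ℓ₀))) ^ (2 * a) :=
        Real.rpow_le_rpow (Nat.cast_nonneg n) hn2 (by positivity)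
    _ = K ^ (2 * a) * Real.exp (2 * (a * d) / ℓ₀) * ℓ ^ (2 * a) := by
        rw [Real.mul_rpow (by positivity) (by positivity),
          Real.mul_rpow (by positivity) (by positivity), ← Real.exp_mul]
        have : d / ℓ₀ * (2 * a) = 2 * (a * d) / ℓ₀ := by ring
        rw [this]; ring
    _ ≤ _ := by
        rw [had]
        have : K ^ (2 * a) ≤ K ^ (2 * ((1 + ϖ) * (Real.log (1 / γ₀) / Real.log R))) := by
          refine Real.rpow_le_rpow_of_exponent_le hK ?_
          rw [ha]; gcongr
        gcongr

/-- Taking logarithms, the lower bound on γ says a log n ≤ −log(2β), that is n^a ≤ 1/(2β). -/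
theorem rpow_sq_le_inv_sq {ϖ γ R β : ℝ} {n : ℕ} (hϖ : 0 < ϖ) (hγ : γ ∈ Set.Ioo (0 : ℝ) 1)
    (hR : 1 < R) (hn : 1 ≤ n) (hβ : β ∈ Set.Ioo (0 : ℝ) (1 / 2))
    (h : R ^ (Real.log (2 * β) / ((1 + ϖ) * Real.log n)) ≤ γ) :
    ((n : ℝ) ^ ((1 + ϖ) * (Real.log (1 / γ) / Real.log R))) ^ 2 ≤ 1 / β ^ 2 := by
  have hβ0 := hβ.1
  have hlR : 0 < Real.log R := Real.log_pos hR
  have hγ0 := hγ.1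
  rcases hn.eq_or_lt with rfl | hn1
  -- For n = 1 the division by log n = 0 yields exponent 0, so the hypothesis reads 1 ≤ γ, which is
  -- absurd.
  · simp only [Nat.cast_one, Real.log_one, mul_zero, div_zero, Real.rpow_zero] at h
    linarith [hγ.2]
  have hn1' : (1 : ℝ) < n := by exact_mod_cast hn1
  have hln : 0 < Real.log n := Real.log_pos hn1'
  have h1 := Real.log_le_log (Real.rpow_pos_of_pos (by linarith) _) h
  rw [Real.log_rpow (by linarith), div_mul_eq_mul_div, div_le_iff₀ (by positivity)] at h1
  have h2 : (1 + ϖ) * (Real.log (1 / γ) / Real.log R) * Real.log n ≤ -Real.log (2 * β) := by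
    rw [one_div, Real.log_inv, ← mul_div_assoc, div_mul_eq_mul_div, div_le_iff₀ hlR]
    linarith
  have h3 : (n : ℝ) ^ ((1 + ϖ) * (Real.log (1 / γ) / Real.log R)) ≤ 1 / (2 * β) := by
    rw [Real.rpow_def_of_pos (by linarith), mul_comm]
    refine (Real.exp_le_exp.2 h2).trans (le_of_eq ?_)
    rw [Real.exp_neg, Real.exp_log (by positivity), one_div]
  have h4 : (1 : ℝ) / (2 * β) ≤ 1 / β := one_div_le_one_div_of_le hβ0 (by linarith)
  have h5 : 0 ≤ (n : ℝ) ^ ((1 + ϖ) * (Real.log (1 / γ) / Real.log R)) :=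
    Real.rpow_nonneg (Nat.cast_nonneg n) _
  calc _ ≤ (1 / β) ^ 2 := by gcongr; exact h3.trans h4
    _ = _ := by rw [div_pow, one_pow]

theorem SASS.mem_tocAtMost_of_le {m : ℕ} {D : Type u} {Ω : Type v} {A : SASS m D}
    {ξ : ℕ × OracleCall × ℕ → Ω → D} {o : Ω} {G : Set (EuclideanSpace ℝ (Fin m))} {n : ℕ} {B : ℝ}
    (h : ∃ j ≤ n, A.iterate ξ j o ∈ G) (hB : ∀ T ≤ n, (A.TOC ξ T o : ℝ) ≤ B) :
    o ∈ A.tocAtMost ξ G B := by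
  classical
  obtain ⟨j, hj, hjG⟩ := h
  have hex : ∃ k, A.iterate ξ k o ∈ G := ⟨j, hjG⟩
  exact ⟨Nat.find hex, ⟨Nat.find_spec hex, fun k hk => Nat.find_min' hex hk⟩,
    hB _ ((Nat.find_min' hex hjG).trans hj)⟩

theorem SASS.exists_subset_tocAtMost {αbar α₀ κ τ p ϖ γ₀ a₀ a₁ ℓ₀ : ℝ} (hκ : 0 < κ)
    (hαbar : 0 < αbar) (hτ : κ * αbar ≤ τ) (hα₀ : αbar ≤ α₀) (hp : p ∈ Set.Ioo (1 / 2 : ℝ) 1)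
    (hϖ : 0 < ϖ) (hγ₀ : 0 < γ₀) (ha₀ : 0 < a₀) (ha₁ : 0 < a₁) (hℓ₀ : 0 < ℓ₀) (K : ℝ) {c : ℝ}
    (hc : c ∈ Set.Ioo (0 : ℝ) 1) :
    ∃ C > (0 : ℝ), ∀ {m : ℕ} {D : Type u} {Ω : Type v} {l : EuclideanSpace ℝ (Fin m) → D → ℝ}
      {θ γ : ℝ} {αmax : WithTop ℝ} {x₀ : EuclideanSpace ℝ (Fin m)} {σf Mc Mv ρ t ℓ : ℝ}
      {ξ : ℕ × OracleCall × ℕ → Ω → D} {G : Set (EuclideanSpace ℝ (Fin m))} {n : ℕ},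
      0 ≤ Mc → 0 ≤ Mv → 0 < t → ℓ₀ ≤ ℓ → γ ∈ Set.Ico γ₀ 1 → 1 ≤ n →
      let A := forERM l θ γ αmax x₀ α₀ κ τ σf Mc Mv ρ a₀ a₁ t
      let d := Real.logb (1 / γ) (α₀ / αbar)
      let S := {o | (∃ j ≤ n, A.iterate ξ j o ∈ G) ∧ ∀ k < n,
            αbar * (n : ℝ) ^ (-((1 + ϖ) * Real.logb (2 * (1 - p)) γ)) ≤ A.stepSize ξ k o}
      (n ≤ K * (ℓ + d) → S ⊆ A.tocAtMost ξ G (C * ((ℓ + d) * max 1 (σf ^ 2 / t ^ 2 + Mc / t +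
        Mv * ℓ ^ (2 * (1 + ϖ) * Real.logb (2 * (1 - p)) γ))))) ∧
      (n ≤ K * ℓ + d → ∀ β ∈ Set.Ioo (0 : ℝ) (1 / 2),
        max (1 / 2) ((1 / (2 * (1 - p))) ^ (Real.log (2 * β) / ((1 + ϖ) * Real.log n))) ≤ γ →
        γ ≤ (αbar / α₀) ^ (1 / (c * n)) →
        S ⊆ A.tocAtMost ξ G (C * (ℓ * max 1 (σf ^ 2 / t ^ 2 + Mc / t + Mv / β ^ 2)))) := by
  obtain ⟨hp1, hp2⟩ := hp
  obtain ⟨hc0, hc1⟩ := hc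
  set R := 1 / (2 * (1 - p)) with hR
  have hR1 : 1 < R := by
    rw [hR, one_div]; exact (one_lt_inv₀ (by linarith)).2 (by linarith)
  -- K is arbitrary; K₁ ≥ 1 makes K₁^{2a} increasing in a, so that γ₀ gives the worst case.
  set K₁ := max K 1 with hK₁
  have hK1 : 1 ≤ K₁ := le_max_right _ _
  have hKK : K ≤ K₁ := le_max_left _ _
  set CQ := K₁ ^ (2 * ((1 + ϖ) * (Real.log (1 / γ₀) / Real.log R))) *
        Real.exp (2 * ((1 + ϖ) * (Real.log (α₀ / αbar) / Real.log R)) / ℓ₀) with hCQ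
  have hCQ0 : 0 ≤ CQ := mul_nonneg (Real.rpow_nonneg (by linarith) _) (Real.exp_pos _).le
  set B₁ := 3 + 2 * a₀ + a₁ * (1 + CQ / (κ * αbar) ^ 2) with hB₁
  set B₂ := 3 + 2 * a₀ + a₁ * (1 + 1 / (κ * αbar) ^ 2) with hB₂
  have hB₁0 : 0 < B₁ := by positivity
  have hB₂0 : 0 < B₂ := by positivity
  have h1c : 0 < 1 - c := by linarith
  refine ⟨K₁ * B₁ + K₁ / (1 - c) * B₂, by positivity, ?_⟩
  intro m D Ω l θ γ αmax x₀ σf Mc Mv ρ t ℓ ξ G n hMc hMv ht hℓ hγ hn A d S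
  have hγ0 : 0 < γ := hγ₀.trans_le hγ.1
  have hb : 1 < 1 / γ := by rw [one_div]; exact (one_lt_inv₀ hγ0).2 hγ.2
  have hlγ : 0 < Real.log (1 / γ) := Real.log_pos hb
  have hlR : 0 < Real.log R := Real.log_pos hR1
  have hd0 : 0 ≤ d := Real.logb_nonneg hb ((one_le_div hαbar).2 hα₀)
  have hℓp : 0 < ℓ := hℓ₀.trans_le hℓ
  have ha_eq : (1 + ϖ) * Real.logb (2 * (1 - p)) γ =
      (1 + ϖ) * (Real.log (1 / γ) / Real.log R) := by rw [logb_two_mul_eq]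
  have ha0 : 0 ≤ (1 + ϖ) * Real.logb (2 * (1 - p)) γ := by rw [ha_eq]; positivity
  have hn1 : (1 : ℝ) ≤ n := by exact_mod_cast hn
  refine ⟨fun hnK o ho => ?_, fun hnK β hβ hγβ hγc o ho => ?_⟩
  · have hnK1 : (n : ℝ) ≤ K₁ * (ℓ + d) := hnK.trans (by gcongr)
    refine mem_tocAtMost_of_le ho.1 fun T hT => ?_
    have hQ := rpow_sq_le_of_le_mul hαbar hα₀ hϖ hγ₀ hγ hR1 hK1 hℓ₀ hℓ hnK1
    rw [← ha_eq] at hQ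
    refine (TOC_forERM_le hκ hαbar hτ hMc hMv ha₀ ha₁ ht ha0 hn hT hQ hCQ0 ho.2).trans ?_
    rw [← mul_assoc 2 (1 + ϖ) (Real.logb (2 * (1 - p)) γ)]
    set W := max 1 (σf ^ 2 / t ^ 2 + Mc / t +
        Mv * ℓ ^ (2 * (1 + ϖ) * Real.logb (2 * (1 - p)) γ)) with hW
    have hW0 : 0 ≤ W := zero_le_one.trans (le_max_left _ _)
    calc (n : ℝ) * (B₁ * W) ≤ K₁ * (ℓ + d) * (B₁ * W) := by gcongr
      _ = K₁ * B₁ * ((ℓ + d) * W) := by ring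
      _ ≤ _ := by
        gcongr
        have : 0 ≤ K₁ / (1 - c) * B₂ := by positivity
        linarith
  -- The upper bound on γ says that Λ takes at most the fraction c of n, so n ≤ Kℓ + Λ gives n ≤
  -- K₁ℓ/(1 − c).
  · have hdc : d ≤ c * n := by
      have hcn : 0 < c * n := by positivity
      have hα₀p : 0 < α₀ := hαbar.trans_le hα₀
      have h1 := Real.log_le_log hγ0 hγc
      rw [Real.log_rpow (by positivity), one_div_mul_eq_div, le_div_iff₀ hcn] at h1
      change Real.log (α₀ / αbar) / Real.log (1 / γ) ≤ c * n
      rw [div_le_iff₀ hlγ, ← inv_div αbar α₀, Real.log_inv, one_div, Real.log_inv]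
      linarith
    have hnK1 : (n : ℝ) ≤ K₁ / (1 - c) * ℓ := by
      rw [div_mul_eq_mul_div, le_div_iff₀ h1c]
      have : K * ℓ ≤ K₁ * ℓ := by gcongr
      linarith
    refine mem_tocAtMost_of_le ho.1 fun T hT => ?_
    have hQ := rpow_sq_le_inv_sq hϖ ⟨hγ0, hγ.2⟩ hR1 hn hβ ((le_max_right _ _).trans hγβ)
    rw [← ha_eq, ← one_mul (1 / β ^ 2)] at hQ
    refine (TOC_forERM_le hκ hαbar hτ hMc hMv ha₀ ha₁ ht ha0 hn hT hQ zero_le_one ho.2).trans ?_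
    rw [mul_one_div]
    set W := max 1 (σf ^ 2 / t ^ 2 + Mc / t + Mv / β ^ 2) with hW
    have hW0 : 0 ≤ W := zero_le_one.trans (le_max_left _ _)
    calc (n : ℝ) * (B₂ * W) ≤ K₁ / (1 - c) * ℓ * (B₂ * W) := by gcongr
      _ = K₁ / (1 - c) * B₂ * (ℓ * W) := by ring
      _ ≤ _ := by
        gcongr
        have : 0 ≤ K₁ * B₁ := by positivity
        linarith

/-! ### The potentials of the two cases -/

theorem isPotential_gradient_norm {m : ℕ} {φ : EuclideanSpace ℝ (Fin m) → ℝ} {L : NNReal}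
    (hf : Differentiable ℝ φ) (hL : LipschitzWith L (gradient φ))
    (hbdd : BddBelow (Set.range φ)) {ε : ℝ} (hε : 0 < ε) :
    IsPotential φ {x | ‖gradient φ x‖ ≤ ε} (fun x => (φ x - ⨅ y, φ y) / ε ^ 2) 1 1 (ε ^ 2) where
  measurableSet := (isClosed_le hL.continuous.norm continuous_const).measurableSet
  measurable := (hf.continuous.measurable.sub_const _).div_const _
  nonneg x _ := div_nonneg (sub_nonneg.2 (ciInf_le hbdd x)) (sq_nonneg ε)
  le_norm_gradient x hx := by
    rw [Real.sqrt_sq hε.le, one_mul]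
    exact (not_le.1 hx).le
  step x hx x' _ y hy e _ h := by
    have h1 : ε ≤ ‖gradient φ x‖ := (not_le.1 hx).le
    have h2 : ε ^ 2 ≤ ‖gradient φ x‖ ^ 2 := by gcongr
    have h3 : y * ε ^ 2 ≤ y * ‖gradient φ x‖ ^ 2 := by gcongr
    have hε2 : 0 < ε ^ 2 := by positivity
    rw [div_le_iff₀ hε2, add_mul, sub_mul, div_mul_cancel₀ _ hε2.ne', div_mul_cancel₀ _ hε2.ne']
    linarith

/-- By Polyak–Łojasiewicz and ε < Z, the gap ratio Z'/Z is at most 1 − 2μy + e/ε; then log u ≤ u −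
1. That x' lies outside the target keeps Z' positive. -/
theorem isPotential_log_gap {m : ℕ} {φ : EuclideanSpace ℝ (Fin m) → ℝ} {μ : ℝ} (hμ : 0 < μ)
    (hf : Differentiable ℝ φ) (hc : StrongConvexOn Set.univ μ φ) {ε : ℝ} (hε : 0 < ε) :
    IsPotential φ {x | φ x - ⨅ y, φ y ≤ ε} (fun x => Real.log ((φ x - ⨅ y, φ y) / ε))
      √(2 * μ) (2 * μ) ε where
  measurableSet :=
    (isClosed_le (hf.continuous.sub continuous_const) continuous_const).measurableSet
  measurable := ((hf.continuous.measurable.sub_const _).div_const _).log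
  nonneg x hx := Real.log_nonneg ((one_le_div hε).2 (not_le.1 hx).le)
  le_norm_gradient x hx := by
    rw [← Real.sqrt_mul (by positivity)]
    refine Real.sqrt_le_iff.2 ⟨norm_nonneg _, ?_⟩
    refine le_trans ?_ (hc.sub_iInf_le hμ hf x)
    exact mul_le_mul_of_nonneg_left (not_le.1 hx).le (by positivity)
  step x hx x' hx' y hy e he h := by
    set Z := φ x - ⨅ y, φ y with hZ
    set Z' := φ x' - ⨅ y, φ y with hZ'
    have hxε : ε < Z := not_le.1 hx
    have hxε' : ε < Z' := not_le.1 hx'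
    have hZ0 : 0 < Z := hε.trans hxε
    have hZ0' : 0 < Z' := hε.trans hxε'
    have hPL := mul_le_mul_of_nonneg_left (hc.sub_iInf_le hμ hf x) hy
    have h1 : Z' ≤ Z * (1 - 2 * μ * y) + e := by
      rw [← hZ] at hPL
      linarith
    have h2 : Real.log (Z' / Z) ≤ Z' / Z - 1 := Real.log_le_sub_one_of_pos (by positivity)
    have h3 : Z' / Z ≤ 1 - 2 * μ * y + e / ε := by
      rw [div_le_iff₀ hZ0, add_mul]
      have : e ≤ e / ε * Z := by
        rw [div_mul_eq_mul_div, le_div_iff₀ hε]; gcongr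
      linarith
    rw [Real.log_div hZ0'.ne' hε.ne', Real.log_div hZ0.ne' hε.ne']
    rw [Real.log_div hZ0'.ne' hZ0.ne'] at h2
    linarith

/-! ### Assembly of the two cases -/

theorem mainTheorem9
    (L : NNReal) (Δ θ κ τ αbar α₀ p ω γ₀ : ℝ)
    (hθ : θ ∈ Set.Ioo (0 : ℝ) 1) (hκ : 0 < κ)
    (hαbar : 0 < αbar) (hαbar_le : αbar ≤ (1 - θ) / (L / 2 + κ)) (hτ : κ * αbar ≤ τ)
    (hα₀ : αbar ≤ α₀)
    (hp : p ∈ Set.Ioo (1 / 2 : ℝ) 1) (hω : 0 < ω) (hγ₀ : γ₀ ∈ Set.Ioc (0 : ℝ) (1 / 2)) :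
    -- the non-convex case
    (∀ εmax : ℝ, 0 < εmax →
      ∃ ρmax > (0 : ℝ), ∀ ρ ∈ Set.Ioc (0 : ℝ) ρmax,
      ∃ amin > (0 : ℝ), ∀ a₀ ≥ amin, ∀ a₁ ≥ amin,
      ∃ C₁ > (0 : ℝ), ∀ K c : ℝ, c ∈ Set.Ioo (0 : ℝ) 1 →
      ∃ C > (0 : ℝ), ∀ σf ν b : ℝ, 0 ≤ σf →
      ∃ C₃ > (0 : ℝ), ∃ C₄ : ℝ,
      ∀ (m : ℕ) (D : Type u) [MeasurableSpace D] (𝒟 : Measure D)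
        (l : EuclideanSpace ℝ (Fin m) → D → ℝ) (Mc Mv : ℝ), 0 ≤ Mc → 0 ≤ Mv →
        ERMAssumptions 𝒟 l L σf ν b Mc Mv →
      ∀ (x₀ : EuclideanSpace ℝ (Fin m)), expectedRisk 𝒟 l x₀ - ⨅ x, expectedRisk 𝒟 l x ≤ Δ →
      ∀ (Ω : Type v) [MeasurableSpace Ω] (P : Measure Ω) [IsProbabilityMeasure P]
        (ξ : ℕ × OracleCall × ℕ → Ω → D), IsIIDSampling P 𝒟 ξ →
      ∀ (αmax : WithTop ℝ), (α₀ : WithTop ℝ) ≤ αmax →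
      ∀ γ ∈ Set.Ico γ₀ 1, ∀ ε ∈ Set.Ioc 0 εmax,
        let A := SASS.forERM l θ γ αmax x₀ α₀ κ τ σf Mc Mv ρ a₀ a₁ (ε ^ 2)
        let G := {x | ‖gradient (expectedRisk 𝒟 l) x‖ ≤ ε}
        let d := Real.logb (1 / γ) (α₀ / αbar)
        -- before stopping, an iteration with `α ≤ αbar` is successful with probability at least `p`
        (∀ k, ∀ x ∉ G, ∀ α ∈ Set.Ioc 0 αbar,
          p ≤ P.real {o | A.Successful (SASS.samples ξ k o) x α}) ∧
        ∀ n : ℕ, C₁ / ε ^ 2 + d ≤ n →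
          (n ≤ K * (1 / ε ^ 2 + d) →
            1 - 2 * Real.exp (-C₃ * n) - C₄ * (n : ℝ) ^ (-ω) ≤
              P.real (A.tocAtMost ξ G
                (C * ((1 / ε ^ 2 + d) *
                  max 1 (σf ^ 2 / ε ^ 4 + Mc / ε ^ 2 +
                    Mv / ε ^ (4 * (1 + ω) * Real.logb (2 * (1 - p)) γ)))))) ∧
          (n ≤ K / ε ^ 2 + d → ∀ β ∈ Set.Ioo (0 : ℝ) (1 / 2),
            max (1 / 2) ((1 / (2 * (1 - p))) ^ (Real.log (2 * β) / ((1 + ω) * Real.log n))) ≤ γ →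
            γ ≤ (αbar / α₀) ^ (1 / (c * n)) →
            1 - 2 * Real.exp (-C₃ * n) - C₄ * (n : ℝ) ^ (-ω) ≤
              P.real (A.tocAtMost ξ G
                (C * (1 / ε ^ 2 *
                  max 1 (σf ^ 2 / ε ^ 4 + Mc / ε ^ 2 + Mv / β ^ 2)))))) ∧
    -- the strongly convex case
    (∀ εmax μ : ℝ, εmax ∈ Set.Ioo (0 : ℝ) 1 → 0 < μ →
      ∃ ρmax > (0 : ℝ), ∀ ρ ∈ Set.Ioc (0 : ℝ) ρmax,
      ∃ amin > (0 : ℝ), ∀ a₀ ≥ amin, ∀ a₁ ≥ amin,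
      ∃ C₂ > (0 : ℝ), ∀ K c : ℝ, c ∈ Set.Ioo (0 : ℝ) 1 →
      ∃ C > (0 : ℝ), ∀ σf ν b : ℝ, 0 ≤ σf →
      ∃ C₃ > (0 : ℝ), ∃ C₄ : ℝ,
      ∀ (m : ℕ) (D : Type u) [MeasurableSpace D] (𝒟 : Measure D)
        (l : EuclideanSpace ℝ (Fin m) → D → ℝ) (Mc Mv : ℝ), 0 ≤ Mc → 0 ≤ Mv →
        ERMAssumptions 𝒟 l L σf ν b Mc Mv →
        StrongConvexOn Set.univ μ (expectedRisk 𝒟 l) →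
      ∀ (x₀ : EuclideanSpace ℝ (Fin m)), expectedRisk 𝒟 l x₀ - ⨅ x, expectedRisk 𝒟 l x ≤ Δ →
      ∀ (Ω : Type v) [MeasurableSpace Ω] (P : Measure Ω) [IsProbabilityMeasure P]
        (ξ : ℕ × OracleCall × ℕ → Ω → D), IsIIDSampling P 𝒟 ξ →
      ∀ (αmax : WithTop ℝ), (α₀ : WithTop ℝ) ≤ αmax →
      ∀ γ ∈ Set.Ico γ₀ 1, ∀ ε ∈ Set.Ioc 0 εmax,
        let A := SASS.forERM l θ γ αmax x₀ α₀ κ τ σf Mc Mv ρ a₀ a₁ ε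
        let G := {x | expectedRisk 𝒟 l x - ⨅ y, expectedRisk 𝒟 l y ≤ ε}
        let d := Real.logb (1 / γ) (α₀ / αbar)
        (∀ k, ∀ x ∉ G, ∀ α ∈ Set.Ioc 0 αbar,
          p ≤ P.real {o | A.Successful (SASS.samples ξ k o) x α}) ∧
        ∀ n : ℕ, C₂ * Real.log (1 / ε) + d ≤ n →
          (n ≤ K * (Real.log (1 / ε) + d) →
            1 - 2 * Real.exp (-C₃ * n) - C₄ * (n : ℝ) ^ (-ω) ≤
              P.real (A.tocAtMost ξ G
                (C * ((Real.log (1 / ε) + d) *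
                  max 1 (σf ^ 2 / ε ^ 2 + Mc / ε +
                    Mv * Real.log (1 / ε) ^ (2 * (1 + ω) * Real.logb (2 * (1 - p)) γ)))))) ∧
          (n ≤ K * Real.log (1 / ε) + d → ∀ β ∈ Set.Ioo (0 : ℝ) (1 / 2),
            max (1 / 2) ((1 / (2 * (1 - p))) ^ (Real.log (2 * β) / ((1 + ω) * Real.log n))) ≤ γ →
            γ ≤ (αbar / α₀) ^ (1 / (c * n)) →
            1 - 2 * Real.exp (-C₃ * n) - C₄ * (n : ℝ) ^ (-ω) ≤
              P.real (A.tocAtMost ξ G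
                (C * (Real.log (1 / ε) *
                  max 1 (σf ^ 2 / ε ^ 2 + Mc / ε + Mv / β ^ 2)))))) := by
  refine ⟨fun εmax hεmax => ?_, fun εmax μ hεmax hμ => ?_⟩
  · have hℓ₀ : 0 < 1 / εmax ^ 2 := by positivity
    -- Here ℓ = 1/ε², bounded below by ℓ₀ = 1/εmax², and Φ(x₀) ≤ max Δ 0 · ℓ; the maximum is taken
    -- because the sign of Δ is not given.
    obtain ⟨ρmax, hρmax, hcore⟩ := SASS.exists_reach_and_stepSize.{u, v} L θ κ τ αbar α₀ p ω γ₀ 1 1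
      (max Δ 0) (1 / εmax ^ 2) (εmax ^ 2) hθ hκ hαbar hαbar_le hτ hα₀ hp hω hγ₀.1 one_pos one_pos
      (le_max_right _ _) hℓ₀ (by positivity)
    refine ⟨ρmax, hρmax, fun ρ hρ => ?_⟩
    obtain ⟨amin, hamin, hcore⟩ := hcore ρ hρ
    refine ⟨amin, hamin, fun a₀ ha₀ a₁ ha₁ => ?_⟩
    obtain ⟨C₁, hC₁, hcore⟩ := hcore a₀ ha₀ a₁ ha₁
    refine ⟨C₁, hC₁, fun K c hc => ?_⟩
    obtain ⟨C, hC, htoc⟩ := SASS.exists_subset_tocAtMost.{u, v} hκ hαbar hτ hα₀ hp hω hγ₀.1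
      (hamin.trans_le ha₀) (hamin.trans_le ha₁) hℓ₀ K hc
    refine ⟨C, hC, fun σf ν b hσ => ?_⟩
    obtain ⟨C₃, hC₃, C₄, hcore⟩ := hcore σf ν b hσ
    refine ⟨C₃, hC₃, C₄, ?_⟩
    intro m D _ 𝒟 l Mc Mv hMc hMv h x₀ hΔ Ω _ P _ ξ hξ αmax hmax γ hγ ε hε A G d
    obtain ⟨hε0, hεm⟩ := hε
    have hℓ : 1 / εmax ^ 2 ≤ 1 / ε ^ 2 := by gcongr
    have hpot := isPotential_gradient_norm h.differentiable_risk h.lipschitz_gradient h.bddBelow hε0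
    obtain ⟨hsucc, hprob⟩ := hcore m D 𝒟 l Mc Mv hMc hMv h x₀ Ω P ξ hξ αmax hmax γ hγ (ε ^ 2)
      ⟨by positivity, by gcongr⟩ G _ (1 / ε ^ 2) hpot (fun _ => by
        rw [div_eq_mul_one_div]
        gcongr
        exact hΔ.trans (le_max_left _ _)) hℓ
    refine ⟨fun k x _ α hα => hsucc k x α hα, fun n hn => ?_⟩
    have hd0 : 0 ≤ d := by
      have hγ0 : 0 < γ := hγ₀.1.trans_le hγ.1
      exact Real.logb_nonneg (by rw [one_div]; exact (one_lt_inv₀ hγ0).2 hγ.2)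
        ((one_le_div hαbar).2 hα₀)
    have hn1 : 1 ≤ n := by
      have h1 : 0 < C₁ / ε ^ 2 := by positivity
      have : (0 : ℝ) < n := by linarith
      exact_mod_cast this
    have hpr := hprob n (by rw [mul_one_div]; exact hn)
    obtain ⟨ht1, ht2⟩ := htoc (l := l) (θ := θ) (αmax := αmax) (x₀ := x₀) (σf := σf) (ρ := ρ)
      (ξ := ξ) (G := G) hMc hMv (show 0 < ε ^ 2 by positivity) hℓ hγ hn1
    have e1 : (ε ^ 2) ^ 2 = ε ^ 4 := by ring
    have e2 : Mv * (1 / ε ^ 2) ^ (2 * (1 + ω) * Real.logb (2 * (1 - p)) γ) =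
        Mv / ε ^ (4 * (1 + ω) * Real.logb (2 * (1 - p)) γ) := by
      rw [Real.div_rpow zero_le_one (by positivity), Real.one_rpow, mul_one_div,
        ← Real.rpow_natCast, ← Real.rpow_mul hε0.le]
      congr 2
      push_cast
      ring
    rw [e1, e2] at ht1
    rw [e1] at ht2
    refine ⟨fun hnK => hpr.trans (measureReal_mono (ht1 hnK)), fun hnK β hβ h1 h2 =>
      hpr.trans (measureReal_mono (ht2 (by rw [mul_one_div]; exact hnK) β hβ h1 h2))⟩
  · have hℓ₀ : 0 < Real.log (1 / εmax) :=
      Real.log_pos (by rw [one_div]; exact (one_lt_inv₀ hεmax.1).2 hεmax.2)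
    -- Here ℓ = log(1/ε), and εmax < 1 makes ℓ₀ positive. Since Φ(x₀) ≤ |log Δ| + ℓ, the constant
    -- |log Δ| is converted into a multiple of ℓ through ℓ ≥ ℓ₀.
    obtain ⟨ρmax, hρmax, hcore⟩ := SASS.exists_reach_and_stepSize.{u, v} L θ κ τ αbar α₀ p ω γ₀
      √(2 * μ) (2 * μ) (|Real.log Δ| / Real.log (1 / εmax) + 1) (Real.log (1 / εmax)) εmax
      hθ hκ hαbar hαbar_le hτ hα₀ hp hω hγ₀.1 (Real.sqrt_pos.2 (by positivity)) (by positivity)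
      (by positivity) hℓ₀ hεmax.1
    refine ⟨ρmax, hρmax, fun ρ hρ => ?_⟩
    obtain ⟨amin, hamin, hcore⟩ := hcore ρ hρ
    refine ⟨amin, hamin, fun a₀ ha₀ a₁ ha₁ => ?_⟩
    obtain ⟨C₁, hC₁, hcore⟩ := hcore a₀ ha₀ a₁ ha₁
    refine ⟨C₁, hC₁, fun K c hc => ?_⟩
    obtain ⟨C, hC, htoc⟩ := SASS.exists_subset_tocAtMost.{u, v} hκ hαbar hτ hα₀ hp hω hγ₀.1
      (hamin.trans_le ha₀) (hamin.trans_le ha₁) hℓ₀ K hc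
    refine ⟨C, hC, fun σf ν b hσ => ?_⟩
    obtain ⟨C₃, hC₃, C₄, hcore⟩ := hcore σf ν b hσ
    refine ⟨C₃, hC₃, C₄, ?_⟩
    intro m D _ 𝒟 l Mc Mv hMc hMv h hconv x₀ hΔ Ω _ P _ ξ hξ αmax hmax γ hγ ε hε A G d
    obtain ⟨hε0, hεm⟩ := hε
    have hℓ : Real.log (1 / εmax) ≤ Real.log (1 / ε) :=
      Real.log_le_log (one_div_pos.2 hεmax.1) (one_div_le_one_div_of_le hε0 hεm)
    have hpot := isPotential_log_gap hμ h.differentiable_risk hconv hε0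
    obtain ⟨hsucc, hprob⟩ := hcore m D 𝒟 l Mc Mv hMc hMv h x₀ Ω P ξ hξ αmax hmax γ hγ ε
      ⟨hε0, hεm⟩ G _ (Real.log (1 / ε)) hpot (fun hx₀ => by
        have h1 : ε < expectedRisk 𝒟 l x₀ - ⨅ y, expectedRisk 𝒟 l y := not_le.1 hx₀
        have hgap := hε0.trans h1
        rw [div_eq_mul_one_div, Real.log_mul hgap.ne' (one_div_pos.2 hε0).ne', add_mul, one_mul]
        have h2 : Real.log (expectedRisk 𝒟 l x₀ - ⨅ y, expectedRisk 𝒟 l y) ≤ |Real.log Δ| :=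
          (Real.log_le_log hgap hΔ).trans (le_abs_self _)
        have h3 : |Real.log Δ| ≤ |Real.log Δ| / Real.log (1 / εmax) * Real.log (1 / ε) := by
          rw [div_mul_eq_mul_div, le_div_iff₀ hℓ₀]
          gcongr
        linarith) hℓ
    refine ⟨fun k x _ α hα => hsucc k x α hα, fun n hn => ?_⟩
    have hd0 : 0 ≤ d := by
      have hγ0 : 0 < γ := hγ₀.1.trans_le hγ.1
      exact Real.logb_nonneg (by rw [one_div]; exact (one_lt_inv₀ hγ0).2 hγ.2)
        ((one_le_div hαbar).2 hα₀)
    have hn1 : 1 ≤ n := by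
      have h1 : 0 < C₁ * Real.log (1 / ε) := mul_pos hC₁ (hℓ₀.trans_le hℓ)
      have : (0 : ℝ) < n := by linarith
      exact_mod_cast this
    have hpr := hprob n hn
    obtain ⟨ht1, ht2⟩ := htoc (l := l) (θ := θ) (αmax := αmax) (x₀ := x₀) (σf := σf) (ρ := ρ)
      (ξ := ξ) (G := G) hMc hMv hε0 hℓ hγ hn1
    exact ⟨fun hnK => hpr.trans (measureReal_mono (ht1 hnK)), fun hnK β hβ h1 h2 =>
      hpr.trans (measureReal_mono (ht2 hnK β hβ h1 h2))⟩
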